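/- Let $\mathbb K$ be $\mathbb R$ or $\mathbb C$, and let $(\mathfrak g,[-,-])$ be a (left) Leibniz algebra over $\mathbb K$, i.e. $[x,[y,z]]=[[x,y],z]+[y,[x,z]]$. Let $K=\operatorname{span}\{[x,y]+[y,x]\}$ be its Leibniz kernel and $\mathfrak g_{\mathrm{Lie}}=\mathfrak g/K$ the associated Lie algebra. Let $L_{\mathfrak g}$ be the hemistrict Lie 2-algebra on the 2-term complex $K\hookrightarrow\mathfrak g$ ($K$ in degree $-1$, $\mathfrak g$ in degree $0$) with bracket induced by $[-,-]$ and alternator $h_2(x,y)=[x,y]+[y,x]\in K$. Let $\mathcal G=(K[1]\hookrightarrow\mathfrak g,\tilde l_2,\tilde l_3)$ be the semistrict Lie 2-algebra obtained by skew-symmetrization: $\tilde l_2(x,y)=\tfrac12([x,y]-[y,x])$, $\tilde l_2(x,\alpha)=-\tilde l_2(\alpha,x)=\tfrac12[x,\alpha]$ and $\tilde l_3(x,y,z)=-\tfrac16\big(h_2(\tilde l_2(x,y),z)+h_2(\tilde l_2(y,z),x)+h_2(\tilde l_2(z,x),y)\big)$ for $x,y,z\in\mathfrak g$, $\alpha\in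 K$. Let $V=(V^{-1}\xrightarrow{d}V^0,\,l,r,h_v)$ be a representation of $L_{\mathfrak g}$ on a 2-term complex. That is, $l\colon L^i\otimes V^j\to V^{i+j}$ and $r\colon V^j\otimes L^i\to V^{i+j}$ (where $L^{-1}=K$, $L^0=\mathfrak g$) are cochain maps, $h_v\colon \mathfrak g\otimes V^0\to V^{-1}$ is linear, $l$ is a left representation of the dg Leibniz algebra $K[1]\hookrightarrow\mathfrak g$, one has $l(x,v)+r(v,x)=d(h_v)(x,v)$ for all $x\in L^\bullet$, $v\in V^\bullet$, and for $x,y\in\mathfrak g$, $v\in V^0$: $r(h_v(x,v),y)=0$, $l(h_2(x,y),v)=0$, $l(x,h_v(y,v))=h_v([x,y],v)+h_v(y,l(x,v))$. Assume that $l_\alpha=0\colon V^0\to V^{-1}$ for all $\alpha\in K$ (placed in degree $-1$). Then $l$ makes $V$ a representation of $\mathcal G$ and a 2-term complex of $\mathfrak g_{\mathrm{Lie}}$-modules. Consider the following three complexes; in each, degree $n$ is the sum of a $V^{-1}$-part (with $m=n+1$) and a $V^0$-part (with $m=n$). * $C^\bullet(L_{\mathfrak g},V)$: families of multilinear maps $\omega_k(x_1,\dots,x_{m-2k}\mid\alpha_1,\dots,\alpha_k)$,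 $x_i\in\mathfrak g$, $\alpha_j\in K$, symmetric in the $\alpha_j$, with $\omega_k(\dots,x_i,x_{i+1},\dots\mid\cdots)+\omega_k(\dots,x_{i+1},x_i,\dots\mid\cdots)=-\omega_{k+1}(\dots,\widehat{x_i},\widehat{x_{i+1}},\dots\mid h_2(x_i,x_{i+1}),\cdots)$, equipped with the Loday–Pirashvili differential of the symmetric representation $(V,l,-l)$. * $C^\bullet(\mathcal G,V)$: families of multilinear maps on $\wedge^{m-2k}\mathfrak g\otimes S^kK$, with the Chevalley–Eilenberg differential of $\mathcal G$ with coefficients in $V$ (the sum of the terms dual to $d_V$, to $K\hookrightarrow\mathfrak g$, to $\tilde l_2$, to $\tilde l_3$ and to the action $l$). * the Chevalley–Eilenberg complex with terms $\operatorname{Hom}(\wedge^{n+1}\mathfrak g_{\mathrm{Lie}},V^{-1})\oplus\operatorname{Hom}(\wedge^{n}\mathfrak g_{\mathrm{Lie}},V^0)$ and differential $d_V+d_{\mathrm{CE}}$. Then for every $n\in\mathbb Z$ there are isomorphisms of $\mathbb K$-vector spaces $$H^n(L_{\mathfrak g},V)\;\cong\;H^n(\mathcal G,V)\;\cong\;H^n_{\mathrm{CE}}(\mathfrak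 g_{\mathrm{Lie}},V).$$ -/

import Mathlib

namespace LieTwo

/-! ### Cohomology of a graded subspace with respect to a differential -/

/-- The degree `n` cohomology of the graded subspaces `C n ⊆ E` with respect to `D : E → E`:
cocycles `{ω ∈ C n | D ω = 0}` modulo coboundaries `D (C (n - 1))`. -/
abbrev Cohomology {𝕂 E : Type*} [Field 𝕂] [AddCommGroup E] [Module 𝕂 E]
    (C : ℤ → Submodule 𝕂 E) (D : E →ₗ[𝕂] E) (n : ℤ) : Type _ :=
  ↥(C n ⊓ LinearMap.ker D) ⧸ ((C (n - 1)).map D).submoduleOf (C n ⊓ LinearMap.ker D)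

/-! ### Families of cochains and the operators out of which differentials are built -/

/-- Families `η = (η_a)` of functions of `a` arguments in `M`, with values in `V`. -/
abbrev Fam₁ (M V : Type*) : Type _ := (a : ℕ) → (Fin a → M) → V

/-- Families `η = (η_{a,k})`, where `η_{a,k}(x₁, …, x_a ∣ α₁, …, α_k)` is a function of `a`
arguments in `M` (degree `0` elements) and `k` arguments in `N` (degree `-1` elements). -/
abbrev Fam (M N V : Type*) : Type _ := (a k : ℕ) → (Fin a → M) → (Fin k → N) → V

section Operators

variable {𝕂 M N V W : Type*} [Field 𝕂] [AddCommGroup M] [Module 𝕂 M] [AddCommGroup N] [Module 𝕂 N]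
  [AddCommGroup V] [Module 𝕂 V] [AddCommGroup W] [Module 𝕂 W]

/-- The Loday-Pirashvili differential with coefficients in the symmetric module `(V, ρ, -ρ)`:
`∑_i (-1)^{i+1} ρ(x_i) η(…, x̂_i, …) + ∑_{i<j} (-1)^i η(…, x̂_i, …, [x_i, x_j], …)`
(with `1`-based `i`, and `[x_i, x_j]` in the place of `x_j`).
On alternating cochains, and for a skew bracket, this is the Chevalley-Eilenberg differential. -/
def lpDifferential (br : M →ₗ[𝕂] M →ₗ[𝕂] M) (ρ : M →ₗ[𝕂] Module.End 𝕂 V) :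
    Fam₁ M V →ₗ[𝕂] Fam₁ M V where
  toFun η := fun a => match a with
    | 0 => fun _ => 0
    | a + 1 => fun x =>
        ∑ i : Fin (a + 1), (-1 : 𝕂) ^ (i : ℕ) • ρ (x i) (η a (i.removeNth x)) +
        ∑ i : Fin (a + 1), ∑ j ∈ Finset.Ioi i, (-1 : 𝕂) ^ ((i : ℕ) + 1) •
          η a (i.removeNth (Function.update x j (br (x i) (x j))))
  map_add' η θ := by
    funext a x
    cases a with
    | zero => simp
    | succ a => simp only [Pi.add_apply, map_add, smul_add, Finset.sum_add_distrib]; abel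
  map_smul' c η := by
    funext a x
    cases a with
    | zero => simp
    | succ a =>
      simp only [Pi.smul_apply, map_smul, smul_add, Finset.smul_sum, RingHom.id_apply,
        smul_comm c]

/-- `lpDifferential` applied in the `M`-arguments, the `N`-arguments being fixed. -/
def lpTerm (br : M →ₗ[𝕂] M →ₗ[𝕂] M) (ρ : M →ₗ[𝕂] Module.End 𝕂 V) :
    Fam M N V →ₗ[𝕂] Fam M N V where
  toFun η := fun a k x α => lpDifferential br ρ (fun b y => η b k y α) a x
  map_add' η θ := by
    funext a k x α
    exact congrFun (congrFun ((lpDifferential br ρ).map_add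
      (fun b y => η b k y α) (fun b y => θ b k y α)) a) x
  map_smul' c η := by
    funext a k x α
    exact congrFun (congrFun ((lpDifferential br ρ).map_smul c (fun b y => η b k y α)) a) x

/-- `∑_i η(d α_i, x₁, …, x_a ∣ …, α̂_i, …)`. -/
def insertTerm (d : N →ₗ[𝕂] M) : Fam M N V →ₗ[𝕂] Fam M N V where
  toFun η := fun a k => match k with
    | 0 => fun _ _ => 0
    | k + 1 => fun x α => ∑ i : Fin (k + 1),
        η (a + 1) k (Fin.cons (d (α i)) x : Fin (a + 1) → M) (i.removeNth α)
  map_add' η θ := by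
    funext a k x α
    cases k <;> simp [Finset.sum_add_distrib]
  map_smul' c η := by
    funext a k x α
    cases k <;> simp [Finset.smul_sum]

/-- `∑_i ∑_j (-1)^{i+1} η(…, x̂_i, … ∣ …, m(α_j, x_i), …)` (with `1`-based `i`). -/
def mixedTerm (m : N →ₗ[𝕂] M →ₗ[𝕂] N) : Fam M N V →ₗ[𝕂] Fam M N V where
  toFun η := fun a k => match a with
    | 0 => fun _ _ => 0
    | a + 1 => fun x α => ∑ i : Fin (a + 1), ∑ j : Fin k, (-1 : 𝕂) ^ (i : ℕ) •
        η a k (i.removeNth x) (Function.update α j (m (α j) (x i)))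
  map_add' η θ := by
    funext a k x α
    cases a <;> simp [Finset.sum_add_distrib]
  map_smul' c η := by
    funext a k x α
    cases a <;> simp [Finset.smul_sum, smul_comm c]

/-- `∑_{i<j<m} (-1)^{i+j+m} η(…, x̂_i, …, x̂_j, …, x̂_m, … ∣ t(x_i, x_j, x_m), α₁, …, α_k)`
with `1`-based `i, j, m`. Here the entries are removed one after the other, so that with `0`-based
positions `i`, `j`, `m` in the successively shortened tuples the condition reads `i ≤ j ≤ m` and the
sign is `(-1)^{i+j+m}`. -/
def ternaryTerm (t : M →ₗ[𝕂] M →ₗ[𝕂] M →ₗ[𝕂] N) : Fam M N V →ₗ[𝕂] Fam M N V where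
  toFun η := fun a k => match a with
    | 0 => fun _ _ => 0
    | 1 => fun _ _ => 0
    | 2 => fun _ _ => 0
    | a + 3 => fun x α => ∑ i : Fin (a + 3), ∑ j : Fin (a + 2), ∑ m : Fin (a + 1),
        if (i : ℕ) ≤ j ∧ (j : ℕ) ≤ m then
          (-1 : 𝕂) ^ ((i : ℕ) + j + m) •
            η a (k + 1) (m.removeNth (j.removeNth (i.removeNth x)))
              (Fin.cons (t (x i) (i.removeNth x j) (j.removeNth (i.removeNth x) m)) α :
                Fin (k + 1) → N)
        else 0
  map_add' η θ := by
    funext a k x α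
    match a with
    | 0 => simp
    | 1 => simp
    | 2 => simp
    | a + 3 =>
      simp only [Pi.add_apply, ← Finset.sum_add_distrib]
      refine Finset.sum_congr rfl fun i _ => Finset.sum_congr rfl fun j _ =>
        Finset.sum_congr rfl fun m _ => ?_
      split_ifs <;> simp
  map_smul' c η := by
    funext a k x α
    match a with
    | 0 => simp
    | 1 => simp
    | 2 => simp
    | a + 3 =>
      simp only [Pi.smul_apply, Finset.smul_sum, RingHom.id_apply]
      refine Finset.sum_congr rfl fun i _ => Finset.sum_congr rfl fun j _ =>
        Finset.sum_congr rfl fun m _ => ?_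
      split_ifs <;> simp [smul_comm c]

/-- `(-1)^a f(η(x₁, …, x_a))`. -/
def coeffTerm₁ (f : V →ₗ[𝕂] W) : Fam₁ M V →ₗ[𝕂] Fam₁ M W where
  toFun η := fun a x => (-1 : 𝕂) ^ a • f (η a x)
  map_add' η θ := by funext a x; simp
  map_smul' c η := by funext a x; simp [smul_comm c]

/-- `(-1)^a f(η(x₁, …, x_a ∣ α₁, …, α_k))`. -/
def coeffTerm (f : V →ₗ[𝕂] W) : Fam M N V →ₗ[𝕂] Fam M N W where
  toFun η := fun a k x α => (-1 : 𝕂) ^ a • f (η a k x α)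
  map_add' η θ := by funext a k x α; simp
  map_smul' c η := by funext a k x α; simp [smul_comm c]

/-- `(-1)^{a+1} ∑_j l(α_j, η(x₁, …, x_a ∣ …, α̂_j, …))`. -/
def innerTerm (l : N →ₗ[𝕂] V →ₗ[𝕂] W) : Fam M N V →ₗ[𝕂] Fam M N W where
  toFun η := fun a k => match k with
    | 0 => fun _ _ => 0
    | k + 1 => fun x α => (-1 : 𝕂) ^ (a + 1) •
        ∑ j : Fin (k + 1), l (α j) (η a k x (j.removeNth α))
  map_add' η θ := by
    funext a k x α
    cases k with
    | zero => simp
    | succ k => simp only [Pi.add_apply, map_add, Finset.sum_add_distrib, smul_add]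
  map_smul' c η := by
    funext a k x α
    cases k with
    | zero => simp
    | succ k =>
      simp only [Pi.smul_apply, map_smul, ← Finset.smul_sum, RingHom.id_apply, smul_comm c]

end Operators

section CochainSpaces

variable (𝕂 : Type*) {M N : Type*} (V : Type*) [Field 𝕂] [AddCommGroup M] [Module 𝕂 M]
  [AddCommGroup N] [Module 𝕂 N] [AddCommGroup V] [Module 𝕂 V]

variable (M N) in
/-- Families concentrated in `a + 2 k = n`, all of whose members are multilinear, and symmetric in
the `N`-arguments: `∏_{a + 2k = n} Hom(M^{⊗ a} ⊗ S^k N, V)`. -/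
def multilinearCochains (n : ℤ) : Submodule 𝕂 (Fam M N V) where
  carrier := {η | (∀ a k : ℕ, (a : ℤ) + 2 * k ≠ n → η a k = 0) ∧
    (∀ a k : ℕ, ∃ F : MultilinearMap 𝕂 (fun _ : Fin a => M)
      (MultilinearMap 𝕂 (fun _ : Fin k => N) V), ∀ x α, η a k x α = F x α) ∧
    ∀ (a k : ℕ) (x : Fin a → M) (α : Fin k → N) (σ : Equiv.Perm (Fin k)),
      η a k x (α ∘ σ) = η a k x α}
  add_mem' := by
    rintro η θ ⟨h₁, h₂, h₃⟩ ⟨h₁', h₂', h₃'⟩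
    refine ⟨fun a k h => ?_, fun a k => ?_, fun a k x α σ => ?_⟩
    · simp [h₁ a k h, h₁' a k h]
    · obtain ⟨F, hF⟩ := h₂ a k
      obtain ⟨G, hG⟩ := h₂' a k
      exact ⟨F + G, fun x α => by simp [hF, hG]⟩
    · simp [h₃, h₃']
  zero_mem' := ⟨fun _ _ _ => rfl, fun _ _ => ⟨0, fun _ _ => rfl⟩, fun _ _ _ _ _ => rfl⟩
  smul_mem' := by
    rintro c η ⟨h₁, h₂, h₃⟩
    refine ⟨fun a k h => ?_, fun a k => ?_, fun a k x α σ => ?_⟩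
    · simp [h₁ a k h]
    · obtain ⟨F, hF⟩ := h₂ a k
      exact ⟨c • F, fun x α => by simp [hF]⟩
    · simp [h₃]

/-- The weakly symmetric cochains of degree `n`: elements `η` of `multilinearCochains` with
`η_k(…, x_i, x_{i+1}, … ∣ …) + η_k(…, x_{i+1}, x_i, … ∣ …)
  = - η_{k+1}(…, x̂_i, x̂_{i+1}, … ∣ h(x_i, x_{i+1}), …)`.
These are the linear maps to `V` on the degree `-n` part of the universal enveloping algebra of the
graded Lie algebra `M[1] ⊕ N[2]` with bracket `h`. -/
def weakCochains (h : M →ₗ[𝕂] M →ₗ[𝕂] N) (n : ℤ) : Submodule 𝕂 (Fam M N V) where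
  carrier := {η | η ∈ multilinearCochains 𝕂 M N V n ∧
    ∀ (a k : ℕ) (i : Fin (a + 1)) (x : Fin (a + 2) → M) (α : Fin k → N),
      η (a + 2) k x α + η (a + 2) k (x ∘ Equiv.swap i.castSucc i.succ) α =
        - η a (k + 1) (i.removeNth (i.castSucc.removeNth x))
            (Fin.cons (h (x i.castSucc) (x i.succ)) α : Fin (k + 1) → N)}
  add_mem' := by
    rintro η θ ⟨h₁, h₂⟩ ⟨h₁', h₂'⟩
    refine ⟨add_mem h₁ h₁', fun a k i x α => ?_⟩
    have := h₂ a k i x α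
    have := h₂' a k i x α
    simp only [Pi.add_apply, neg_add]
    rw [← h₂ a k i x α, ← h₂' a k i x α]
    abel
  zero_mem' := ⟨zero_mem _, fun _ _ _ _ _ => by simp⟩
  smul_mem' := by
    rintro c η ⟨h₁, h₂⟩
    refine ⟨Submodule.smul_mem _ c h₁, fun a k i x α => ?_⟩
    simp only [Pi.smul_apply]
    rw [← smul_add, h₂ a k i x α, smul_neg]

variable (M N) in
/-- `∏_{a + 2k = n} Hom(⋀^a M ⊗ S^k N, V)`. -/
def alternatingCochains (n : ℤ) : Submodule 𝕂 (Fam M N V) where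
  carrier := {η | η ∈ multilinearCochains 𝕂 M N V n ∧
    ∀ (a k : ℕ) (x : Fin a → M) (α : Fin k → N) (i j : Fin a), x i = x j → i ≠ j →
      η a k x α = 0}
  add_mem' := by
    rintro η θ ⟨h₁, h₂⟩ ⟨h₁', h₂'⟩
    refine ⟨add_mem h₁ h₁', fun a k x α i j hx hij => ?_⟩
    simp [h₂ a k x α i j hx hij, h₂' a k x α i j hx hij]
  zero_mem' := ⟨zero_mem _, fun _ _ _ _ _ _ _ _ => rfl⟩
  smul_mem' := by
    rintro c η ⟨h₁, h₂⟩
    refine ⟨Submodule.smul_mem _ c h₁, fun a k x α i j hx hij => ?_⟩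
    simp [h₂ a k x α i j hx hij]

variable (M) in
/-- `Hom(⋀^n M, V)`, as families concentrated in `a = n`. -/
def alternatingCochains₁ (n : ℤ) : Submodule 𝕂 (Fam₁ M V) where
  carrier := {η | (∀ a : ℕ, (a : ℤ) ≠ n → η a = 0) ∧
    ∀ a : ℕ, ∃ F : M [⋀^Fin a]→ₗ[𝕂] V, ∀ x, η a x = F x}
  add_mem' := by
    rintro η θ ⟨h₁, h₂⟩ ⟨h₁', h₂'⟩
    refine ⟨fun a h => ?_, fun a => ?_⟩
    · simp [h₁ a h, h₁' a h]
    · obtain ⟨F, hF⟩ := h₂ a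
      obtain ⟨G, hG⟩ := h₂' a
      exact ⟨F + G, fun x => by simp [hF, hG]⟩
  zero_mem' := ⟨fun _ _ => rfl, fun _ => ⟨0, fun _ => rfl⟩⟩
  smul_mem' := by
    rintro c η ⟨h₁, h₂⟩
    refine ⟨fun a h => ?_, fun a => ?_⟩
    · simp [h₁ a h]
    · obtain ⟨F, hF⟩ := h₂ a
      exact ⟨c • F, fun x => by simp [hF]⟩

end CochainSpaces

/-! ### Hemistrict Lie 2-algebras, their representations and their standard complexes -/

/-- A hemistrict Lie 2-algebra on the 2-term complex `d : L₁ → L₀`, with `L₁` in degree `-1` and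
`L₀` in degree `0`. The components of the bracket are `br₀₀ x y = [x, y]`, `br₀₁ x α = [x, α]` and
`br₁₀ α x = [α, x]`; the component `L₁ ⊗ L₁ → L₋₂ = 0` vanishes. -/
structure HemistrictLie2Algebra (𝕂 L₁ L₀ : Type*) [Field 𝕂] [AddCommGroup L₁] [Module 𝕂 L₁]
    [AddCommGroup L₀] [Module 𝕂 L₀] where
  d : L₁ →ₗ[𝕂] L₀
  br₀₀ : L₀ →ₗ[𝕂] L₀ →ₗ[𝕂] L₀
  br₀₁ : L₀ →ₗ[𝕂] L₁ →ₗ[𝕂] L₁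
  br₁₀ : L₁ →ₗ[𝕂] L₀ →ₗ[𝕂] L₁
  /-- the alternator -/
  h : L₀ →ₗ[𝕂] L₀ →ₗ[𝕂] L₁
  /- the bracket is a cochain map -/
  d_br₀₁ : ∀ x α, d (br₀₁ x α) = br₀₀ x (d α)
  d_br₁₀ : ∀ α x, d (br₁₀ α x) = br₀₀ (d α) x
  br_d_d : ∀ α β, br₀₁ (d α) β = br₁₀ α (d β)
  /- the left Leibniz rule -/
  leibniz₀₀₀ : ∀ x y z, br₀₀ x (br₀₀ y z) = br₀₀ (br₀₀ x y) z + br₀₀ y (br₀₀ x z)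
  leibniz₀₀₁ : ∀ x y γ, br₀₁ x (br₀₁ y γ) = br₀₁ (br₀₀ x y) γ + br₀₁ y (br₀₁ x γ)
  leibniz₀₁₀ : ∀ x β z, br₀₁ x (br₁₀ β z) = br₁₀ (br₀₁ x β) z + br₁₀ β (br₀₀ x z)
  leibniz₁₀₀ : ∀ α y z, br₁₀ α (br₀₀ y z) = br₁₀ (br₁₀ α y) z + br₀₁ y (br₁₀ α z)
  h_symm : ∀ x y, h x y = h y x
  /- the bracket is skew-symmetric up to the homotopy `h` -/
  skew₀₀ : ∀ x y, br₀₀ x y + br₀₀ y x = d (h x y)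
  skew₀₁ : ∀ x α, br₀₁ x α + br₁₀ α x = h x (d α)
  br_h : ∀ x y z, br₁₀ (h x y) z = 0
  act_h : ∀ x y z, br₀₁ x (h y z) = h (br₀₀ x y) z + h y (br₀₀ x z)

/-- A representation of a hemistrict Lie 2-algebra on the 2-term complex `d : V₁ → V₀`, with `V₁` in
degree `-1` and `V₀` in degree `0`. The components of the left action are `l₀₀ x v = l(x, v)`,
`l₀₁ x u = l(x, u)`, `l₁₀ α v = l(α, v)`, those of the right action are `r₀₀ v x = r(v, x)`,
`r₁₀ u x = r(u, x)`, `r₀₁ v α = r(v, α)`, for `x : L₀`, `α : L₁`, `v : V₀`, `u : V₁`. -/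
structure HemistrictLie2Algebra.Rep {𝕂 L₁ L₀ : Type*} [Field 𝕂] [AddCommGroup L₁] [Module 𝕂 L₁]
    [AddCommGroup L₀] [Module 𝕂 L₀] (L : HemistrictLie2Algebra 𝕂 L₁ L₀)
    (V₁ V₀ : Type*) [AddCommGroup V₁] [Module 𝕂 V₁] [AddCommGroup V₀] [Module 𝕂 V₀] where
  d : V₁ →ₗ[𝕂] V₀
  l₀₀ : L₀ →ₗ[𝕂] Module.End 𝕂 V₀
  l₀₁ : L₀ →ₗ[𝕂] Module.End 𝕂 V₁
  l₁₀ : L₁ →ₗ[𝕂] V₀ →ₗ[𝕂] V₁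
  r₀₀ : V₀ →ₗ[𝕂] L₀ →ₗ[𝕂] V₀
  r₁₀ : V₁ →ₗ[𝕂] L₀ →ₗ[𝕂] V₁
  r₀₁ : V₀ →ₗ[𝕂] L₁ →ₗ[𝕂] V₁
  /-- the action homotopy -/
  hv : L₀ →ₗ[𝕂] V₀ →ₗ[𝕂] V₁
  /- `l` and `r` are cochain maps -/
  d_l₀₁ : ∀ x u, d (l₀₁ x u) = l₀₀ x (d u)
  d_l₁₀ : ∀ α v, d (l₁₀ α v) = l₀₀ (L.d α) v
  l_d_d : ∀ α u, l₀₁ (L.d α) u = l₁₀ α (d u)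
  d_r₁₀ : ∀ u x, d (r₁₀ u x) = r₀₀ (d u) x
  d_r₀₁ : ∀ v α, d (r₀₁ v α) = r₀₀ v (L.d α)
  r_d_d : ∀ u α, r₀₁ (d u) α = r₁₀ u (L.d α)
  /- `l` is a left representation of the underlying dg Leibniz algebra -/
  l_br₀₀ : ∀ x y v, l₀₀ x (l₀₀ y v) - l₀₀ y (l₀₀ x v) = l₀₀ (L.br₀₀ x y) v
  l_br₀₀' : ∀ x y u, l₀₁ x (l₀₁ y u) - l₀₁ y (l₀₁ x u) = l₀₁ (L.br₀₀ x y) u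
  l_br₀₁ : ∀ x α v, l₀₁ x (l₁₀ α v) - l₁₀ α (l₀₀ x v) = l₁₀ (L.br₀₁ x α) v
  l_br₁₀ : ∀ α x v, l₁₀ α (l₀₀ x v) - l₀₁ x (l₁₀ α v) = l₁₀ (L.br₁₀ α x) v
  /- the actions skew-commute up to the homotopy `hv` -/
  skew₀₀ : ∀ x v, l₀₀ x v + r₀₀ v x = d (hv x v)
  skew₀₁ : ∀ x u, l₀₁ x u + r₁₀ u x = hv x (d u)
  skew₁₀ : ∀ α v, l₁₀ α v + r₀₁ v α = hv (L.d α) v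
  /- compatibility conditions -/
  r_hv : ∀ x y v, r₁₀ (hv x v) y = 0
  l_h : ∀ x y v, l₁₀ (L.h x y) v = 0
  l_hv : ∀ x y v, l₀₁ x (hv y v) = hv (L.br₀₀ x y) v + hv y (l₀₀ x v)

namespace HemistrictLie2Algebra.Rep

variable {𝕂 L₁ L₀ V₁ V₀ : Type*} [Field 𝕂] [AddCommGroup L₁] [Module 𝕂 L₁]
  [AddCommGroup L₀] [Module 𝕂 L₀] [AddCommGroup V₁] [Module 𝕂 V₁] [AddCommGroup V₀] [Module 𝕂 V₀]
  {L : HemistrictLie2Algebra 𝕂 L₁ L₀} (V : L.Rep V₁ V₀)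

/-- The standard complex in degree `n`: pairs `(ω^{(-1)}, ω^{(0)})` of weakly symmetric cochains
of degree `n + 1` with values in `V₁` and of degree `n` with values in `V₀`. -/
def cochains (_V : L.Rep V₁ V₀) (n : ℤ) : Submodule 𝕂 (Fam L₀ L₁ V₁ × Fam L₀ L₁ V₀) :=
  (weakCochains 𝕂 V₁ L.h (n + 1)).prod (weakCochains 𝕂 V₀ L.h n)

/-- The differential of the standard complex, that is, of the Loday-Pirashvili complex of the
symmetric representation `(l, -l)`. -/
def differential :
    Fam L₀ L₁ V₁ × Fam L₀ L₁ V₀ →ₗ[𝕂] Fam L₀ L₁ V₁ × Fam L₀ L₁ V₀ :=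
  LinearMap.prod
    ((insertTerm L.d + lpTerm L.br₀₀ V.l₀₁ + mixedTerm L.br₁₀) ∘ₗ LinearMap.fst 𝕂 _ _ +
      innerTerm V.l₁₀ ∘ₗ LinearMap.snd 𝕂 _ _)
    ((insertTerm L.d + lpTerm L.br₀₀ V.l₀₀ + mixedTerm L.br₁₀) ∘ₗ LinearMap.snd 𝕂 _ _ +
      coeffTerm V.d ∘ₗ LinearMap.fst 𝕂 _ _)

/-- The cohomology `Hⁿ(L, V)` of the representation `V` of the hemistrict Lie 2-algebra `L`. -/
abbrev H (n : ℤ) : Type _ := Cohomology V.cochains V.differential n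

end HemistrictLie2Algebra.Rep

/-! ### Semistrict Lie 2-algebras and their cohomology -/

/-- A semistrict Lie 2-algebra (2-term `L_∞`-algebra) on `d : L₁ → L₀`, with `L₁` in degree `-1`
and `L₀` in degree `0`. The binary bracket has components `l₂ x y` and `l₂' x α = - l₂(α, x)`. -/
structure SemistrictLie2Algebra (𝕂 L₁ L₀ : Type*) [Field 𝕂] [AddCommGroup L₁] [Module 𝕂 L₁]
    [AddCommGroup L₀] [Module 𝕂 L₀] where
  d : L₁ →ₗ[𝕂] L₀
  l₂ : L₀ →ₗ[𝕂] L₀ →ₗ[𝕂] L₀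
  l₂' : L₀ →ₗ[𝕂] L₁ →ₗ[𝕂] L₁
  l₃ : L₀ →ₗ[𝕂] L₀ →ₗ[𝕂] L₀ →ₗ[𝕂] L₁
  l₂_skew : ∀ x y, l₂ x y = - l₂ y x
  l₃_skew₁ : ∀ x y z, l₃ x y z = - l₃ y x z
  l₃_skew₂ : ∀ x y z, l₃ x y z = - l₃ x z y
  d_l₂' : ∀ x α, d (l₂' x α) = l₂ x (d α)
  l₂_d_d : ∀ α β, l₂' (d α) β = - l₂' (d β) α
  jacobi₀ : ∀ x y z, l₂ x (l₂ y z) + l₂ y (l₂ z x) + l₂ z (l₂ x y) = d (l₃ x y z)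
  jacobi₁ : ∀ x y α, l₂' x (l₂' y α) - l₂' y (l₂' x α) - l₂' (l₂ x y) α = l₃ x y (d α)
  coherence : ∀ x y z w,
    l₂' x (l₃ y z w) - l₂' y (l₃ x z w) + l₂' z (l₃ x y w) - l₂' w (l₃ x y z)
      - l₃ (l₂ x y) z w + l₃ (l₂ x z) y w - l₃ (l₂ x w) y z
      - l₃ (l₂ y z) x w + l₃ (l₂ y w) x z - l₃ (l₂ z w) x y = 0

/-- A representation (with vanishing ternary action) of a semistrict Lie 2-algebra on the 2-term
complex `d : V₁ → V₀`. -/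
structure SemistrictLie2Algebra.Rep {𝕂 L₁ L₀ : Type*} [Field 𝕂] [AddCommGroup L₁] [Module 𝕂 L₁]
    [AddCommGroup L₀] [Module 𝕂 L₀] (L : SemistrictLie2Algebra 𝕂 L₁ L₀)
    (V₁ V₀ : Type*) [AddCommGroup V₁] [Module 𝕂 V₁] [AddCommGroup V₀] [Module 𝕂 V₀] where
  d : V₁ →ₗ[𝕂] V₀
  l₀₀ : L₀ →ₗ[𝕂] Module.End 𝕂 V₀
  l₀₁ : L₀ →ₗ[𝕂] Module.End 𝕂 V₁
  l₁₀ : L₁ →ₗ[𝕂] V₀ →ₗ[𝕂] V₁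
  d_l₀₁ : ∀ x u, d (l₀₁ x u) = l₀₀ x (d u)
  d_l₁₀ : ∀ α v, d (l₁₀ α v) = l₀₀ (L.d α) v
  l_d_d : ∀ α u, l₀₁ (L.d α) u = l₁₀ α (d u)
  l_l₂ : ∀ x y v, l₀₀ (L.l₂ x y) v = l₀₀ x (l₀₀ y v) - l₀₀ y (l₀₀ x v)
  l_l₂' : ∀ x y u, l₀₁ (L.l₂ x y) u = l₀₁ x (l₀₁ y u) - l₀₁ y (l₀₁ x u)
  l_l₂'' : ∀ x α v, l₁₀ (L.l₂' x α) v = l₀₁ x (l₁₀ α v) - l₁₀ α (l₀₀ x v)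
  l_l₃ : ∀ x y z v, l₁₀ (L.l₃ x y z) v = 0

namespace SemistrictLie2Algebra.Rep

variable {𝕂 L₁ L₀ V₁ V₀ : Type*} [Field 𝕂] [AddCommGroup L₁] [Module 𝕂 L₁]
  [AddCommGroup L₀] [Module 𝕂 L₀] [AddCommGroup V₁] [Module 𝕂 V₁] [AddCommGroup V₀] [Module 𝕂 V₀]
  {L : SemistrictLie2Algebra 𝕂 L₁ L₀} (V : L.Rep V₁ V₀)

/-- `Cⁿ(L, V) = ⨁_{p + 2q + r = n} Hom(⋀^p L₀ ⊗ S^q L₁, V^r)`, with `V^{-1} = V₁`, `V^0 = V₀`. -/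
def cochains (_V : L.Rep V₁ V₀) (n : ℤ) : Submodule 𝕂 (Fam L₀ L₁ V₁ × Fam L₀ L₁ V₀) :=
  (alternatingCochains 𝕂 L₀ L₁ V₁ (n + 1)).prod (alternatingCochains 𝕂 L₀ L₁ V₀ n)

/-- The Chevalley-Eilenberg differential of a semistrict Lie 2-algebra with coefficients: the sum of
the terms dual to `d : V₁ → V₀`, to `d : L₁ → L₀`, to the binary and the ternary brackets, and to the
action. -/
def differential :
    Fam L₀ L₁ V₁ × Fam L₀ L₁ V₀ →ₗ[𝕂] Fam L₀ L₁ V₁ × Fam L₀ L₁ V₀ :=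
  LinearMap.prod
    ((insertTerm L.d + lpTerm L.l₂ V.l₀₁ + mixedTerm (-L.l₂'.flip) + ternaryTerm L.l₃) ∘ₗ
        LinearMap.fst 𝕂 _ _ +
      innerTerm V.l₁₀ ∘ₗ LinearMap.snd 𝕂 _ _)
    ((insertTerm L.d + lpTerm L.l₂ V.l₀₀ + mixedTerm (-L.l₂'.flip) + ternaryTerm L.l₃) ∘ₗ
        LinearMap.snd 𝕂 _ _ +
      coeffTerm V.d ∘ₗ LinearMap.fst 𝕂 _ _)

/-- The cohomology `Hⁿ(L, V)` of a semistrict Lie 2-algebra `L` with coefficients in `V`. -/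
abbrev H (n : ℤ) : Type _ := Cohomology V.cochains V.differential n

end SemistrictLie2Algebra.Rep

/-! ### Skew-symmetrization -/

namespace HemistrictLie2Algebra

variable {𝕂 L₁ L₀ V₁ V₀ : Type*} [Field 𝕂] [AddCommGroup L₁] [Module 𝕂 L₁]
  [AddCommGroup L₀] [Module 𝕂 L₀] [AddCommGroup V₁] [Module 𝕂 V₁] [AddCommGroup V₀] [Module 𝕂 V₀]

section Brackets

variable (L : HemistrictLie2Algebra 𝕂 L₁ L₀)

/-- `l₂(x, y) = ([x, y] - [y, x]) / 2` on `L₀`. -/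
def skewBr : L₀ →ₗ[𝕂] L₀ →ₗ[𝕂] L₀ := (1 / 2 : 𝕂) • (L.br₀₀ - L.br₀₀.flip)

/-- `l₂(x, α) = ([x, α] - [α, x]) / 2`. -/
def skewBr' : L₀ →ₗ[𝕂] L₁ →ₗ[𝕂] L₁ := (1 / 2 : 𝕂) • (L.br₀₁ - L.br₁₀.flip)

/-- `l₃(x, y, z) = - (h(l₂(x, y), z) + h(l₂(y, z), x) + h(l₂(z, x), y)) / 6`. -/
def skewTernary : L₀ →ₗ[𝕂] L₀ →ₗ[𝕂] L₀ →ₗ[𝕂] L₁ :=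
  LinearMap.mk₂ 𝕂
    (fun x y => (-(1 / 6) : 𝕂) • (L.h (L.skewBr x y) + L.h.flip x ∘ₗ L.skewBr y +
      L.h.flip y ∘ₗ L.skewBr.flip x))
    (fun x x' y => by ext z; simp; module)
    (fun c x y => by ext z; simp; module)
    (fun x y y' => by ext z; simp; module)
    (fun c x y => by ext z; simp; module)

theorem skewBr_apply (x y : L₀) :
    L.skewBr x y = (1 / 2 : 𝕂) • (L.br₀₀ x y - L.br₀₀ y x) := rfl

theorem skewBr'_apply (x : L₀) (α : L₁) :
    L.skewBr' x α = (1 / 2 : 𝕂) • (L.br₀₁ x α - L.br₁₀ α x) := rfl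

theorem skewTernary_apply (x y z : L₀) :
    L.skewTernary x y z = (-(1 / 6) : 𝕂) • (L.h (L.skewBr x y) z + L.h (L.skewBr y z) x +
      L.h (L.skewBr z x) y) := rfl

set_option maxHeartbeats 2000000 in
theorem skew_coherence [CharZero 𝕂] (x y z w : L₀) :
    L.skewBr' x (L.skewTernary y z w) - L.skewBr' y (L.skewTernary x z w)
      + L.skewBr' z (L.skewTernary x y w) - L.skewBr' w (L.skewTernary x y z)
      - L.skewTernary (L.skewBr x y) z w + L.skewTernary (L.skewBr x z) y w
      - L.skewTernary (L.skewBr x w) y z - L.skewTernary (L.skewBr y z) x w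
      + L.skewTernary (L.skewBr y w) x z - L.skewTernary (L.skewBr z w) x y = 0 := by
  have hL : ∀ a b c e : L₀, L.h (L.br₀₀ a (L.br₀₀ b c)) e - L.h (L.br₀₀ (L.br₀₀ a b) c) e -
      L.h (L.br₀₀ b (L.br₀₀ a c)) e = 0 := fun a b c e => by
    rw [L.leibniz₀₀₀ a b c]; simp
  have hbb : ∀ a b c e : L₀, L.h (L.br₀₀ a b) (L.br₀₀ c e) = L.h (L.br₀₀ c e) (L.br₀₀ a b) :=
    fun a b c e => L.h_symm _ _
  simp only [skewTernary_apply, skewBr_apply, skewBr'_apply, map_sub, map_smul,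
    LinearMap.sub_apply, LinearMap.smul_apply, map_add, L.act_h, L.br_h,
    hbb]
  linear_combination (norm := module) (1/24 : 𝕂) • hL x z y w - (1/24 : 𝕂) • hL y w z x +
    (1/24 : 𝕂) • hL x w z y - (1/24 : 𝕂) • hL x w y z + (1/24 : 𝕂) • hL y x z w - (1/24 : 𝕂)
    • hL y x w z + (1/24 : 𝕂) • hL y w x z - (1/24 : 𝕂) • hL z x y w + (1/24 : 𝕂) • hL z x w
    y - (1/24 : 𝕂) • hL y z x w - (1/24 : 𝕂) • hL z w x y + (1/24 : 𝕂) • hL w x y z + (1/24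
    : 𝕂) • hL y z w x - (1/24 : 𝕂) • hL w x z y - (1/24 : 𝕂) • hL x z w y + (1/24 : 𝕂) • hL
    z w y x + (1/24 : 𝕂) • hL z y x w - (1/24 : 𝕂) • hL x y z w - (1/24 : 𝕂) • hL z y w x +
    (-1/24 : 𝕂) • hL w y x z + (1/24 : 𝕂) • hL x y w z + (1/24 : 𝕂) • hL w y z x + (1/24 : 𝕂)
    • hL w z x y - (1/24 : 𝕂) • hL w z y x

end Brackets

/-- The semistrict Lie 2-algebra obtained from a hemistrict one by skew-symmetrizing the bracket. -/
def skewSymmetrization [CharZero 𝕂] (L : HemistrictLie2Algebra 𝕂 L₁ L₀) : SemistrictLie2Algebra 𝕂 L₁ L₀ where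
  d := L.d
  l₂ := L.skewBr
  l₂' := L.skewBr'
  l₃ := L.skewTernary
  l₂_skew x y := by simp only [skewBr_apply]; module
  l₃_skew₁ x y z := by
    simp only [skewTernary_apply, skewBr_apply, map_sub, map_smul, LinearMap.sub_apply,
      LinearMap.smul_apply]
    module
  l₃_skew₂ x y z := by
    simp only [skewTernary_apply, skewBr_apply, map_sub, map_smul, LinearMap.sub_apply,
      LinearMap.smul_apply]
    module
  d_l₂' x α := by simp [skewBr_apply, skewBr'_apply, L.d_br₀₁, L.d_br₁₀]
  l₂_d_d α β := by
    simp only [skewBr'_apply, L.br_d_d]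
    module
  jacobi₀ x y z := by
    have hh : ∀ a b, L.d (L.h a b) = L.br₀₀ a b + L.br₀₀ b a := fun a b => (L.skew₀₀ a b).symm
    simp only [skewTernary_apply, skewBr_apply, map_sub, map_smul, LinearMap.sub_apply,
      LinearMap.smul_apply, map_add, hh]
    linear_combination (norm := module) (1/6 : 𝕂) • L.leibniz₀₀₀ x y z
      + (-1/6 : 𝕂) • L.leibniz₀₀₀ x z y + (-1/6 : 𝕂) • L.leibniz₀₀₀ z y x
      + (1/6 : 𝕂) • L.leibniz₀₀₀ y z x + (1/6 : 𝕂) • L.leibniz₀₀₀ z x y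
      + (-1/6 : 𝕂) • L.leibniz₀₀₀ y x z
  jacobi₁ x y α := by
    have e : ∀ x α, L.h x (L.d α) = L.br₀₁ x α + L.br₁₀ α x := fun x α => (L.skew₀₁ x α).symm
    have e' : ∀ x α, L.h (L.d α) x = L.br₀₁ x α + L.br₁₀ α x := fun x α => by
      rw [L.h_symm, e]
    simp only [skewTernary_apply, skewBr_apply, skewBr'_apply, map_sub, map_smul,
      LinearMap.sub_apply, LinearMap.smul_apply, ← L.d_br₀₁, ← L.d_br₁₀, e, e']
    linear_combination (norm := module) (1/6 : 𝕂) • L.leibniz₀₀₁ x y α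
      + (-1/6 : 𝕂) • L.leibniz₀₁₀ x α y + (-1/6 : 𝕂) • L.leibniz₁₀₀ α y x
      + (1/6 : 𝕂) • L.leibniz₀₁₀ y α x + (1/6 : 𝕂) • L.leibniz₁₀₀ α x y
      + (-1/6 : 𝕂) • L.leibniz₀₀₁ y x α
  coherence := L.skew_coherence

/-- A representation `V` of a hemistrict Lie 2-algebra `L`, regarded through its left action as a
representation of the semistrict Lie 2-algebra obtained from `L` by skew-symmetrization. -/
def Rep.skewSymmetrization [CharZero 𝕂] {L : HemistrictLie2Algebra 𝕂 L₁ L₀} (V : L.Rep V₁ V₀) :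
    L.skewSymmetrization.Rep V₁ V₀ where
  d := V.d
  l₀₀ := V.l₀₀
  l₀₁ := V.l₀₁
  l₁₀ := V.l₁₀
  d_l₀₁ := V.d_l₀₁
  d_l₁₀ := V.d_l₁₀
  l_d_d := V.l_d_d
  l_l₂ x y v := by
    change V.l₀₀ (L.skewBr x y) v = _
    simp only [skewBr_apply, map_smul, map_sub, LinearMap.smul_apply, LinearMap.sub_apply,
      ← V.l_br₀₀]
    module
  l_l₂' x y u := by
    change V.l₀₁ (L.skewBr x y) u = _
    simp only [skewBr_apply, map_smul, map_sub, LinearMap.smul_apply, LinearMap.sub_apply,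
      ← V.l_br₀₀']
    module
  l_l₂'' x α v := by
    change V.l₁₀ (L.skewBr' x α) v = _
    simp only [skewBr'_apply, map_smul, map_sub, LinearMap.smul_apply, LinearMap.sub_apply,
      ← V.l_br₀₁, ← V.l_br₁₀]
    module
  l_l₃ x y z v := by
    change V.l₁₀ (L.skewTernary x y z) v = _
    simp only [skewTernary_apply, map_smul, map_add, LinearMap.smul_apply, LinearMap.add_apply,
      V.l_h, add_zero, smul_zero]

end HemistrictLie2Algebra

/-! ### Chevalley-Eilenberg cohomology of a Lie algebra with values in a 2-term complex -/

/-- A 2-term complex `d : V₁ → V₀` of representations of a Lie algebra `𝔥`, with `V₁` in degree `-1`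
and `V₀` in degree `0`. -/
structure LieComplex (𝕂 𝔥 V₁ V₀ : Type*) [Field 𝕂] [LieRing 𝔥] [LieAlgebra 𝕂 𝔥]
    [AddCommGroup V₁] [Module 𝕂 V₁] [AddCommGroup V₀] [Module 𝕂 V₀] where
  d : V₁ →ₗ[𝕂] V₀
  ρ₁ : 𝔥 →ₗ[𝕂] Module.End 𝕂 V₁
  ρ₀ : 𝔥 →ₗ[𝕂] Module.End 𝕂 V₀
  ρ₁_lie : ∀ x y u, ρ₁ ⁅x, y⁆ u = ρ₁ x (ρ₁ y u) - ρ₁ y (ρ₁ x u)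
  ρ₀_lie : ∀ x y v, ρ₀ ⁅x, y⁆ v = ρ₀ x (ρ₀ y v) - ρ₀ y (ρ₀ x v)
  d_ρ₁ : ∀ x u, d (ρ₁ x u) = ρ₀ x (d u)

namespace LieComplex

variable {𝕂 𝔥 V₁ V₀ : Type*} [Field 𝕂] [LieRing 𝔥] [LieAlgebra 𝕂 𝔥]
  [AddCommGroup V₁] [Module 𝕂 V₁] [AddCommGroup V₀] [Module 𝕂 V₀] (V : LieComplex 𝕂 𝔥 V₁ V₀)

/-- `Hom(⋀^{n+1} 𝔥, V₁) ⊕ Hom(⋀^n 𝔥, V₀)`. -/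
def cochains (_V : LieComplex 𝕂 𝔥 V₁ V₀) (n : ℤ) : Submodule 𝕂 (Fam₁ 𝔥 V₁ × Fam₁ 𝔥 V₀) :=
  (alternatingCochains₁ 𝕂 𝔥 V₁ (n + 1)).prod (alternatingCochains₁ 𝕂 𝔥 V₀ n)

variable (𝕂 𝔥) in
/-- The Lie bracket as a bilinear map. -/
def lieBr : 𝔥 →ₗ[𝕂] 𝔥 →ₗ[𝕂] 𝔥 :=
  LinearMap.mk₂ 𝕂 (fun x y => ⁅x, y⁆) add_lie smul_lie lie_add lie_smul

/-- The differential `d_V + d_CE` of the Chevalley-Eilenberg (total) complex. -/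
def differential : Fam₁ 𝔥 V₁ × Fam₁ 𝔥 V₀ →ₗ[𝕂] Fam₁ 𝔥 V₁ × Fam₁ 𝔥 V₀ :=
  LinearMap.prod
    (lpDifferential (lieBr 𝕂 𝔥) V.ρ₁ ∘ₗ
      LinearMap.fst 𝕂 _ _)
    (lpDifferential (lieBr 𝕂 𝔥) V.ρ₀ ∘ₗ
      LinearMap.snd 𝕂 _ _ + coeffTerm₁ V.d ∘ₗ LinearMap.fst 𝕂 _ _)

/-- The Chevalley-Eilenberg cohomology `Hⁿ_CE(𝔥, V)`. -/
abbrev H (n : ℤ) : Type _ := Cohomology V.cochains V.differential n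

end LieComplex

/-! ### Leibniz algebras -/

/-- A (left) Leibniz algebra over `𝕂`. -/
class LeibnizAlgebra (𝕂 𝔤 : Type*) [Field 𝕂] [AddCommGroup 𝔤] [Module 𝕂 𝔤] where
  br : 𝔤 →ₗ[𝕂] 𝔤 →ₗ[𝕂] 𝔤
  leibniz : ∀ x y z : 𝔤, br x (br y z) = br (br x y) z + br y (br x z)

namespace LeibnizAlgebra

variable (𝕂 𝔤 : Type*) [Field 𝕂] [AddCommGroup 𝔤] [Module 𝕂 𝔤] [LeibnizAlgebra 𝕂 𝔤]

/-- The Leibniz kernel `K`, spanned by the elements `[x, y] + [y, x]`. -/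
def kernel : Submodule 𝕂 𝔤 :=
  Submodule.span 𝕂 {z | ∃ x y : 𝔤, z = br (𝕂 := 𝕂) x y + br (𝕂 := 𝕂) y x}

variable {𝔤}

theorem br_add_br_mem (x y : 𝔤) : br (𝕂 := 𝕂) x y + br (𝕂 := 𝕂) y x ∈ kernel 𝕂 𝔤 :=
  Submodule.subset_span ⟨x, y, rfl⟩

/-- The Leibniz kernel is contained in the left centre. -/
theorem br_kernel_left {k : 𝔤} (hk : k ∈ kernel 𝕂 𝔤) (x : 𝔤) : br (𝕂 := 𝕂) k x = 0 := by
  induction hk using Submodule.span_induction with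
  | mem z hz =>
    obtain ⟨a, b, rfl⟩ := hz
    simp only [map_add, LinearMap.add_apply]
    have h₁ := leibniz (𝕂 := 𝕂) a b x
    have h₂ := leibniz (𝕂 := 𝕂) b a x
    rw [h₂, ← add_assoc] at h₁
    have h₃ : br (𝕂 := 𝕂) (br (𝕂 := 𝕂) a b) x + br (𝕂 := 𝕂) (br (𝕂 := 𝕂) b a) x +
        br (𝕂 := 𝕂) a (br (𝕂 := 𝕂) b x) = 0 + br (𝕂 := 𝕂) a (br (𝕂 := 𝕂) b x) := by
      rw [zero_add]; exact h₁.symm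
    exact add_right_cancel h₃
  | zero => simp
  | add a b _ _ ha hb => simp [ha, hb]
  | smul c a _ ha => simp [ha]

theorem br_kernel_right (x : 𝔤) {k : 𝔤} (hk : k ∈ kernel 𝕂 𝔤) :
    br (𝕂 := 𝕂) x k ∈ kernel 𝕂 𝔤 := by
  induction hk using Submodule.span_induction with
  | mem z hz =>
    obtain ⟨a, b, rfl⟩ := hz
    rw [map_add, leibniz x a b, leibniz x b a]
    convert add_mem (br_add_br_mem 𝕂 (br (𝕂 := 𝕂) x a) b)
      (br_add_br_mem 𝕂 a (br (𝕂 := 𝕂) x b)) using 1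
    abel
  | zero => simp
  | add a b _ _ ha hb => rw [map_add]; exact add_mem ha hb
  | smul c a _ ha => rw [map_smul]; exact Submodule.smul_mem _ c ha

variable (𝔤)

/-- The hemistrict Lie 2-algebra `L_𝔤 = (K[1] ↪ 𝔤, [-,-], h)`, with `h(x, y) = [x, y] + [y, x]`. -/
def hemistrict : HemistrictLie2Algebra 𝕂 (kernel 𝕂 𝔤) 𝔤 where
  d := (kernel 𝕂 𝔤).subtype
  br₀₀ := br
  br₀₁ := LinearMap.mk₂ 𝕂 (fun x α => ⟨br (𝕂 := 𝕂) x (α : 𝔤), br_kernel_right 𝕂 x α.2⟩)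
    (fun x y α => by ext; simp) (fun c x α => by ext; simp)
    (fun x α β => by ext; simp) (fun c x α => by ext; simp)
  br₁₀ := LinearMap.mk₂ 𝕂
    (fun α x => ⟨br (𝕂 := 𝕂) (α : 𝔤) x, by rw [br_kernel_left 𝕂 α.2]; exact zero_mem _⟩)
    (fun α β x => by ext; simp) (fun c α x => by ext; simp)
    (fun α x y => by ext; simp) (fun c α x => by ext; simp)
  h := LinearMap.mk₂ 𝕂 (fun x y => ⟨br (𝕂 := 𝕂) x y + br (𝕂 := 𝕂) y x, br_add_br_mem 𝕂 x y⟩)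
    (fun x x' y => by ext; simp; abel) (fun c x y => by ext; simp)
    (fun x y y' => by ext; simp; abel) (fun c x y => by ext; simp)
  d_br₀₁ x α := rfl
  d_br₁₀ α x := rfl
  br_d_d α β := rfl
  leibniz₀₀₀ := leibniz
  leibniz₀₀₁ x y γ := Subtype.ext (leibniz x y (γ : 𝔤))
  leibniz₀₁₀ x β z := Subtype.ext (leibniz x (β : 𝔤) z)
  leibniz₁₀₀ α y z := Subtype.ext (leibniz (α : 𝔤) y z)
  h_symm x y := Subtype.ext (add_comm _ _)
  skew₀₀ x y := rfl
  skew₀₁ x α := rfl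
  br_h x y z := Subtype.ext (br_kernel_left 𝕂 (br_add_br_mem 𝕂 x y) z)
  act_h x y z := by
    ext
    change br (𝕂 := 𝕂) x (br (𝕂 := 𝕂) y z + br (𝕂 := 𝕂) z y) =
      (br (𝕂 := 𝕂) (br (𝕂 := 𝕂) x y) z + br (𝕂 := 𝕂) z (br (𝕂 := 𝕂) x y)) +
      (br (𝕂 := 𝕂) y (br (𝕂 := 𝕂) x z) + br (𝕂 := 𝕂) (br (𝕂 := 𝕂) x z) y)
    rw [map_add, leibniz x y z, leibniz x z y]
    abel

/-- The semistrict Lie 2-algebra `𝒢 = (K[1] ↪ 𝔤, l₂, l₃)` obtained from `L_𝔤`. -/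
abbrev semistrict [CharZero 𝕂] : SemistrictLie2Algebra 𝕂 (kernel 𝕂 𝔤) 𝔤 :=
  (hemistrict 𝕂 𝔤).skewSymmetrization

/-- The Lie algebra `𝔤_Lie = 𝔤 / K`, with the bracket `{x̄, ȳ} = pr [x, y]`. -/
abbrev LieQuotient : Type _ := 𝔤 ⧸ kernel 𝕂 𝔤

/-- The bracket of `𝔤 / K`. -/
def quotientBr : LieQuotient 𝕂 𝔤 →ₗ[𝕂] LieQuotient 𝕂 𝔤 →ₗ[𝕂] LieQuotient 𝕂 𝔤 :=
  (kernel 𝕂 𝔤).liftQ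
    (LinearMap.mk₂ 𝕂
      (fun x : 𝔤 => (kernel 𝕂 𝔤).mapQ (kernel 𝕂 𝔤) (br x) fun _ hk => br_kernel_right 𝕂 x hk)
      (fun x x' y => by induction y using Submodule.Quotient.induction_on; simp)
      (fun c x y => by induction y using Submodule.Quotient.induction_on; simp)
      (fun x y y' => map_add _ y y')
      (fun c x y => map_smul _ c y))
    (fun k hk => by
      ext y
      simp [br_kernel_left 𝕂 hk])

theorem quotientBr_mk (x y : 𝔤) :
    quotientBr 𝕂 𝔤 (Submodule.Quotient.mk x) (Submodule.Quotient.mk y) =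
      Submodule.Quotient.mk (br (𝕂 := 𝕂) x y) := rfl

theorem quotientBr_leibniz (x y z : LieQuotient 𝕂 𝔤) :
    quotientBr 𝕂 𝔤 x (quotientBr 𝕂 𝔤 y z) =
      quotientBr 𝕂 𝔤 (quotientBr 𝕂 𝔤 x y) z + quotientBr 𝕂 𝔤 y (quotientBr 𝕂 𝔤 x z) := by
  induction x using Submodule.Quotient.induction_on with | _ x =>
  induction y using Submodule.Quotient.induction_on with | _ y =>
  induction z using Submodule.Quotient.induction_on with | _ z =>
  simp only [quotientBr_mk, leibniz x y z, Submodule.Quotient.mk_add]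

variable [CharZero 𝕂]

theorem quotientBr_self (x : LieQuotient 𝕂 𝔤) : quotientBr 𝕂 𝔤 x x = 0 := by
  induction x using Submodule.Quotient.induction_on with | _ x =>
  rw [quotientBr_mk, Submodule.Quotient.mk_eq_zero]
  have h := Submodule.smul_mem _ (1 / 2 : 𝕂) (br_add_br_mem 𝕂 x x)
  convert h using 1
  module

instance : LieRing (LieQuotient 𝕂 𝔤) where
  bracket x y := quotientBr 𝕂 𝔤 x y
  add_lie x y z := by
    change quotientBr 𝕂 𝔤 (x + y) z = quotientBr 𝕂 𝔤 x z + quotientBr 𝕂 𝔤 y z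
    simp
  lie_add x y z := map_add _ y z
  lie_self := quotientBr_self 𝕂 𝔤
  leibniz_lie := quotientBr_leibniz 𝕂 𝔤

instance : LieAlgebra 𝕂 (LieQuotient 𝕂 𝔤) where
  lie_smul c x y := map_smul (quotientBr 𝕂 𝔤 x) c y

variable {𝕂 𝔤} {V₁ V₀ : Type*} [AddCommGroup V₁] [Module 𝕂 V₁] [AddCommGroup V₀] [Module 𝕂 V₀]

/-- A representation `V` of `L_𝔤` with `l_α = 0` for all `α ∈ K`, regarded through its left action
as a 2-term complex of representations of the Lie algebra `𝔤_Lie`. -/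
def lieComplex (V : (hemistrict 𝕂 𝔤).Rep V₁ V₀) (hV : ∀ α, V.l₁₀ α = 0) :
    LieComplex 𝕂 (LieQuotient 𝕂 𝔤) V₁ V₀ where
  d := V.d
  ρ₁ := (kernel 𝕂 𝔤).liftQ V.l₀₁ fun k hk => by
    ext u
    exact (V.l_d_d ⟨k, hk⟩ u).trans (by simp [hV])
  ρ₀ := (kernel 𝕂 𝔤).liftQ V.l₀₀ fun k hk => by
    ext v
    exact (V.d_l₁₀ ⟨k, hk⟩ v).symm.trans (by simp [hV])
  ρ₁_lie x y u := by
    induction x using Submodule.Quotient.induction_on with | _ x =>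
    induction y using Submodule.Quotient.induction_on with | _ y =>
    exact (V.l_br₀₀' x y u).symm
  ρ₀_lie x y v := by
    induction x using Submodule.Quotient.induction_on with | _ x =>
    induction y using Submodule.Quotient.induction_on with | _ y =>
    exact (V.l_br₀₀ x y v).symm
  d_ρ₁ x u := by
    induction x using Submodule.Quotient.induction_on with | _ x =>
    exact V.d_l₀₁ x u

end LeibnizAlgebra

end LieTwo

/-!
Let `K ⊆ 𝔤` be the Leibniz kernel, and choose a linear retraction `p : 𝔤 → K` of the inclusion `d`.
All three cohomologies are compared with that of one complex: the alternating cochains on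
`⋀ 𝔤 ⊗ S K`, with the terms of the differential dual to `d_V`, to `d`, to the action `l`, and to the
bracket `[x, y]' = [x, y] - p [x, y]`. This is the Chevalley-Eilenberg complex of the direct sum of
`𝔤 / K`, realised as `ker p`, and of the acyclic complex `K → K`. The vanishing of `l` on
`K ⊗ V⁰` removes the one remaining term of the two differentials, so that the coefficients in `V⁻¹`
and in `V⁰` can be treated separately.

* For a bilinear map `b : 𝔤 × 𝔤 → K`, the operator `twist b` inserts the values of `b` on disjoint
  pairs of arguments among the arguments in `K`. It is unipotent with inverse `twist (-b)`, and it
  replaces the defect of antisymmetry `h` by `h - b - bᵗ` (`twist_mem`). With `b = p ∘ [-, -]` the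
  weakly symmetric cochains of `L_𝔤` become alternating, since `h₂ = b + bᵗ`; with `b = p ∘ l̃₂`, which
  is skew, the alternating cochains of `𝒢` remain alternating. In both cases the differential is
  carried to that of the common complex (`HemistrictLie2Algebra.twist_comm` and
  `SemistrictLie2Algebra.twist_comm`).
* On the common complex, the anticommutator of the differential with `insertOne p` is the number
  operator which counts the arguments in `K` and the components in `K` of the arguments in `𝔤`. In
  characteristic zero its inverse away from the part of weight zero gives a contracting homotopy
  (`IsCartan.sub_weightZero`), and the part of weight zero consists of the pullbacks from `𝔤 / K`
  (`LieComplex.nonempty_H_equiv`).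

The identities between operators are not proved by handling sums with signs. Each operator is
determined by its value without arguments in `𝔤` and by a recursion for its contractions with `x ∈ 𝔤`
in the first place, which for the differentials is Cartan's formula (`IsCartan`). Identities then
follow by induction on the number of arguments (`eq_zero_of_contract`). Membership in the spaces of
cochains is treated in the same way, because the weakly symmetric families form the largest submodule
on which contractions satisfy the obvious relations (`IsContractible.le_weakFamilies`).
-/

namespace LieTwo

set_option linter.unusedSectionVars false

/-! ### Tuples with a new first entry -/

section TupleLemmas

variable {M : Type*} {a : ℕ}

theorem removeNth_succ_cons (i : Fin (a + 1)) (y : M) (x : Fin (a + 1) → M) :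
    i.succ.removeNth (Fin.cons y x : Fin (a + 2) → M) =
      (Fin.cons y (i.removeNth x) : Fin (a + 1) → M) := by
  funext j
  cases j using Fin.cases with
  | zero => simp [Fin.removeNth]
  | succ j => simp [Fin.removeNth]

theorem removeNth_zero_cons (y : M) (x : Fin a → M) :
    (0 : Fin (a + 1)).removeNth (Fin.cons y x : Fin (a + 1) → M) = x := by
  simp

theorem update_zero_cons (y z : M) (x : Fin a → M) :
    Function.update (Fin.cons y x : Fin (a + 1) → M) 0 z = (Fin.cons z x : Fin (a + 1) → M) :=
  Fin.update_cons_zero (α := fun _ => M) y x z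

theorem update_succ_cons (j : Fin a) (y z : M) (x : Fin a → M) :
    Function.update (Fin.cons y x : Fin (a + 1) → M) j.succ z =
      (Fin.cons y (Function.update x j z) : Fin (a + 1) → M) :=
  (Fin.cons_update (α := fun _ => M) y x j z).symm

theorem cons_comp_swap_zero (y z : M) (x : Fin a → M) :
    (Fin.cons y (Fin.cons z x : Fin (a + 1) → M) : Fin (a + 2) → M) ∘
        Equiv.swap (0 : Fin (a + 1)).castSucc (0 : Fin (a + 1)).succ =
      (Fin.cons z (Fin.cons y x : Fin (a + 1) → M) : Fin (a + 2) → M) := by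
  funext j
  cases j using Fin.cases with
  | zero => simp [-Fin.succ_zero_eq_one]
  | succ j =>
    cases j using Fin.cases with
    | zero => simp
    | succ j =>
      rw [Function.comp_apply, Equiv.swap_apply_of_ne_of_ne] <;> simp [Fin.ext_iff]

theorem cons_comp_swap_succ (i : Fin (a + 1)) (y : M) (x : Fin (a + 2) → M) :
    (Fin.cons y x : Fin (a + 3) → M) ∘ Equiv.swap i.succ.castSucc i.succ.succ =
      (Fin.cons y (x ∘ Equiv.swap i.castSucc i.succ) : Fin (a + 3) → M) := by
  funext j
  cases j using Fin.cases with
  | zero =>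
    rw [Function.comp_apply, Equiv.swap_apply_of_ne_of_ne]
    · simp
    · exact fun h => by simpa using congrArg Fin.val h
    · exact fun h => by simpa using congrArg Fin.val h
  | succ j =>
    simp only [Function.comp_apply, Fin.cons_succ, ← Fin.succ_castSucc]
    rw [← (Fin.succ_injective _).map_swap]
    simp

end TupleLemmas

/-! ### Contractions -/

section Contractions

variable {𝕂 M N V : Type*} [Field 𝕂] [AddCommGroup M] [Module 𝕂 M] [AddCommGroup N] [Module 𝕂 N]
  [AddCommGroup V] [Module 𝕂 V]

variable (𝕂 N V) in
/-- Contraction with `x : M`, which becomes the first `M`-argument. -/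
def contract (x : M) : Fam M N V →ₗ[𝕂] Fam M N V where
  toFun η := fun a k y α => η (a + 1) k (Fin.cons x y : Fin (a + 1) → M) α
  map_add' _ _ := rfl
  map_smul' _ _ := rfl

variable (𝕂 M V) in
/-- Contraction with `α : N`, which becomes the first `N`-argument. -/
def contract' (α : N) : Fam M N V →ₗ[𝕂] Fam M N V where
  toFun η := fun a k y β => η a (k + 1) y (Fin.cons α β : Fin (k + 1) → N)
  map_add' _ _ := rfl
  map_smul' _ _ := rfl

local notation "ι" => contract 𝕂 N V
local notation "κ" => contract' 𝕂 M V

theorem contract'_contract (α : N) (x : M) (η : Fam M N V) :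
    κ α (ι x η) = ι x (κ α η) := rfl

/-- A principle of induction on the number of `M`-arguments: the families `X s`, for `s ∈ S`, vanish
if they do so without `M`-arguments and if each contraction of one of them is again one of them. -/
theorem eq_zero_of_contract {σ : Type*} {S : Set σ} {X : σ → Fam M N V}
    (h₀ : ∀ s ∈ S, X s 0 = 0) (h : ∀ s ∈ S, ∀ y, ∃ s' ∈ S, ι y (X s) = X s') :
    ∀ s ∈ S, X s = 0 := by
  have key : ∀ a : ℕ, ∀ s ∈ S, X s a = 0 := by
    intro a
    induction a with
    | zero => exact h₀
    | succ a ih =>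
      intro s hs
      funext k x α
      obtain ⟨s', hs', e⟩ := h s hs (x 0)
      have e' := congrFun (congrFun (congrFun (congrFun e a) k) (Fin.tail x)) α
      rw [ih s' hs'] at e'
      rw [← Fin.cons_self_tail x]
      exact e'
  intro s hs
  funext a
  exact key a s hs

/-- The variant of `eq_zero_of_contract` for a sequence of families of this kind, where a
contraction of the `c`-th one is a sum of two, with indices `c` and `c + 1`. -/
theorem eq_zero_of_contract_nat {σ : Type*} {S : Set σ} {X : ℕ → σ → Fam M N V}
    (h₀ : ∀ c, ∀ s ∈ S, X c s 0 = 0)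
    (h : ∀ c, ∀ s ∈ S, ∀ y, ∃ s' ∈ S, ∃ s'' ∈ S, ι y (X c s) = X c s' + X (c + 1) s'') :
    ∀ c, ∀ s ∈ S, X c s = 0 := by
  have key : ∀ a c : ℕ, ∀ s ∈ S, X c s a = 0 := by
    intro a
    induction a with
    | zero => exact h₀
    | succ a ih =>
      intro c s hs
      funext k x α
      obtain ⟨s', hs', s'', hs'', e⟩ := h c s hs (x 0)
      have e' := congrFun (congrFun (congrFun (congrFun e a) k) (Fin.tail x)) α
      rw [Pi.add_apply, ih c s' hs', ih (c + 1) s'' hs'', add_zero] at e'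
      rw [← Fin.cons_self_tail x]
      exact e'
  intro c s hs
  funext a
  exact key a c s hs

/-! ### Operators determined by their contractions -/

/-- `∑_i (-1)^{i+1} η(…, x̂_i, … ∣ f(x_i), …)` (with `1`-based `i`). -/
def insertOne (f : M →ₗ[𝕂] N) : Fam M N V →ₗ[𝕂] Fam M N V where
  toFun η := fun a k => match a with
    | 0 => fun _ _ => 0
    | a + 1 => fun x α => ∑ i : Fin (a + 1), (-1 : 𝕂) ^ (i : ℕ) •
        η a (k + 1) (i.removeNth x) (Fin.cons (f (x i)) α : Fin (k + 1) → N)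
  map_add' η θ := by
    funext a k x α
    cases a <;> simp [Finset.sum_add_distrib]
  map_smul' c η := by
    funext a k x α
    cases a <;> simp [Finset.smul_sum, smul_comm c]

/-- `∑_{i<j} (-1)^{i+j+1} η(…, x̂_i, …, x̂_j, … ∣ t(x_i, x_j), …)` (with `1`-based `i, j`); as in
`ternaryTerm`, the entries are removed one after the other. -/
def insertTwo (t : M →ₗ[𝕂] M →ₗ[𝕂] N) : Fam M N V →ₗ[𝕂] Fam M N V where
  toFun η := fun a k => match a with
    | 0 => fun _ _ => 0
    | 1 => fun _ _ => 0
    | a + 2 => fun x α => ∑ i : Fin (a + 2), ∑ j : Fin (a + 1),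
        if (i : ℕ) ≤ j then (-1 : 𝕂) ^ ((i : ℕ) + j) •
          η a (k + 1) (j.removeNth (i.removeNth x))
            (Fin.cons (t (x i) (i.removeNth x j)) α : Fin (k + 1) → N)
        else 0
  map_add' η θ := by
    funext a k x α
    match a with
    | 0 => simp
    | 1 => simp
    | a + 2 =>
      simp only [Pi.add_apply, ← Finset.sum_add_distrib]
      refine Finset.sum_congr rfl fun i _ => Finset.sum_congr rfl fun j _ => ?_
      split_ifs <;> simp
  map_smul' c η := by
    funext a k x α
    match a with
    | 0 => simp
    | 1 => simp
    | a + 2 =>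
      simp only [Pi.smul_apply, Finset.smul_sum, RingHom.id_apply]
      refine Finset.sum_congr rfl fun i _ => Finset.sum_congr rfl fun j _ => ?_
      split_ifs <;> simp [smul_comm c]

/-- The operator induced by endomorphisms `ρ`, `u`, `v` of `V`, `M`, `N`: the sum of `ρ`, applied to
the value, and of `u` and `v`, applied to one argument at a time. -/
def lieDerivative (ρ : Module.End 𝕂 V) (u : Module.End 𝕂 M) (v : Module.End 𝕂 N) :
    Fam M N V →ₗ[𝕂] Fam M N V where
  toFun η := fun a k x α => ρ (η a k x α) +
    ∑ j : Fin a, η a k (Function.update x j (u (x j))) α +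
    ∑ j : Fin k, η a k x (Function.update α j (v (α j)))
  map_add' η θ := by
    funext a k x α
    simp only [Pi.add_apply, map_add, Finset.sum_add_distrib]
    abel
  map_smul' c η := by
    funext a k x α
    simp only [Pi.smul_apply, map_smul, smul_add, Finset.smul_sum, RingHom.id_apply]

theorem insertOne_zero_left (f : M →ₗ[𝕂] N) (η : Fam M N V) : insertOne f η 0 = 0 := rfl

theorem insertTwo_zero_left (t : M →ₗ[𝕂] M →ₗ[𝕂] N) (η : Fam M N V) : insertTwo t η 0 = 0 := rfl

/-- Together with `insertOne_zero_left` this recursion determines `insertOne f`. -/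
theorem contract_insertOne (f : M →ₗ[𝕂] N) (y : M) (η : Fam M N V) :
    ι y (insertOne f η) = κ (f y) η - insertOne f (ι y η) := by
  funext a k x α
  change ∑ i : Fin (a + 1), (-1 : 𝕂) ^ (i : ℕ) • η a (k + 1)
      (i.removeNth (Fin.cons y x : Fin (a + 1) → M))
      (Fin.cons (f ((Fin.cons y x : Fin (a + 1) → M) i)) α : Fin (k + 1) → N) = _
  rw [Fin.sum_univ_succ]
  cases a with
  | zero => simp [contract', insertOne]
  | succ a =>
    simp only [removeNth_succ_cons, Fin.cons_succ, Fin.cons_zero, Fin.val_succ, pow_succ]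
    simp [contract', insertOne, contract, sub_eq_add_neg]

/-- Together with `insertTwo_zero_left` this recursion determines `insertTwo t`. -/
theorem contract_insertTwo (t : M →ₗ[𝕂] M →ₗ[𝕂] N) (y : M) (η : Fam M N V) :
    ι y (insertTwo t η) = insertTwo t (ι y η) + insertOne (t y) η := by
  funext a k x α
  cases a with
  | zero => simp [contract, insertOne, insertTwo]
  | succ a =>
    change ∑ i : Fin (a + 2), ∑ j : Fin (a + 1), (if (i : ℕ) ≤ j then (-1 : 𝕂) ^ ((i : ℕ) + j) •
          η a (k + 1) (j.removeNth (i.removeNth (Fin.cons y x : Fin (a + 2) → M)))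
            (Fin.cons (t ((Fin.cons y x : Fin (a + 2) → M) i)
              (i.removeNth (Fin.cons y x : Fin (a + 2) → M) j)) α : Fin (k + 1) → N)
        else 0) = _
    rw [Fin.sum_univ_succ, add_comm]
    congr 1
    · cases a with
      | zero => simp [insertTwo]
      | succ a =>
        change _ = ∑ i : Fin (a + 2), ∑ j : Fin (a + 1), (if (i : ℕ) ≤ j then
          (-1 : 𝕂) ^ ((i : ℕ) + j) • η (a + 1) (k + 1)
            (Fin.cons y (j.removeNth (i.removeNth x)) : Fin (a + 1) → M)
            (Fin.cons (t (x i) (i.removeNth x j)) α : Fin (k + 1) → N) else 0)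
        refine Finset.sum_congr rfl fun i _ => ?_
        rw [Fin.sum_univ_succ]
        simp only [removeNth_succ_cons, Fin.cons_succ, Fin.val_succ, Fin.val_zero,
          Nat.add_le_add_iff_right]
        rw [if_neg (by omega), zero_add]
        refine Finset.sum_congr rfl fun j _ => ?_
        congr 2
        rw [show (i : ℕ) + 1 + (j + 1) = i + j + 2 by ring, pow_add]
        simp
    · simp [insertOne]

theorem contract_lieDerivative (ρ : Module.End 𝕂 V) (u : Module.End 𝕂 M) (v : Module.End 𝕂 N)
    (y : M) (η : Fam M N V) :
    ι y (lieDerivative ρ u v η) = lieDerivative ρ u v (ι y η) + ι (u y) η := by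
  funext a k x α
  simp only [contract, lieDerivative, LinearMap.coe_mk, AddHom.coe_mk, Pi.add_apply,
    Fin.sum_univ_succ, Fin.cons_zero, Fin.cons_succ, update_zero_cons, update_succ_cons]
  abel

theorem contract'_lieDerivative (ρ : Module.End 𝕂 V) (u : Module.End 𝕂 M) (v : Module.End 𝕂 N)
    (β : N) (η : Fam M N V) :
    κ β (lieDerivative ρ u v η) = lieDerivative ρ u v (κ β η) + κ (v β) η := by
  funext a k x α
  simp only [contract', lieDerivative, LinearMap.coe_mk, AddHom.coe_mk, Pi.add_apply,
    Fin.sum_univ_succ, Fin.cons_zero, Fin.cons_succ, update_zero_cons, update_succ_cons]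
  abel

/-! ### The terms of the differentials -/

theorem contract_ternaryTerm (t : M →ₗ[𝕂] M →ₗ[𝕂] M →ₗ[𝕂] N) (y : M) (η : Fam M N V) :
    ι y (ternaryTerm t η) = insertTwo (t y) η - ternaryTerm t (ι y η) := by
  funext a k x α
  match a with
  | 0 => simp [contract, ternaryTerm, insertTwo]
  | 1 => simp [contract, ternaryTerm, insertTwo]
  | a + 2 =>
    change ∑ i : Fin (a + 3), ∑ j : Fin (a + 2), ∑ m : Fin (a + 1),
        (if (i : ℕ) ≤ j ∧ (j : ℕ) ≤ m then
          (-1 : 𝕂) ^ ((i : ℕ) + j + m) •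
            η a (k + 1) (m.removeNth (j.removeNth (i.removeNth
              (Fin.cons y x : Fin (a + 3) → M))))
              (Fin.cons (t ((Fin.cons y x : Fin (a + 3) → M) i)
                (i.removeNth (Fin.cons y x : Fin (a + 3) → M) j)
                (j.removeNth (i.removeNth (Fin.cons y x : Fin (a + 3) → M)) m)) α :
                Fin (k + 1) → N)
        else 0) = _
    rw [Fin.sum_univ_succ, Pi.sub_apply, Pi.sub_apply, Pi.sub_apply, Pi.sub_apply,
      sub_eq_add_neg]
    congr 1
    · simp only [removeNth_zero_cons, Fin.cons_zero, Fin.val_zero, zero_add, zero_le, true_and]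
      rfl
    · cases a with
      | zero =>
        refine (Finset.sum_eq_zero fun i _ => Finset.sum_eq_zero fun j _ =>
          Finset.sum_eq_zero fun m _ => if_neg ?_).trans ?_
        · simp only [Fin.val_succ]
          omega
        · simp [ternaryTerm]
      | succ a =>
        change _ = -∑ i : Fin (a + 3), ∑ j : Fin (a + 2), ∑ m : Fin (a + 1),
          (if (i : ℕ) ≤ j ∧ (j : ℕ) ≤ m then
            (-1 : 𝕂) ^ ((i : ℕ) + j + m) •
              η (a + 1) (k + 1) (Fin.cons y (m.removeNth (j.removeNth (i.removeNth x))) :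
                  Fin (a + 1) → M)
                (Fin.cons (t (x i) (i.removeNth x j) (j.removeNth (i.removeNth x) m)) α :
                  Fin (k + 1) → N)
          else 0)
        rw [← Finset.sum_neg_distrib]
        refine Finset.sum_congr rfl fun i _ => ?_
        rw [Fin.sum_univ_succ, ← Finset.sum_neg_distrib, Finset.sum_eq_zero, zero_add]
        · refine Finset.sum_congr rfl fun j _ => ?_
          rw [Fin.sum_univ_succ, ← Finset.sum_neg_distrib, if_neg (by simp), zero_add]
          refine Finset.sum_congr rfl fun m _ => ?_
          simp only [removeNth_succ_cons, Fin.cons_succ, Fin.val_succ, Nat.add_le_add_iff_right]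
          rw [show (i : ℕ) + 1 + (j + 1) + (m + 1) = i + j + m + 3 by ring, pow_add]
          split_ifs <;> simp [pow_succ]
        · intro m _
          exact if_neg (by simp)

theorem contract'_insertTerm (d : N →ₗ[𝕂] M) (β : N) (η : Fam M N V) :
    κ β (insertTerm d η) = insertTerm d (κ β η) + ι (d β) η := by
  funext a k x α
  change ∑ i : Fin (k + 1), η (a + 1) k
      (Fin.cons (d ((Fin.cons β α : Fin (k + 1) → N) i)) x : Fin (a + 1) → M)
      (i.removeNth (Fin.cons β α : Fin (k + 1) → N)) = _
  rw [Fin.sum_univ_succ, add_comm]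
  congr 1
  cases k with
  | zero => simp [insertTerm]
  | succ k => simp only [removeNth_succ_cons, Fin.cons_succ]; rfl

end Contractions

section WeakFamilies

variable {𝕂 M N V : Type*} [Field 𝕂] [AddCommGroup M] [Module 𝕂 M] [AddCommGroup N] [Module 𝕂 N]
  [AddCommGroup V] [Module 𝕂 V]

local notation "ι" => contract 𝕂 N V
local notation "κ" => contract' 𝕂 M V

/-! ### Weakly symmetric families -/

variable (V) in
/-- The families satisfying all the conditions of `weakCochains` except for being concentrated in
one degree. -/
def weakFamilies (h : M →ₗ[𝕂] M →ₗ[𝕂] N) : Submodule 𝕂 (Fam M N V) where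
  carrier := {η | (∀ a k : ℕ, ∃ F : MultilinearMap 𝕂 (fun _ : Fin a => M)
      (MultilinearMap 𝕂 (fun _ : Fin k => N) V), ∀ x α, η a k x α = F x α) ∧
    (∀ (a k : ℕ) (x : Fin a → M) (α : Fin k → N) (σ : Equiv.Perm (Fin k)),
      η a k x (α ∘ σ) = η a k x α) ∧
    ∀ (a k : ℕ) (i : Fin (a + 1)) (x : Fin (a + 2) → M) (α : Fin k → N),
      η (a + 2) k x α + η (a + 2) k (x ∘ Equiv.swap i.castSucc i.succ) α =
        - η a (k + 1) (i.removeNth (i.castSucc.removeNth x))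
            (Fin.cons (h (x i.castSucc) (x i.succ)) α : Fin (k + 1) → N)}
  add_mem' := by
    rintro η θ ⟨h₁, h₂, h₃⟩ ⟨h₁', h₂', h₃'⟩
    refine ⟨fun a k => ?_, fun a k x α σ => ?_, fun a k i x α => ?_⟩
    · obtain ⟨F, hF⟩ := h₁ a k
      obtain ⟨G, hG⟩ := h₁' a k
      exact ⟨F + G, fun x α => by simp [hF, hG]⟩
    · simp [h₂, h₂']
    · simp only [Pi.add_apply, neg_add]
      rw [← h₃ a k i x α, ← h₃' a k i x α]
      abel
  zero_mem' := ⟨fun _ _ => ⟨0, fun _ _ => rfl⟩, fun _ _ _ _ _ => rfl, fun _ _ _ _ _ => by simp⟩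
  smul_mem' := by
    rintro c η ⟨h₁, h₂, h₃⟩
    refine ⟨fun a k => ?_, fun a k x α σ => ?_, fun a k i x α => ?_⟩
    · obtain ⟨F, hF⟩ := h₁ a k
      exact ⟨c • F, fun x α => by simp [hF]⟩
    · simp [h₂]
    · simp only [Pi.smul_apply]
      rw [← smul_add, h₃ a k i x α, smul_neg]

variable (𝕂 M N V) in
/-- The families concentrated in the degrees `(a, k)` with `a + 2 k = n`. -/
def concentrated (n : ℤ) : Submodule 𝕂 (Fam M N V) where
  carrier := {η | ∀ a k : ℕ, (a : ℤ) + 2 * k ≠ n → η a k = 0}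
  add_mem' := by
    intro η θ h h' a k hn
    simp [h a k hn, h' a k hn]
  zero_mem' := fun _ _ _ => rfl
  smul_mem' := by
    intro c η h a k hn
    simp [h a k hn]

theorem weakCochains_eq (h : M →ₗ[𝕂] M →ₗ[𝕂] N) (n : ℤ) :
    weakCochains 𝕂 V h n = concentrated 𝕂 M N V n ⊓ weakFamilies V h := by
  ext η
  exact ⟨fun ⟨⟨h₁, h₂, h₃⟩, h₄⟩ => ⟨h₁, h₂, h₃, h₄⟩, fun ⟨h₁, h₂, h₃, h₄⟩ => ⟨⟨h₁, h₂, h₃⟩, h₄⟩⟩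

/-- In characteristic zero the alternating cochains are the weakly symmetric ones for `h = 0`. -/
theorem alternatingCochains_eq [CharZero 𝕂] (n : ℤ) :
    alternatingCochains 𝕂 M N V n = weakCochains 𝕂 V (0 : M →ₗ[𝕂] M →ₗ[𝕂] N) n := by
  ext η
  refine ⟨fun ⟨h₁, h₂⟩ => ⟨h₁, fun a k i x α => ?_⟩, fun ⟨h₁, h₂⟩ => ⟨h₁, ?_⟩⟩
  · obtain ⟨F, hF⟩ := h₁.2.1 (a + 2) k
    obtain ⟨G, hG⟩ := h₁.2.1 a (k + 1)
    let A : M [⋀^Fin (a + 2)]→ₗ[𝕂] V :=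
      { MultilinearMap.mk' (fun x => F x α) (fun x i u v => by simp) (fun x i c u => by simp) with
        map_eq_zero_of_eq' := fun x i j hx hij => (hF x α).symm.trans (h₂ _ _ _ _ i j hx hij) }
    have hA : ∀ x, η (a + 2) k x α = A x := fun x => hF x α
    rw [hA, hA, A.map_swap x (ne_of_lt (Fin.castSucc_lt_succ)), add_neg_cancel, hG,
      MultilinearMap.map_coord_zero (i := 0) _ rfl, neg_zero]
  · intro a k x α i j hx hij
    match a with
    | 0 => exact i.elim0
    | 1 => exact absurd (Subsingleton.elim i j) hij
    | a + 2 =>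
      have hswap : ∀ (i : Fin (a + 1)) (x : Fin (a + 2) → M),
          η (a + 2) k (x ∘ Equiv.swap i.castSucc i.succ) α = - η (a + 2) k x α := by
        intro i x
        obtain ⟨G, hG⟩ := h₁.2.1 a (k + 1)
        have := h₂ a k i x α
        rw [hG, MultilinearMap.map_coord_zero (i := 0) _ rfl, neg_zero] at this
        exact eq_neg_of_add_eq_zero_right this
      have hsign : ∀ (σ : Equiv.Perm (Fin (a + 2))) (x : Fin (a + 2) → M),
          η (a + 2) k (x ∘ σ) α = (Equiv.Perm.sign σ : ℤ) • η (a + 2) k x α := by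
        intro σ
        have hσ : σ ∈ Submonoid.closure
            (Set.range fun i : Fin (a + 1) => Equiv.swap i.castSucc i.succ) := by
          rw [Equiv.Perm.mclosure_swap_castSucc_succ]
          trivial
        induction hσ using Submonoid.closure_induction with
        | mem σ hσ =>
          obtain ⟨i, rfl⟩ := hσ
          intro x
          simp only [hswap, Equiv.Perm.sign_swap (ne_of_lt (Fin.castSucc_lt_succ (i := i)))]
          simp
        | one => intro x; simp
        | mul σ τ _ _ h₁ h₂ =>
          intro x
          rw [Equiv.Perm.coe_mul, ← Function.comp_assoc, h₂, h₁, smul_smul, mul_comm]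
          simp
      have h := hsign (Equiv.swap i j) x
      rw [Equiv.Perm.sign_swap hij, show x ∘ Equiv.swap i j = x from ?_] at h
      · have h' : (2 : 𝕂) • η (a + 2) k x α = 0 := by
          rw [two_smul]
          nth_rewrite 1 [h]
          simp
        exact (smul_eq_zero.mp h').resolve_left two_ne_zero
      · funext l
        rw [Function.comp_apply, Equiv.swap_apply_def]
        split_ifs with h₁ h₂
        · rw [h₁, hx]
        · rw [h₂, hx]
        · rfl

/-- A submodule of families stable under contractions, on which contractions are linear, those with
elements of `N` commute, and those with elements of `M` anticommute up to `h`. The weakly symmetric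
families form the largest submodule of this kind. -/
structure IsContractible (h : M →ₗ[𝕂] M →ₗ[𝕂] N) (S : Submodule 𝕂 (Fam M N V)) : Prop where
  contract_mem : ∀ η ∈ S, ∀ x, ι x η ∈ S
  contract'_mem : ∀ η ∈ S, ∀ α, κ α η ∈ S
  contract_add : ∀ η ∈ S, ∀ x y, ι (x + y) η = ι x η + ι y η
  contract_smul : ∀ η ∈ S, ∀ (c : 𝕂) x, ι (c • x) η = c • ι x η
  contract'_add : ∀ η ∈ S, ∀ α β, κ (α + β) η = κ α η + κ β η
  contract'_smul : ∀ η ∈ S, ∀ (c : 𝕂) α, κ (c • α) η = c • κ α η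
  contract'_comm : ∀ η ∈ S, ∀ α β, κ α (κ β η) = κ β (κ α η)
  contract_anticomm : ∀ η ∈ S, ∀ x y, ι x (ι y η) + ι y (ι x η) = -κ (h y x) η

theorem isContractible_weakFamilies (h : M →ₗ[𝕂] M →ₗ[𝕂] N) :
    IsContractible h (weakFamilies V h) where
  contract_mem := by
    rintro η ⟨h₁, h₂, h₃⟩ x
    refine ⟨fun a k => ?_, fun a k y α σ => h₂ _ _ _ _ _, fun a k i y α => ?_⟩
    · obtain ⟨F, hF⟩ := h₁ (a + 1) k
      exact ⟨F.curryLeft x, fun y α => hF _ _⟩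
    · have := h₃ (a + 1) k i.succ (Fin.cons x y : Fin (a + 3) → M) α
      rw [cons_comp_swap_succ, ← Fin.succ_castSucc, removeNth_succ_cons, removeNth_succ_cons] at this
      exact this
  contract'_mem := by
    rintro η ⟨h₁, h₂, h₃⟩ β
    have hσ : ∀ {k : ℕ} (α : Fin k → N) (σ : Equiv.Perm (Fin k)),
        (Fin.cons β (α ∘ σ) : Fin (k + 1) → N) =
          (Fin.cons β α : Fin (k + 1) → N) ∘ (Equiv.Perm.decomposeFin.symm (0, σ)) := by
      intro k α σ
      funext j
      cases j using Fin.cases <;> simp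
    refine ⟨fun a k => ?_, fun a k y α σ => ?_, fun a k i y α => ?_⟩
    · obtain ⟨F, hF⟩ := h₁ a (k + 1)
      exact ⟨MultilinearMap.mk' (fun y => (F y).curryLeft β)
        (fun y i u v => by ext; simp) (fun y i c u => by ext; simp), fun y α => hF _ _⟩
    · change η a (k + 1) y _ = η a (k + 1) y _
      rw [hσ, h₂]
    · refine (h₃ a (k + 1) i y _).trans (congrArg Neg.neg ?_)
      change η a (k + 2) _ _ = η a (k + 2) _ _
      rw [← h₂ a (k + 2) _ _ (Equiv.swap (0 : Fin (k + 1)).castSucc (0 : Fin (k + 1)).succ),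
        cons_comp_swap_zero]
  contract_add := by
    rintro η ⟨h₁, -, -⟩ x y
    funext a k z α
    obtain ⟨F, hF⟩ := h₁ (a + 1) k
    change η _ _ _ _ = η _ _ _ _ + η _ _ _ _
    rw [hF, hF, hF, F.cons_add]
    rfl
  contract_smul := by
    rintro η ⟨h₁, -, -⟩ c x
    funext a k z α
    obtain ⟨F, hF⟩ := h₁ (a + 1) k
    change η _ _ _ _ = c • η _ _ _ _
    rw [hF, hF, F.cons_smul]
    rfl
  contract'_add := by
    rintro η ⟨h₁, -, -⟩ β γ
    funext a k z α
    obtain ⟨F, hF⟩ := h₁ a (k + 1)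
    change η _ _ _ _ = η _ _ _ _ + η _ _ _ _
    rw [hF, hF, hF, (F z).cons_add]
  contract'_smul := by
    rintro η ⟨h₁, -, -⟩ c β
    funext a k z α
    obtain ⟨F, hF⟩ := h₁ a (k + 1)
    change η _ _ _ _ = c • η _ _ _ _
    rw [hF, hF, (F z).cons_smul]
  contract'_comm := by
    rintro η ⟨-, h₂, -⟩ β γ
    funext a k z α
    change η a (k + 2) _ _ = η a (k + 2) _ _
    rw [← h₂ a (k + 2) _ _ (Equiv.swap (0 : Fin (k + 1)).castSucc (0 : Fin (k + 1)).succ),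
      cons_comp_swap_zero]
  contract_anticomm := by
    rintro η ⟨-, -, h₃⟩ x y
    funext a k z α
    have := h₃ a k 0 (Fin.cons y (Fin.cons x z : Fin (a + 1) → M) : Fin (a + 2) → M) α
    rw [cons_comp_swap_zero] at this
    exact this

/-- A contractible submodule consists of weakly symmetric families: each condition in the first
arguments is one on iterated contractions, and it propagates to the other arguments by induction.
Thus, to see that an operator preserves weak symmetry, it suffices to compute its contractions. -/
theorem IsContractible.le_weakFamilies {h : M →ₗ[𝕂] M →ₗ[𝕂] N} {S : Submodule 𝕂 (Fam M N V)}
    (hS : IsContractible h S) : S ≤ weakFamilies V h := by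
  have add : ∀ a k, ∀ η ∈ S, ∀ (x : Fin a → M) i u v α,
      η a k (Function.update x i (u + v)) α =
        η a k (Function.update x i u) α + η a k (Function.update x i v) α := by
    intro a k
    induction a with
    | zero => intro η _ x i; exact i.elim0
    | succ a ih =>
      intro η hη x i u v α
      rw [← Fin.cons_self_tail x]
      cases i using Fin.cases with
      | zero =>
        simp only [update_zero_cons]
        exact congrFun (congrFun (congrFun (congrFun (hS.contract_add η hη u v) a) k) _) α
      | succ i =>
        simp only [update_succ_cons]
        exact ih _ (hS.contract_mem η hη (x 0)) _ _ _ _ _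
  have smul : ∀ a k, ∀ η ∈ S, ∀ (x : Fin a → M) i (c : 𝕂) u α,
      η a k (Function.update x i (c • u)) α = c • η a k (Function.update x i u) α := by
    intro a k
    induction a with
    | zero => intro η _ x i; exact i.elim0
    | succ a ih =>
      intro η hη x i c u α
      rw [← Fin.cons_self_tail x]
      cases i using Fin.cases with
      | zero =>
        simp only [update_zero_cons]
        exact congrFun (congrFun (congrFun (congrFun (hS.contract_smul η hη c u) a) k) _) α
      | succ i =>
        simp only [update_succ_cons]
        exact ih _ (hS.contract_mem η hη (x 0)) _ _ _ _ _
  have add' : ∀ k a, ∀ η ∈ S, ∀ (x : Fin a → M) (α : Fin k → N) i u v,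
      η a k x (Function.update α i (u + v)) =
        η a k x (Function.update α i u) + η a k x (Function.update α i v) := by
    intro k a
    induction k with
    | zero => intro η _ x α i; exact i.elim0
    | succ k ih =>
      intro η hη x α i u v
      rw [← Fin.cons_self_tail α]
      cases i using Fin.cases with
      | zero =>
        simp only [update_zero_cons]
        exact congrFun (congrFun (congrFun (congrFun (hS.contract'_add η hη u v) a) k) x) _
      | succ i =>
        simp only [update_succ_cons]
        exact ih _ (hS.contract'_mem η hη (α 0)) _ _ _ _ _
  have smul' : ∀ k a, ∀ η ∈ S, ∀ (x : Fin a → M) (α : Fin k → N) i (c : 𝕂) u,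
      η a k x (Function.update α i (c • u)) = c • η a k x (Function.update α i u) := by
    intro k a
    induction k with
    | zero => intro η _ x α i; exact i.elim0
    | succ k ih =>
      intro η hη x α i c u
      rw [← Fin.cons_self_tail α]
      cases i using Fin.cases with
      | zero =>
        simp only [update_zero_cons]
        exact congrFun (congrFun (congrFun (congrFun (hS.contract'_smul η hη c u) a) k) x) _
      | succ i =>
        simp only [update_succ_cons]
        exact ih _ (hS.contract'_mem η hη (α 0)) _ _ _ _ _
  have swap : ∀ k a, ∀ η ∈ S, ∀ (x : Fin a → M) (α : Fin (k + 1) → N) (i : Fin k),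
      η a (k + 1) x (α ∘ Equiv.swap i.castSucc i.succ) = η a (k + 1) x α := by
    intro k a
    induction k with
    | zero => intro η _ x α i; exact i.elim0
    | succ k ih =>
      intro η hη x α i
      rw [← Fin.cons_self_tail α]
      cases i using Fin.cases with
      | zero =>
        rw [← Fin.cons_self_tail (Fin.tail α), cons_comp_swap_zero]
        exact congrFun (congrFun (congrFun (congrFun (hS.contract'_comm η hη _ _) a) k) x) _
      | succ i =>
        cases k with
        | zero => exact i.elim0
        | succ k =>
          rw [cons_comp_swap_succ]
          exact ih _ (hS.contract'_mem η hη (α 0)) _ _ _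
  have weak : ∀ a k, ∀ η ∈ S, ∀ (i : Fin (a + 1)) (x : Fin (a + 2) → M) (α : Fin k → N),
      η (a + 2) k x α + η (a + 2) k (x ∘ Equiv.swap i.castSucc i.succ) α =
        - η a (k + 1) (i.removeNth (i.castSucc.removeNth x))
            (Fin.cons (h (x i.castSucc) (x i.succ)) α : Fin (k + 1) → N) := by
    intro a k
    induction a with
    | zero =>
      intro η hη i x α
      obtain rfl : i = 0 := by omega
      rw [← Fin.cons_self_tail x, ← Fin.cons_self_tail (Fin.tail x), cons_comp_swap_zero]
      exact congrFun (congrFun (congrFun (congrFun (hS.contract_anticomm η hη _ _) _) _) _) _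
    | succ a ih =>
      intro η hη i x α
      rw [← Fin.cons_self_tail x]
      cases i using Fin.cases with
      | zero =>
        rw [← Fin.cons_self_tail (Fin.tail x), cons_comp_swap_zero]
        exact congrFun (congrFun (congrFun (congrFun (hS.contract_anticomm η hη _ _) _) _) _) _
      | succ i =>
        rw [cons_comp_swap_succ, ← Fin.succ_castSucc, removeNth_succ_cons, removeNth_succ_cons]
        exact ih (ι (x 0) η) (hS.contract_mem η hη (x 0)) i _ _
  intro η hη
  refine ⟨fun a k => ?_, fun a k x α σ => ?_, fun a k i => ?_⟩
  · exact ⟨MultilinearMap.mk' (fun x => MultilinearMap.mk' (fun α => η a k x α)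
      (fun α i u v => add' _ _ η hη _ _ _ _ _) (fun α i c u => smul' _ _ η hη _ _ _ _ _))
      (fun x i u v => MultilinearMap.ext fun α => add _ _ η hη _ _ _ _ _)
      (fun x i c u => MultilinearMap.ext fun α => smul _ _ η hη _ _ _ _ _), fun _ _ => rfl⟩
  · cases k with
    | zero => rw [Subsingleton.elim (α ∘ σ) α]
    | succ k =>
      have hσ : σ ∈ Submonoid.closure
          (Set.range fun i : Fin k => Equiv.swap i.castSucc i.succ) := by
        rw [Equiv.Perm.mclosure_swap_castSucc_succ]
        trivial
      induction hσ using Submonoid.closure_induction generalizing α with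
      | mem σ hσ =>
        obtain ⟨i, rfl⟩ := hσ
        exact swap _ _ η hη _ _ _
      | one => rfl
      | mul σ τ _ _ h₁ h₂ =>
        rw [Equiv.Perm.coe_mul, ← Function.comp_assoc, h₂, h₁]
  · exact weak a k η hη i

end WeakFamilies

section Calculus

variable {𝕂 M N V : Type*} [Field 𝕂] [AddCommGroup M] [Module 𝕂 M] [AddCommGroup N] [Module 𝕂 N]
  [AddCommGroup V] [Module 𝕂 V] {h : M →ₗ[𝕂] M →ₗ[𝕂] N} {η : Fam M N V}

local notation "ι" => contract 𝕂 N V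
local notation "κ" => contract' 𝕂 M V

/-! ### Calculus of contractions on weakly symmetric families -/

theorem contract_mem (hη : η ∈ weakFamilies V h) (x : M) : ι x η ∈ weakFamilies V h :=
  (isContractible_weakFamilies h).contract_mem η hη x

theorem contract'_mem (hη : η ∈ weakFamilies V h) (α : N) : κ α η ∈ weakFamilies V h :=
  (isContractible_weakFamilies h).contract'_mem η hη α

theorem contract_add (hη : η ∈ weakFamilies V h) (x y : M) : ι (x + y) η = ι x η + ι y η :=
  (isContractible_weakFamilies h).contract_add η hη x y

theorem contract_smul (hη : η ∈ weakFamilies V h) (c : 𝕂) (x : M) : ι (c • x) η = c • ι x η :=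
  (isContractible_weakFamilies h).contract_smul η hη c x

theorem contract'_add (hη : η ∈ weakFamilies V h) (α β : N) : κ (α + β) η = κ α η + κ β η :=
  (isContractible_weakFamilies h).contract'_add η hη α β

theorem contract'_smul (hη : η ∈ weakFamilies V h) (c : 𝕂) (α : N) : κ (c • α) η = c • κ α η :=
  (isContractible_weakFamilies h).contract'_smul η hη c α

theorem contract'_comm (hη : η ∈ weakFamilies V h) (α β : N) : κ α (κ β η) = κ β (κ α η) :=
  (isContractible_weakFamilies h).contract'_comm η hη α β

theorem contract_anticomm (hη : η ∈ weakFamilies V h) (x y : M) :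
    ι x (ι y η) + ι y (ι x η) = -κ (h y x) η :=
  (isContractible_weakFamilies h).contract_anticomm η hη x y

theorem contract_zero (hη : η ∈ weakFamilies V h) : ι 0 η = 0 := by
  simpa using contract_smul hη 0 0

theorem contract'_zero (hη : η ∈ weakFamilies V h) : κ 0 η = 0 := by
  simpa using contract'_smul hη 0 0

theorem contract'_neg (hη : η ∈ weakFamilies V h) (α : N) : κ (-α) η = -κ α η := by
  simpa using contract'_smul hη (-1) α

theorem contract'_sub (hη : η ∈ weakFamilies V h) (α β : N) : κ (α - β) η = κ α η - κ β η := by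
  rw [sub_eq_add_neg, contract'_add hη, contract'_neg hη, sub_eq_add_neg]

theorem insertOne_add (hη : η ∈ weakFamilies V h) (f g : M →ₗ[𝕂] N) :
    insertOne (f + g) η = insertOne f η + insertOne g η := by
  funext a k x α
  cases a with
  | zero => simp [insertOne]
  | succ a =>
    simp only [insertOne, LinearMap.coe_mk, AddHom.coe_mk, Pi.add_apply, LinearMap.add_apply,
      ← Finset.sum_add_distrib, ← smul_add]
    refine Finset.sum_congr rfl fun i _ => congrArg _ ?_
    exact congrFun (congrFun (congrFun (congrFun (contract'_add hη (f (x i)) (g (x i))) a) k) _) α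

theorem insertOne_smul (hη : η ∈ weakFamilies V h) (c : 𝕂) (f : M →ₗ[𝕂] N) :
    insertOne (c • f) η = c • insertOne f η := by
  funext a k x α
  cases a with
  | zero => simp [insertOne]
  | succ a =>
    simp only [insertOne, LinearMap.coe_mk, AddHom.coe_mk, Pi.smul_apply, LinearMap.smul_apply,
      Finset.smul_sum, smul_comm c]
    refine Finset.sum_congr rfl fun i _ => congrArg _ ?_
    exact congrFun (congrFun (congrFun (congrFun (contract'_smul hη c (f (x i))) a) k) _) α

theorem insertOne_neg (hη : η ∈ weakFamilies V h) (f : M →ₗ[𝕂] N) :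
    insertOne (-f) η = -insertOne f η := by
  simpa using insertOne_smul hη (-1) f

theorem insertTwo_add (hη : η ∈ weakFamilies V h) (s t : M →ₗ[𝕂] M →ₗ[𝕂] N) :
    insertTwo (s + t) η = insertTwo s η + insertTwo t η := by
  rw [← sub_eq_zero]
  refine eq_zero_of_contract (𝕂 := 𝕂) (S := (weakFamilies V h : Set (Fam M N V)))
    (X := fun η => insertTwo (s + t) η - (insertTwo s η + insertTwo t η))
    (fun η _ => by simp [insertTwo_zero_left]) (fun η hη y => ⟨_, contract_mem hη y, ?_⟩) η hη
  simp only [map_sub, map_add, contract_insertTwo, LinearMap.add_apply, insertOne_add hη]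
  abel

theorem lieDerivative_add (hη : η ∈ weakFamilies V h) (ρ ρ' : Module.End 𝕂 V)
    (u u' : Module.End 𝕂 M) (v v' : Module.End 𝕂 N) :
    lieDerivative (ρ + ρ') (u + u') (v + v') η =
      lieDerivative ρ u v η + lieDerivative ρ' u' v' η := by
  funext a k x α
  obtain ⟨F, hF⟩ := hη.1 a k
  simp only [lieDerivative, LinearMap.coe_mk, AddHom.coe_mk, Pi.add_apply, LinearMap.add_apply,
    hF, MultilinearMap.map_update_add, _root_.add_apply, Finset.sum_add_distrib]
  abel

theorem contract'_insertOne (hη : η ∈ weakFamilies V h) (f : M →ₗ[𝕂] N) (β : N) :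
    κ β (insertOne f η) = insertOne f (κ β η) := by
  rw [← sub_eq_zero]
  refine eq_zero_of_contract (𝕂 := 𝕂) (S := (weakFamilies V h : Set (Fam M N V)))
    (X := fun η => κ β (insertOne f η) - insertOne f (κ β η))
    (fun η _ => by rw [Pi.sub_apply, insertOne_zero_left, sub_zero]; rfl)
    (fun η hη y => ⟨_, neg_mem (contract_mem hη y), ?_⟩) η hη
  simp only [map_sub, map_neg, ← contract'_contract, contract_insertOne, contract'_comm hη (f y) β]
  abel

theorem contract'_insertTwo (hη : η ∈ weakFamilies V h) (t : M →ₗ[𝕂] M →ₗ[𝕂] N) (β : N) :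
    κ β (insertTwo t η) = insertTwo t (κ β η) := by
  rw [← sub_eq_zero]
  refine eq_zero_of_contract (𝕂 := 𝕂) (S := (weakFamilies V h : Set (Fam M N V)))
    (X := fun η => κ β (insertTwo t η) - insertTwo t (κ β η))
    (fun η _ => by rw [Pi.sub_apply, insertTwo_zero_left, sub_zero]; rfl)
    (fun η hη y => ⟨_, contract_mem hη y, ?_⟩) η hη
  simp only [map_sub, map_add, ← contract'_contract, contract_insertTwo,
    contract'_insertOne hη]
  abel

theorem insertOne_anticomm (hη : η ∈ weakFamilies V h) (f g : M →ₗ[𝕂] N) :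
    insertOne f (insertOne g η) = -insertOne g (insertOne f η) := by
  rw [← add_eq_zero_iff_eq_neg]
  refine eq_zero_of_contract (𝕂 := 𝕂) (S := (weakFamilies V h : Set (Fam M N V)))
    (X := fun η => insertOne f (insertOne g η) + insertOne g (insertOne f η))
    (fun η _ => by simp [insertOne_zero_left])
    (fun η hη y => ⟨_, contract_mem hη y, ?_⟩) η hη
  simp only [map_sub, map_add, contract_insertOne, contract'_insertOne hη]
  abel

theorem insertTwo_insertOne (hη : η ∈ weakFamilies V h) (t : M →ₗ[𝕂] M →ₗ[𝕂] N)
    (f : M →ₗ[𝕂] N) : insertTwo t (insertOne f η) = insertOne f (insertTwo t η) := by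
  rw [← sub_eq_zero]
  refine eq_zero_of_contract (𝕂 := 𝕂) (S := (weakFamilies V h : Set (Fam M N V)))
    (X := fun η => insertTwo t (insertOne f η) - insertOne f (insertTwo t η))
    (fun η _ => by simp [insertOne_zero_left, insertTwo_zero_left])
    (fun η hη y => ⟨_, neg_mem (contract_mem hη y), ?_⟩) η hη
  simp only [map_sub, map_add, map_neg, contract_insertOne, contract_insertTwo,
    contract'_insertTwo hη, insertOne_anticomm hη (t y) f]
  abel

theorem lieDerivative_insertOne (hη : η ∈ weakFamilies V h) (ρ : Module.End 𝕂 V)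
    (u : Module.End 𝕂 M) (v : Module.End 𝕂 N) (f : M →ₗ[𝕂] N) :
    lieDerivative ρ u v (insertOne f η) =
      insertOne f (lieDerivative ρ u v η) + insertOne (f ∘ₗ u - v ∘ₗ f) η := by
  rw [← sub_eq_zero]
  refine eq_zero_of_contract (𝕂 := 𝕂) (S := (weakFamilies V h : Set (Fam M N V)))
    (X := fun η => lieDerivative ρ u v (insertOne f η) -
      (insertOne f (lieDerivative ρ u v η) + insertOne (f ∘ₗ u - v ∘ₗ f) η))
    (fun η _ => ?_)
    (fun η hη y => ⟨_, neg_mem (contract_mem hη y), ?_⟩) η hη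
  · funext k x α
    simp [lieDerivative, insertOne]
  · simp only [map_sub, map_add, map_neg, contract_insertOne, contract_lieDerivative,
      contract'_lieDerivative, contract'_sub hη, LinearMap.sub_apply, LinearMap.comp_apply]
    abel

/-- The weakly symmetric families and their images under `insertOne f` span a contractible
submodule. -/
theorem insertOne_mem (hη : η ∈ weakFamilies V h) (f : M →ₗ[𝕂] N) :
    insertOne f η ∈ weakFamilies V h := by
  have key : IsContractible h (weakFamilies V h ⊔ (weakFamilies V h).map (insertOne f)) := by
    have hle : weakFamilies V h ≤ weakFamilies V h ⊔ (weakFamilies V h).map (insertOne f) :=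
      le_sup_left
    have hins : ∀ ξ ∈ weakFamilies V h,
        insertOne f ξ ∈ weakFamilies V h ⊔ (weakFamilies V h).map (insertOne f) :=
      fun ξ hξ => le_sup_right (a := weakFamilies V h) (Submodule.mem_map_of_mem hξ)
    constructor
    all_goals
      intro θ hθ
      obtain ⟨ζ, hζ, _, ⟨ξ, hξ, rfl⟩, rfl⟩ := Submodule.mem_sup.mp hθ
    · intro x
      rw [map_add, contract_insertOne]
      exact add_mem (hle (contract_mem hζ x))
        (sub_mem (hle (contract'_mem hξ _)) (hins _ (contract_mem hξ x)))
    · intro α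
      rw [map_add, contract'_insertOne hξ]
      exact add_mem (hle (contract'_mem hζ α)) (hins _ (contract'_mem hξ α))
    · intro x y
      simp only [map_add, contract_insertOne, contract_add hζ, contract_add hξ, contract'_add hξ]
      abel
    · intro c x
      simp only [map_add, map_smul, contract_insertOne, contract_smul hζ, contract_smul hξ,
        contract'_smul hξ]
      module
    · intro α β
      simp only [map_add, contract'_insertOne hξ, contract'_add hζ, contract'_add hξ]
      abel
    · intro c α
      simp only [map_add, map_smul, contract'_insertOne hξ, contract'_smul hζ, contract'_smul hξ]
      module
    · intro α β
      simp only [map_add, contract'_insertOne hξ, contract'_insertOne (contract'_mem hξ _),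
        contract'_comm hζ α β, contract'_comm hξ α β]
    · intro x y
      have e₁ := contract_anticomm hζ x y
      have e₂ := congrArg (insertOne f) (contract_anticomm hξ x y)
      simp only [map_add, map_neg, map_sub, contract_insertOne, contract'_insertOne hξ,
        contract'_contract] at e₁ e₂ ⊢
      rw [neg_add, ← e₁, ← e₂]
      abel
  exact key.le_weakFamilies (le_sup_right (a := weakFamilies V h) (Submodule.mem_map_of_mem hη))

/-! ### The twist -/

/-- Auxiliary recursion for `twist`. -/
def twistAux (b : M →ₗ[𝕂] M →ₗ[𝕂] N) :
    (a : ℕ) → Fam M N V →ₗ[𝕂] ((k : ℕ) → (Fin a → M) → (Fin k → N) → V)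
  | 0 =>
    { toFun := fun η => η 0
      map_add' := fun _ _ => rfl
      map_smul' := fun _ _ => rfl }
  | a + 1 =>
    { toFun := fun η k x α =>
        twistAux b a (ι (x 0) η + insertOne (b (x 0)) η) k (Fin.tail x) α
      map_add' := fun η θ => by
        funext k x α
        simp only [map_add, Pi.add_apply]
        abel
      map_smul' := fun c η => by
        funext k x α
        simp only [map_smul, map_add, Pi.smul_apply, Pi.add_apply, smul_add, RingHom.id_apply] }

/-- The exponential of the operator `insertTwo b`: the sum over all ways of inserting,
with signs, `b(x_i, x_j)`, for disjoint pairs `i < j`, among the `N`-arguments. It is characterised by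
`ι_x ∘ twist b = twist b ∘ (ι_x + insertOne (b x))`, and this is how it is defined here. -/
def twist (b : M →ₗ[𝕂] M →ₗ[𝕂] N) : Fam M N V →ₗ[𝕂] Fam M N V where
  toFun η := fun a => twistAux b a η
  map_add' _ _ := by funext a; exact map_add _ _ _
  map_smul' _ _ := by funext a; exact map_smul _ _ _

theorem twist_zero (b : M →ₗ[𝕂] M →ₗ[𝕂] N) (η : Fam M N V) : twist b η 0 = η 0 := rfl

theorem contract_twist (b : M →ₗ[𝕂] M →ₗ[𝕂] N) (y : M) (η : Fam M N V) :
    ι y (twist b η) = twist b (ι y η + insertOne (b y) η) := rfl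

theorem contract'_twist (hη : η ∈ weakFamilies V h) (b : M →ₗ[𝕂] M →ₗ[𝕂] N) (β : N) :
    κ β (twist b η) = twist b (κ β η) := by
  rw [← sub_eq_zero]
  refine eq_zero_of_contract (𝕂 := 𝕂) (S := (weakFamilies V h : Set (Fam M N V)))
    (X := fun η => κ β (twist b η) - twist b (κ β η))
    (fun η _ => sub_self _)
    (fun η hη y => ⟨_, add_mem (contract_mem hη y) (insertOne_mem hη (b y)), ?_⟩) η hη
  simp only [map_sub, map_add, ← contract'_contract, contract_twist, contract'_insertOne hη]

theorem insertOne_twist (hη : η ∈ weakFamilies V h) (b : M →ₗ[𝕂] M →ₗ[𝕂] N) (f : M →ₗ[𝕂] N) :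
    insertOne f (twist b η) = twist b (insertOne f η) := by
  rw [← sub_eq_zero]
  refine eq_zero_of_contract (𝕂 := 𝕂) (S := (weakFamilies V h : Set (Fam M N V)))
    (X := fun η => insertOne f (twist b η) - twist b (insertOne f η))
    (fun η _ => by rw [Pi.sub_apply, insertOne_zero_left, twist_zero, insertOne_zero_left, sub_self])
    (fun η hη y => ⟨_, neg_mem (add_mem (contract_mem hη y) (insertOne_mem hη (b y))), ?_⟩) η hη
  simp only [map_sub, map_add, map_neg, contract_twist, contract_insertOne, contract'_twist hη,
    insertOne_anticomm hη (b y) f]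
  abel

/-- The twist changes the failure of antisymmetry by the symmetrization of `b`. -/
theorem twist_mem (hη : η ∈ weakFamilies V h) (b : M →ₗ[𝕂] M →ₗ[𝕂] N) :
    twist b η ∈ weakFamilies V (h - b - b.flip) := by
  have key : IsContractible (h - b - b.flip) ((weakFamilies V h).map (twist b)) := by
    constructor
    all_goals
      rintro _ ⟨ζ, hζ, rfl⟩
    · intro x
      exact ⟨_, add_mem (contract_mem hζ x) (insertOne_mem hζ (b x)), rfl⟩
    · intro α
      exact ⟨_, contract'_mem hζ α, (contract'_twist hζ b α).symm⟩
    · intro x y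
      simp only [map_add, contract_twist, contract_add hζ, insertOne_add hζ]
      abel
    · intro c x
      simp only [contract_twist, map_smul, contract_smul hζ, insertOne_smul hζ, ← smul_add]
    · intro α β
      simp only [map_add, contract'_twist hζ, contract'_add hζ]
    · intro c α
      simp only [map_smul, contract'_twist hζ, contract'_smul hζ]
    · intro α β
      simp only [contract'_twist hζ, contract'_twist (contract'_mem hζ _), contract'_comm hζ α β]
    · intro x y
      have e₁ := contract_anticomm hζ x y
      rw [contract'_twist hζ, contract_twist, contract_twist, contract_twist, contract_twist,
        ← map_add, ← map_neg]
      congr 1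
      simp only [map_add, contract_insertOne, insertOne_anticomm hζ (b y) (b x),
        LinearMap.sub_apply, LinearMap.flip_apply, contract'_sub hζ]
      linear_combination (norm := module) e₁
  exact key.le_weakFamilies (Submodule.mem_map_of_mem hη)

/-- The twist by `-b` is inverse to the twist by `b`. -/
theorem twist_neg_twist (hη : η ∈ weakFamilies V h) (b : M →ₗ[𝕂] M →ₗ[𝕂] N) :
    twist (-b) (twist b η) = η := by
  rw [← sub_eq_zero]
  refine eq_zero_of_contract (𝕂 := 𝕂) (S := (weakFamilies V h : Set (Fam M N V)))
    (X := fun η => twist (-b) (twist b η) - η)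
    (fun η _ => sub_self _)
    (fun η hη y => ⟨_, contract_mem hη y, ?_⟩) η hη
  simp only [map_sub, map_add, contract_twist, LinearMap.neg_apply, insertOne_neg (twist_mem hη b),
    insertOne_twist hη, map_neg]
  abel

/-- The commutator of the Lie derivative along `(ρ, u, v)` with the twist by `b` inserts the
derivative `c` of `b` along `(u, v)`. -/
theorem lieDerivative_twist (hη : η ∈ weakFamilies V h) (ρ : Module.End 𝕂 V)
    (u : Module.End 𝕂 M) (v : Module.End 𝕂 N) (b c : M →ₗ[𝕂] M →ₗ[𝕂] N)
    (hc : ∀ y z, c y z = b y (u z) - v (b y z) + b (u y) z) :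
    lieDerivative ρ u v (twist b η) = twist b (lieDerivative ρ u v η + insertTwo c η) := by
  rw [← sub_eq_zero]
  refine eq_zero_of_contract (𝕂 := 𝕂) (S := (weakFamilies V h : Set (Fam M N V)))
    (X := fun η => lieDerivative ρ u v (twist b η) -
      twist b (lieDerivative ρ u v η + insertTwo c η))
    (fun η _ => ?_)
    (fun η hη y => ⟨_, add_mem (contract_mem hη y) (insertOne_mem hη (b y)), ?_⟩) η hη
  · funext k x α
    simp [lieDerivative, twist_zero, insertTwo_zero_left]
  · have hcy : c y = (b y ∘ₗ u - v ∘ₗ b y) + b (u y) := by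
      ext z
      simp [hc]
    simp only [map_sub, map_add, contract_twist, contract_lieDerivative, contract_insertTwo,
      lieDerivative_insertOne hη, insertTwo_insertOne hη, hcy, insertOne_add hη]
    abel

/-- The twist is unipotent, hence injective. -/
theorem twist_injective (b : M →ₗ[𝕂] M →ₗ[𝕂] N) :
    Function.Injective (twist b : Fam M N V →ₗ[𝕂] Fam M N V) := by
  have hP : ∀ (f : M →ₗ[𝕂] N) (a : ℕ) (η : Fam M N V), (∀ a' < a, η a' = 0) →
      ∀ a' ≤ a, insertOne f η a' = 0 := by
    intro f a η hη a' ha'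
    funext k x α
    cases a' with
    | zero => rfl
    | succ a' =>
      simp [insertOne, hη a' (by omega)]
  have key : ∀ (a : ℕ) (η : Fam M N V), (∀ a' ≤ a, twist b η a' = 0) → ∀ a' ≤ a, η a' = 0 := by
    intro a
    induction a with
    | zero =>
      intro η hη a' ha'
      obtain rfl : a' = 0 := by omega
      exact hη 0 le_rfl
    | succ a ih =>
      intro η hη a' ha'
      have hlow : ∀ a' ≤ a, η a' = 0 := ih η fun a' ha' => hη a' (by omega)
      rcases Nat.lt_or_ge a' (a + 1) with hlt | hge
      · exact hlow a' (by omega)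
      obtain rfl : a' = a + 1 := by omega
      funext k x α
      have h₁ := ih (ι (x 0) η + insertOne (b (x 0)) η) (fun a' ha' => by
        funext k z α
        have := congrFun (congrFun (congrFun (hη (a' + 1) (by omega)) k)
          (Fin.cons (x 0) z : Fin (a' + 1) → M)) α
        exact this) a le_rfl
      rw [Pi.add_apply, hP _ a η (fun a' ha' => hlow a' ha'.le) a le_rfl, add_zero] at h₁
      rw [← Fin.cons_self_tail x]
      exact congrFun (congrFun (congrFun h₁ k) (Fin.tail x)) α
  refine (injective_iff_map_eq_zero _).mpr fun η hη => ?_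
  funext a
  exact key a η (fun a' _ => congrFun hη a') a le_rfl

theorem contract_concentrated {n : ℤ} (hη : η ∈ concentrated 𝕂 M N V n) (x : M) :
    ι x η ∈ concentrated 𝕂 M N V (n - 1) := by
  intro a k hn
  funext y α
  exact congrFun (congrFun (hη (a + 1) k (by push_cast; omega)) _) _

theorem insertOne_concentrated {n : ℤ} (hη : η ∈ concentrated 𝕂 M N V n) (f : M →ₗ[𝕂] N) :
    insertOne f η ∈ concentrated 𝕂 M N V (n - 1) := by
  intro a k hn
  funext y α
  cases a with
  | zero => rfl
  | succ a => simp [insertOne, hη a (k + 1) (by push_cast at hn ⊢; omega)]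

theorem twist_concentrated {n : ℤ} (hη : η ∈ concentrated 𝕂 M N V n)
    (b : M →ₗ[𝕂] M →ₗ[𝕂] N) : twist b η ∈ concentrated 𝕂 M N V n := by
  intro a
  induction a generalizing n η with
  | zero => intro k hn; exact hη 0 k hn
  | succ a ih =>
    intro k hn
    funext x α
    exact congrFun (congrFun (ih (add_mem (contract_concentrated hη (x 0))
      (insertOne_concentrated hη (b (x 0)))) k (by push_cast at hn; omega)) _) _

end Calculus

section CartanFormulas

variable {𝕂 M N V : Type*} [Field 𝕂] [AddCommGroup M] [Module 𝕂 M] [AddCommGroup N] [Module 𝕂 N]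
  [AddCommGroup V] [Module 𝕂 V] {h : M →ₗ[𝕂] M →ₗ[𝕂] N} {η : Fam M N V}

local notation "ι" => contract 𝕂 N V
local notation "κ" => contract' 𝕂 M V

/-! ### Differentials given by Cartan formulas -/

theorem insertOne_zero (hη : η ∈ weakFamilies V h) : insertOne (0 : M →ₗ[𝕂] N) η = 0 := by
  simpa using insertOne_smul hη 0 0

theorem insertTwo_zero (hη : η ∈ weakFamilies V h) : insertTwo (0 : M →ₗ[𝕂] M →ₗ[𝕂] N) η = 0 := by
  simpa using insertTwo_add hη 0 0

/-- By symmetry, an `N`-argument may be moved to the first place. -/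
theorem apply_update_eq (hη : η ∈ weakFamilies V h) {a k : ℕ} (x : Fin a → M)
    (α : Fin (k + 1) → N) (i : Fin (k + 1)) (β : N) :
    η a (k + 1) x (Function.update α i β) =
      η a (k + 1) x (Fin.cons β (i.removeNth α) : Fin (k + 1) → N) := by
  rw [← hη.2.1 a (k + 1) x (Fin.cons β (i.removeNth α) : Fin (k + 1) → N) i.cycleRange]
  rw [Fin.cons_comp_cycleRange, Fin.insertNth_removeNth]

theorem contract_lpTerm (hη : η ∈ weakFamilies V h) (br : M →ₗ[𝕂] M →ₗ[𝕂] M)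
    (ρ : M →ₗ[𝕂] Module.End 𝕂 V) (y : M) :
    ι y (lpTerm br ρ η) = lieDerivative (ρ y) (-br y) 0 η - lpTerm br ρ (ι y η) := by
  funext a k x α
  obtain ⟨F, hF⟩ := hη.1 a k
  have hA : lieDerivative (ρ y) (-br y) 0 η a k x α =
      ρ y (η a k x α) - ∑ j : Fin a, η a k (Function.update x j (br y (x j))) α := by
    simp [lieDerivative, hF, MultilinearMap.map_update_neg, MultilinearMap.map_update_zero,
      sub_eq_add_neg]
  change ∑ i : Fin (a + 1), (-1 : 𝕂) ^ (i : ℕ) • ρ ((Fin.cons y x : Fin (a + 1) → M) i)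
        (η a k (i.removeNth (Fin.cons y x : Fin (a + 1) → M)) α) +
      ∑ i : Fin (a + 1), ∑ j ∈ Finset.Ioi i, (-1 : 𝕂) ^ ((i : ℕ) + 1) •
        η a k (i.removeNth (Function.update (Fin.cons y x : Fin (a + 1) → M) j
          (br ((Fin.cons y x : Fin (a + 1) → M) i) ((Fin.cons y x : Fin (a + 1) → M) j)))) α =
    lieDerivative (ρ y) (-br y) 0 η a k x α - lpTerm br ρ (ι y η) a k x α
  rw [hA, Fin.sum_univ_succ, Fin.sum_univ_succ (f := fun i => ∑ j ∈ Finset.Ioi i, _),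
    Fin.sum_Ioi_zero]
  simp only [Fin.sum_Ioi_succ, update_succ_cons, removeNth_zero_cons, Fin.cons_zero, Fin.cons_succ,
    Fin.val_zero, pow_zero, one_smul, zero_add, pow_one, neg_smul, Finset.sum_neg_distrib]
  cases a with
  | zero => simp [lpTerm, lpDifferential]
  | succ a =>
    simp only [removeNth_succ_cons, Fin.val_succ, pow_succ, mul_neg, mul_one, neg_smul,
      Finset.sum_neg_distrib, neg_neg]
    change _ = _ - (∑ i : Fin (a + 1), (-1 : 𝕂) ^ (i : ℕ) • ρ (x i)
        (η (a + 1) k (Fin.cons y (i.removeNth x) : Fin (a + 1) → M) α) +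
      ∑ i : Fin (a + 1), ∑ j ∈ Finset.Ioi i, (-1 : 𝕂) ^ ((i : ℕ) + 1) •
        η (a + 1) k (Fin.cons y (i.removeNth (Function.update x j (br (x i) (x j)))) :
          Fin (a + 1) → M) α)
    simp only [pow_succ, mul_neg, mul_one, neg_smul, Finset.sum_neg_distrib]
    abel

theorem contract_mixedTerm (hη : η ∈ weakFamilies V h) (m : N →ₗ[𝕂] M →ₗ[𝕂] N) (y : M) :
    ι y (mixedTerm m η) = lieDerivative 0 0 (m.flip y) η - mixedTerm m (ι y η) := by
  funext a k x α
  obtain ⟨F, hF⟩ := hη.1 a k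
  have hA : lieDerivative 0 0 (m.flip y) η a k x α =
      ∑ j : Fin k, η a k x (Function.update α j (m (α j) y)) := by
    simp [lieDerivative, hF, MultilinearMap.map_update_zero]
  change ∑ i : Fin (a + 1), ∑ j : Fin k, (-1 : 𝕂) ^ (i : ℕ) •
        η a k (i.removeNth (Fin.cons y x : Fin (a + 1) → M))
          (Function.update α j (m (α j) ((Fin.cons y x : Fin (a + 1) → M) i))) =
    lieDerivative 0 0 (m.flip y) η a k x α - mixedTerm m (ι y η) a k x α
  rw [hA, Fin.sum_univ_succ, sub_eq_add_neg]
  congr 1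
  · simp
  · cases a with
    | zero => simp [mixedTerm]
    | succ a =>
      simp only [removeNth_succ_cons, Fin.cons_succ, Fin.val_succ, pow_succ, mul_neg, mul_one,
        neg_smul, Finset.sum_neg_distrib]
      rfl

theorem contract'_mixedTerm (m : N →ₗ[𝕂] M →ₗ[𝕂] N) (β : N) :
    κ β (mixedTerm m η) = mixedTerm m (κ β η) + insertOne (m β) η := by
  funext a k x α
  cases a with
  | zero => simp [mixedTerm, contract', insertOne]
  | succ a =>
    change ∑ i : Fin (a + 1), ∑ j : Fin (k + 1), (-1 : 𝕂) ^ (i : ℕ) • η a (k + 1) (i.removeNth x)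
      (Function.update (Fin.cons β α : Fin (k + 1) → N) j
        (m ((Fin.cons β α : Fin (k + 1) → N) j) (x i))) = _
    simp only [Fin.sum_univ_succ (n := k), update_zero_cons, update_succ_cons, Fin.cons_zero,
      Fin.cons_succ, Finset.sum_add_distrib]
    rw [add_comm]
    rfl

theorem contract'_lpTerm (br : M →ₗ[𝕂] M →ₗ[𝕂] M) (ρ : M →ₗ[𝕂] Module.End 𝕂 V) (β : N) :
    κ β (lpTerm br ρ η) = lpTerm br ρ (κ β η) := rfl

theorem contract'_ternaryTerm (hη : η ∈ weakFamilies V h) (t : M →ₗ[𝕂] M →ₗ[𝕂] M →ₗ[𝕂] N)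
    (β : N) : κ β (ternaryTerm t η) = ternaryTerm t (κ β η) := by
  rw [← sub_eq_zero]
  refine eq_zero_of_contract (𝕂 := 𝕂) (S := (weakFamilies V h : Set (Fam M N V)))
    (X := fun η => κ β (ternaryTerm t η) - ternaryTerm t (κ β η))
    (fun η _ => sub_self _)
    (fun η hη y => ⟨_, neg_mem (contract_mem hη y), ?_⟩) η hη
  simp only [map_sub, map_neg, ← contract'_contract, contract_ternaryTerm,
    contract'_insertTwo hη]
  abel

/-- The operators `D` which satisfy the Cartan formulas of the differential associated with
`d : N → M`, an action `ρ`, a bracket `br`, an action `w` of `M` on `N`, a ternary bracket `t`, and a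
correction `q` to the contraction with elements of `N`. -/
structure IsCartan (h : M →ₗ[𝕂] M →ₗ[𝕂] N) (d : N →ₗ[𝕂] M) (ρ : M →ₗ[𝕂] Module.End 𝕂 V)
    (br : M →ₗ[𝕂] M →ₗ[𝕂] M) (w : M →ₗ[𝕂] Module.End 𝕂 N) (t : M →ₗ[𝕂] M →ₗ[𝕂] M →ₗ[𝕂] N)
    (q : N →ₗ[𝕂] M →ₗ[𝕂] N) (D : Fam M N V →ₗ[𝕂] Fam M N V) : Prop where
  apply_zero : ∀ η, D η 0 = insertTerm d η 0
  contract : ∀ η ∈ weakFamilies V h, ∀ x,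
    ι x (D η) = lieDerivative (ρ x) (-br x) (-w x) η + insertTwo (t x) η - D (ι x η)
  contract' : ∀ η ∈ weakFamilies V h, ∀ α,
    κ α (D η) = D (κ α η) + ι (d α) η + insertOne (q α) η

section

variable {d : N →ₗ[𝕂] M} {ρ : M →ₗ[𝕂] Module.End 𝕂 V} {br : M →ₗ[𝕂] M →ₗ[𝕂] M}
  {w : M →ₗ[𝕂] Module.End 𝕂 N} {t : M →ₗ[𝕂] M →ₗ[𝕂] M →ₗ[𝕂] N} {q : N →ₗ[𝕂] M →ₗ[𝕂] N}
  {D D' : Fam M N V →ₗ[𝕂] Fam M N V}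

/-- The anticommutator of `insertOne f` with a differential. -/
theorem IsCartan.insertOne_anticomm (hD : IsCartan h d ρ br w t q D) (f : M →ₗ[𝕂] N)
    (g : M →ₗ[𝕂] M →ₗ[𝕂] N) (hg : ∀ y z, g y z = q (f y) z + w y (f z) - f (br y z))
    (hη : η ∈ weakFamilies V h) :
    insertOne f (D η) + D (insertOne f η) =
      lieDerivative 0 (d ∘ₗ f) (f ∘ₗ d) η + insertTwo g η := by
  rw [← sub_eq_zero]
  refine eq_zero_of_contract (𝕂 := 𝕂) (S := (weakFamilies V h : Set (Fam M N V)))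
    (X := fun η => insertOne f (D η) + D (insertOne f η) -
      (lieDerivative 0 (d ∘ₗ f) (f ∘ₗ d) η + insertTwo g η))
    (fun η hη => ?_)
    (fun η hη y => ⟨_, contract_mem hη y, ?_⟩) η hη
  · funext k x α
    simp only [Pi.sub_apply, Pi.add_apply, insertOne_zero_left, insertTwo_zero_left,
      hD.apply_zero, Pi.zero_apply, zero_add, add_zero]
    rw [sub_eq_zero]
    cases k with
    | zero => simp [insertTerm, lieDerivative]
    | succ k =>
      simp [insertTerm, lieDerivative, insertOne, apply_update_eq hη]
  · have hgy : g y = q (f y) + (f ∘ₗ (-br y) - (-w y) ∘ₗ f) := by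
      ext z
      simp [hg]
      abel
    simp only [map_sub, map_add, contract_insertOne, contract_insertTwo, contract_lieDerivative,
      hD.contract _ hη, hD.contract _ (insertOne_mem hη f), hD.contract' _ hη, hgy,
      insertOne_add hη, lieDerivative_insertOne hη, insertTwo_insertOne hη, LinearMap.comp_apply]
    abel

/-- The twist by `b` with `w = b ∘ d` removes the action on `N` and the ternary bracket, and
replaces the bracket `br` by `br - d ∘ b`. -/
theorem IsCartan.twist_comm (hD : IsCartan h d ρ br w t q D) (b : M →ₗ[𝕂] M →ₗ[𝕂] N)
    (br' : M →ₗ[𝕂] M →ₗ[𝕂] M) (hD' : IsCartan (h - b - b.flip) d ρ br' 0 0 0 D')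
    (hbr : ∀ x y, br' x y = br x y - d (b x y)) (hw : ∀ x α, w x α = b x (d α))
    (ht : ∀ x y z, t x y z + (q (b x y) z + w y (b x z) - b x (br y z)) =
      -b y (br' x z) - b (br' x y) z) (hη : η ∈ weakFamilies V h) :
    twist b (D η) = D' (twist b η) := by
  rw [← sub_eq_zero]
  refine eq_zero_of_contract (𝕂 := 𝕂) (S := (weakFamilies V h : Set (Fam M N V)))
    (X := fun η => twist b (D η) - D' (twist b η))
    (fun η hη => ?_)
    (fun η hη y => ⟨_, neg_mem (add_mem (contract_mem hη y) (insertOne_mem hη (b y))), ?_⟩) η hη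
  · funext k x α
    simp only [Pi.sub_apply, twist_zero, hD.apply_zero, hD'.apply_zero, Pi.zero_apply]
    rw [sub_eq_zero]
    cases k with
    | zero => rfl
    | succ k =>
      change ∑ i : Fin (k + 1), η 1 k (Fin.cons (d (α i)) x : Fin 1 → M) (i.removeNth α) =
        ∑ i : Fin (k + 1), twist b η 1 k (Fin.cons (d (α i)) x : Fin 1 → M) (i.removeNth α)
      refine Finset.sum_congr rfl fun i _ => ?_
      refine Eq.trans ?_ (congrFun (congrFun (congrFun (congrFun
        (contract_twist b (d (α i)) η).symm 0) k) x) _)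
      rw [twist_zero, Pi.add_apply, insertOne_zero_left, add_zero]
      rfl
  · let g : M →ₗ[𝕂] M →ₗ[𝕂] N := q ∘ₗ b y + w.compl₂ (b y) - br.compr₂ (b y)
    have hg : ∀ x z, g x z = q (b y x) z + w x (b y z) - b y (br x z) := fun x z => rfl
    have e := hD.insertOne_anticomm (b y) g hg hη
    have hA : lieDerivative (ρ y) (-br' y) 0 η =
        lieDerivative (ρ y) (-br y) (-w y) η + lieDerivative 0 (d ∘ₗ b y) (b y ∘ₗ d) η := by
      rw [← lieDerivative_add hη, add_zero,
        show -w y + b y ∘ₗ d = 0 by ext α; simp [hw],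
        show -br y + d ∘ₗ b y = -br' y by ext z; simp [hbr]; abel]
    have hR := lieDerivative_twist hη (ρ y) (-br' y) 0 b (t y + g) (fun x z => by
      rw [LinearMap.add_apply, LinearMap.add_apply, hg, ht]
      simp [sub_eq_add_neg])
    rw [map_sub, hD'.contract _ (twist_mem hη b)]
    simp only [LinearMap.zero_apply, neg_zero, insertTwo_zero (twist_mem hη b), add_zero,
      contract_twist, hR, hD.contract _ hη, hA, insertTwo_add hη, eq_sub_of_add_eq e]
    simp only [map_add, map_sub, map_neg]
    abel

end

end CartanFormulas

section Homotopy

variable {𝕂 M N V W : Type*} [Field 𝕂] [AddCommGroup M] [Module 𝕂 M] [AddCommGroup N] [Module 𝕂 N]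
  [AddCommGroup V] [Module 𝕂 V] [AddCommGroup W] [Module 𝕂 W] {η : Fam M N V}

local notation "ι" => contract 𝕂 N V
local notation "κ" => contract' 𝕂 M V

/-! ### Inverting the number operator -/

variable (V) in
/-- Auxiliary recursion for `weightInv`. -/
def weightInvAux (d : N →ₗ[𝕂] M) (p : M →ₗ[𝕂] N) :
    (a : ℕ) → ℕ → Fam M N V →ₗ[𝕂] ((k : ℕ) → (Fin a → M) → (Fin k → N) → V)
  | 0, c =>
    { toFun := fun η k x α => ((k + c : ℕ) : 𝕂)⁻¹ • η 0 k x α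
      map_add' := fun η θ => by
        funext k x α
        simp
      map_smul' := fun r η => by
        funext k x α
        simp [smul_comm r] }
  | a + 1, c =>
    { toFun := fun η k x α => weightInvAux d p a c (ι (x 0 - d (p (x 0))) η) k (Fin.tail x) α +
        weightInvAux d p a (c + 1) (ι (d (p (x 0))) η) k (Fin.tail x) α
      map_add' := fun η θ => by
        funext k x α
        simp only [map_add, Pi.add_apply]
        abel
      map_smul' := fun r η => by
        funext k x α
        simp only [map_smul, Pi.smul_apply, smul_add, RingHom.id_apply] }

/-- Let `p` be a retraction of `d : N → M`, so that `M = ker p ⊕ d N`. If the weight of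
`η(x₁, …, x_a ∣ α₁, …, α_k)` is `k` plus the number of the `x_i` in `d N`, all the others being in
`ker p`, then `weightInv d p c` divides the part of weight `w` by `w + c`. The part of weight
`w = 0` is mapped to `0` for `c = 0`. -/
def weightInv (d : N →ₗ[𝕂] M) (p : M →ₗ[𝕂] N) (c : ℕ) : Fam M N V →ₗ[𝕂] Fam M N V where
  toFun η := fun a => weightInvAux V d p a c η
  map_add' _ _ := by funext a; exact map_add _ _ _
  map_smul' _ _ := by funext a; exact map_smul _ _ _

/-- The part of weight `0`: the `M`-arguments are projected to `ker p`, and the components with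
`N`-arguments are omitted. -/
def weightZero (d : N →ₗ[𝕂] M) (p : M →ₗ[𝕂] N) (η : Fam M N V) : Fam M N V :=
  fun a k => match k with
    | 0 => fun x α => η a 0 (fun i => x i - d (p (x i))) α
    | _ + 1 => fun _ _ => 0

variable {d : N →ₗ[𝕂] M} {p : M →ₗ[𝕂] N}

theorem weightInv_zero (d : N →ₗ[𝕂] M) (p : M →ₗ[𝕂] N) (c : ℕ) (η : Fam M N V) (k : ℕ)
    (x : Fin 0 → M) (α : Fin k → N) :
    weightInv d p c η 0 k x α = ((k + c : ℕ) : 𝕂)⁻¹ • η 0 k x α := rfl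

theorem contract_weightInv (c : ℕ) (y : M) (η : Fam M N V) :
    ι y (weightInv d p c η) =
      weightInv d p c (ι (y - d (p y)) η) + weightInv d p (c + 1) (ι (d (p y)) η) := rfl

theorem contract'_weightInv (c : ℕ) (β : N) (η : Fam M N V) :
    κ β (weightInv d p c η) = weightInv d p (c + 1) (κ β η) := by
  rw [← sub_eq_zero]
  refine eq_zero_of_contract_nat (𝕂 := 𝕂) (S := Set.univ)
    (X := fun c η => κ β (weightInv d p c η) - weightInv d p (c + 1) (κ β η))
    (fun c η _ => ?_)
    (fun c η _ y => ⟨ι (y - d (p y)) η, trivial, ι (d (p y)) η, trivial, ?_⟩) c η trivial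
  · funext k x α
    change ((k + 1 + c : ℕ) : 𝕂)⁻¹ • η 0 (k + 1) x _ - ((k + (c + 1) : ℕ) : 𝕂)⁻¹ • η 0 (k + 1) x _ = 0
    rw [show k + 1 + c = k + (c + 1) by ring, sub_self]
  · simp only [map_sub, map_add, ← contract'_contract, contract_weightInv (M := M)]
    abel

theorem contract_weightZero (y : M) (η : Fam M N V) :
    ι y (weightZero d p η) = weightZero d p (ι (y - d (p y)) η) := by
  funext a k x α
  cases k with
  | zero =>
    change η (a + 1) 0 _ α = η (a + 1) 0 _ α
    congr 1
    funext i
    cases i using Fin.cases <;> simp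
  | succ k => rfl

/-- The recursion `contract_weightInv` raises `c`, so that only the images of the weakly symmetric
families under all the `weightInv d p c` together span a contractible submodule. -/
theorem weightInv_mem (hη : η ∈ weakFamilies V (0 : M →ₗ[𝕂] M →ₗ[𝕂] N)) (c : ℕ) :
    weightInv d p c η ∈ weakFamilies V (0 : M →ₗ[𝕂] M →ₗ[𝕂] N) := by
  set T : Submodule 𝕂 (Fam M N V) :=
    ⨆ c, (weakFamilies V (0 : M →ₗ[𝕂] M →ₗ[𝕂] N)).map (weightInv d p c) with hT
  have hmem : ∀ c, ∀ ζ ∈ weakFamilies V (0 : M →ₗ[𝕂] M →ₗ[𝕂] N), weightInv d p c ζ ∈ T :=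
    fun c ζ hζ => Submodule.mem_iSup_of_mem c (Submodule.mem_map_of_mem hζ)
  have hstable : ∀ A : Fam M N V →ₗ[𝕂] Fam M N V,
      (∀ c, ∀ ζ ∈ weakFamilies V (0 : M →ₗ[𝕂] M →ₗ[𝕂] N), A (weightInv d p c ζ) ∈ T) →
      ∀ θ ∈ T, A θ ∈ T := by
    intro A hA
    change T ≤ T.comap A
    refine iSup_le fun c => ?_
    rintro _ ⟨ζ, hζ, rfl⟩
    exact hA c ζ hζ
  have hext : ∀ A B : Fam M N V →ₗ[𝕂] Fam M N V,
      (∀ c, ∀ ζ ∈ weakFamilies V (0 : M →ₗ[𝕂] M →ₗ[𝕂] N),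
        A (weightInv d p c ζ) = B (weightInv d p c ζ)) → ∀ θ ∈ T, A θ = B θ := by
    intro A B hA
    change T ≤ LinearMap.eqLocus A B
    refine iSup_le fun c => ?_
    rintro _ ⟨ζ, hζ, rfl⟩
    exact hA c ζ hζ
  have key : IsContractible (0 : M →ₗ[𝕂] M →ₗ[𝕂] N) T := by
    refine ⟨fun θ hθ x => hstable (ι x) (fun c ζ hζ => ?_) θ hθ,
      fun θ hθ β => hstable (κ β) (fun c ζ hζ => ?_) θ hθ,
      fun θ hθ x y => hext (ι (x + y)) (ι x + ι y) (fun c ζ hζ => ?_) θ hθ,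
      fun θ hθ r x => hext (ι (r • x)) (r • ι x) (fun c ζ hζ => ?_) θ hθ,
      fun θ hθ β γ => hext (κ (β + γ)) (κ β + κ γ) (fun c ζ hζ => ?_) θ hθ,
      fun θ hθ r β => hext (κ (r • β)) (r • κ β) (fun c ζ hζ => ?_) θ hθ,
      fun θ hθ β γ => hext (κ β ∘ₗ κ γ) (κ γ ∘ₗ κ β) (fun c ζ hζ => ?_) θ hθ,
      fun θ hθ x y => hext (ι x ∘ₗ ι y + ι y ∘ₗ ι x) (-κ 0) (fun c ζ hζ => ?_) θ hθ⟩
    · rw [contract_weightInv]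
      exact add_mem (hmem _ _ (contract_mem hζ _)) (hmem _ _ (contract_mem hζ _))
    · rw [contract'_weightInv]
      exact hmem _ _ (contract'_mem hζ _)
    · have e : x + y - (d (p x) + d (p y)) = (x - d (p x)) + (y - d (p y)) := by abel
      simp only [LinearMap.add_apply, contract_weightInv, map_add, e, contract_add hζ]
      abel
    · simp only [LinearMap.smul_apply, contract_weightInv, map_smul, ← smul_sub, contract_smul hζ,
        smul_add]
    · simp only [LinearMap.add_apply, contract'_weightInv, contract'_add hζ, map_add]
    · simp only [LinearMap.smul_apply, contract'_weightInv, contract'_smul hζ, map_smul]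
    · simp only [LinearMap.comp_apply, contract'_weightInv, contract'_comm hζ β γ]
    · have e : ∀ u v, ι u (ι v ζ) = -ι v (ι u ζ) := fun u v => by
        rw [← add_eq_zero_iff_eq_neg, contract_anticomm hζ]
        simp [contract'_zero hζ]
      simp only [LinearMap.add_apply, LinearMap.comp_apply, LinearMap.neg_apply,
        contract_weightInv, contract'_weightInv, contract'_zero hζ, map_add, map_zero, neg_zero]
      rw [e (x - d (p x)) (y - d (p y)), e (d (p x)) (y - d (p y)), e (x - d (p x)) (d (p y)),
        e (d (p x)) (d (p y))]
      simp only [map_neg]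
      abel
  exact key.le_weakFamilies (hmem c η hη)

theorem weightInv_concentrated {n : ℤ} (hη : η ∈ concentrated 𝕂 M N V n) (c : ℕ) :
    weightInv d p c η ∈ concentrated 𝕂 M N V n := by
  intro a
  induction a generalizing n η c with
  | zero =>
    intro k hn
    funext x α
    rw [weightInv_zero, hη 0 k hn]
    simp
  | succ a ih =>
    intro k hn
    funext x α
    have h₁ := fun y c => ih (contract_concentrated hη y) c k (by push_cast at hn; omega)
    have e := congrFun (congrFun (congrFun (congrFun
      (contract_weightInv (d := d) (p := p) c (x 0) η) a) k) (Fin.tail x)) α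
    rw [Pi.add_apply, Pi.add_apply, h₁, h₁, add_zero] at e
    rw [← Fin.cons_self_tail x]
    exact e

theorem lieDerivative_zero {h : M →ₗ[𝕂] M →ₗ[𝕂] N} (hη : η ∈ weakFamilies V h) :
    lieDerivative (0 : Module.End 𝕂 V) 0 0 η = 0 := by
  simpa using lieDerivative_add hη (0 : Module.End 𝕂 V) 0 0 0 0 0

theorem lieDerivative_weightInv {h : M →ₗ[𝕂] M →ₗ[𝕂] N} (hη : η ∈ weakFamilies V h)
    (ρ : Module.End 𝕂 V) (u : Module.End 𝕂 M) (hpu : ∀ x, p (u x) = 0) (hud : ∀ α, u (d α) = 0)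
    (c : ℕ) :
    lieDerivative ρ u 0 (weightInv d p c η) = weightInv d p c (lieDerivative ρ u 0 η) := by
  rw [← sub_eq_zero]
  refine eq_zero_of_contract_nat (𝕂 := 𝕂) (S := (weakFamilies V h : Set (Fam M N V)))
    (X := fun c η => lieDerivative ρ u 0 (weightInv d p c η) -
      weightInv d p c (lieDerivative ρ u 0 η))
    (fun c η _ => ?_)
    (fun c η hη y => ⟨_, contract_mem hη (y - d (p y)), _, contract_mem hη (d (p y)), ?_⟩) c η hη
  · funext k x α
    simp [weightInv_zero, lieDerivative, Finset.smul_sum]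
  · simp only [map_sub, map_add, contract_weightInv, contract_lieDerivative, hpu, hud, map_zero,
      sub_zero, contract_zero hη, add_zero]
    abel

/-- `weightInv` inverts the sum of the number operator and `c`, up to the part of weight `0`. -/
theorem number_weightInv [CharZero 𝕂] {h : M →ₗ[𝕂] M →ₗ[𝕂] N} (hη : η ∈ weakFamilies V h)
    (hp : ∀ α, p (d α) = α) (c : ℕ) :
    lieDerivative 0 (d ∘ₗ p) LinearMap.id (weightInv d p c η) + (c : 𝕂) • weightInv d p c η =
      η - if c = 0 then weightZero d p η else 0 := by
  rw [← sub_eq_zero]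
  refine eq_zero_of_contract_nat (𝕂 := 𝕂) (S := (weakFamilies V h : Set (Fam M N V)))
    (X := fun c η => lieDerivative 0 (d ∘ₗ p) LinearMap.id (weightInv d p c η) +
      (c : 𝕂) • weightInv d p c η - (η - if c = 0 then weightZero d p η else 0))
    (fun c η _ => ?_)
    (fun c η hη y => ⟨_, contract_mem hη (y - d (p y)), _, contract_mem hη (d (p y)), ?_⟩) c η hη
  · funext k x α
    have hk : (lieDerivative 0 (d ∘ₗ p) LinearMap.id (weightInv d p c η) +
        (c : 𝕂) • weightInv d p c η) 0 k x α =
        (((k + c : ℕ) : 𝕂) * ((k + c : ℕ) : 𝕂)⁻¹) • η 0 k x α := by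
      simp [lieDerivative, weightInv_zero, smul_smul, ← add_smul, add_mul, ← Nat.cast_smul_eq_nsmul 𝕂]
    rw [Pi.sub_apply, Pi.sub_apply, Pi.sub_apply, Pi.sub_apply, hk]
    rcases Nat.eq_zero_or_pos (k + c) with h0 | hpos
    · obtain ⟨rfl, rfl⟩ : k = 0 ∧ c = 0 := by omega
      simp [weightZero, Subsingleton.elim (fun i => x i - d (p (x i))) x]
    · rw [mul_inv_cancel₀ (Nat.cast_ne_zero.mpr hpos.ne'), one_smul]
      split_ifs with hc
      · obtain ⟨k, rfl⟩ : ∃ k', k = k' + 1 := ⟨k - 1, by omega⟩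
        simp [weightZero]
      · simp
  · have hy : ι y η = ι (y - d (p y)) η + ι (d (p y)) η := by
      rw [← contract_add hη, sub_add_cancel]
    have hQ : ι y (if c = 0 then weightZero d p η else 0) =
        if c = 0 then weightZero d p (ι (y - d (p y)) η) else 0 := by
      split_ifs
      · exact contract_weightZero y η
      · exact map_zero _
    simp only [map_sub, map_add, map_smul, contract_lieDerivative, LinearMap.comp_apply,
      contract_weightInv, hp, sub_self, contract_zero hη, map_zero, zero_add, hQ]
    rw [hy]
    simp only [Nat.succ_ne_zero, if_false, sub_zero]
    push_cast
    module

variable {ρ : M →ₗ[𝕂] Module.End 𝕂 V} {br : M →ₗ[𝕂] M →ₗ[𝕂] M} {D : Fam M N V →ₗ[𝕂] Fam M N V}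

/-- The differential preserves the weight: `d` turns an `N`-argument into an argument in `d N`, and
the bracket and the action ignore arguments in `d N`. -/
theorem IsCartan.weightInv_comm
    (hD : IsCartan (0 : M →ₗ[𝕂] M →ₗ[𝕂] N) d ρ br 0 0 0 D)
    (hp : ∀ α, p (d α) = α) (hpbr : ∀ x y, p (br x y) = 0) (hbr₁ : ∀ α, br (d α) = 0)
    (hbr₂ : ∀ x α, br x (d α) = 0) (hρ : ∀ α, ρ (d α) = 0)
    (hη : η ∈ weakFamilies V (0 : M →ₗ[𝕂] M →ₗ[𝕂] N)) (c : ℕ) :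
    D (weightInv d p c η) = weightInv d p c (D η) := by
  rw [← sub_eq_zero]
  refine eq_zero_of_contract_nat (𝕂 := 𝕂)
    (S := (weakFamilies V (0 : M →ₗ[𝕂] M →ₗ[𝕂] N) : Set (Fam M N V)))
    (X := fun c η => D (weightInv d p c η) - weightInv d p c (D η))
    (fun c η hη => ?_)
    (fun c η hη y => ⟨_, neg_mem (contract_mem hη (y - d (p y))), _,
      neg_mem (contract_mem hη (d (p y))), ?_⟩) c η hη
  · funext k x α
    rw [Pi.sub_apply, Pi.sub_apply, Pi.sub_apply, Pi.sub_apply, weightInv_zero, hD.apply_zero,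
      hD.apply_zero]
    cases k with
    | zero => simp [insertTerm]
    | succ k =>
      change ∑ i : Fin (k + 1),
          weightInv d p c η 1 k (Fin.cons (d (α i)) x : Fin 1 → M) (i.removeNth α) -
        ((k + 1 + c : ℕ) : 𝕂)⁻¹ • ∑ i : Fin (k + 1),
          η 1 k (Fin.cons (d (α i)) x : Fin 1 → M) (i.removeNth α) = 0
      rw [Finset.smul_sum, sub_eq_zero]
      refine Finset.sum_congr rfl fun i _ => ?_
      refine (congrFun (congrFun (congrFun (congrFun
        (contract_weightInv (d := d) (p := p) c (d (α i)) η) 0) k) x) _).trans ?_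
      rw [hp, sub_self, contract_zero hη, map_zero, zero_add, weightInv_zero,
        show k + (c + 1) = k + 1 + c by ring]
      rfl
  · have hA := lieDerivative_weightInv hη (d := d) (p := p) (ρ y) (-br y)
      (fun x => by simp [hpbr]) (fun α => by simp [hbr₂]) c
    simp only [map_sub, map_neg, map_add, contract_weightInv, hD.contract _ (weightInv_mem hη c),
      hD.contract _ hη, hρ, hbr₁, LinearMap.zero_apply, neg_zero, insertTwo_zero hη,
      insertTwo_zero (weightInv_mem hη c), add_zero, sub_zero, hA, lieDerivative_zero hη, zero_sub]
    abel

/-- A family annihilated by the differential is cohomologous to its part of weight `0`; the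
statement for arbitrary families is a homotopy between the identity and `weightZero`. -/
theorem IsCartan.sub_weightZero [CharZero 𝕂]
    (hD : IsCartan (0 : M →ₗ[𝕂] M →ₗ[𝕂] N) d ρ br 0 0 0 D)
    (hp : ∀ α, p (d α) = α) (hpbr : ∀ x y, p (br x y) = 0) (hbr₁ : ∀ α, br (d α) = 0)
    (hbr₂ : ∀ x α, br x (d α) = 0) (hρ : ∀ α, ρ (d α) = 0)
    (hη : η ∈ weakFamilies V (0 : M →ₗ[𝕂] M →ₗ[𝕂] N)) :
    η - weightZero d p η =
      D (insertOne p (weightInv d p 0 η)) + insertOne p (weightInv d p 0 (D η)) := by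
  have h₁ := number_weightInv hη hp 0
  have h₂ := hD.insertOne_anticomm p 0 (fun y z => by simp [hpbr]) (weightInv_mem hη (d := d) (p := p) 0)
  rw [show p ∘ₗ d = LinearMap.id from LinearMap.ext hp, insertTwo_zero (weightInv_mem hη 0),
    add_zero, hD.weightInv_comm hp hpbr hbr₁ hbr₂ hρ hη] at h₂
  simp only [Nat.cast_zero, zero_smul, add_zero, if_true] at h₁
  rw [← h₁, ← h₂, add_comm]

/-! ### Compatibility with the differential of the coefficients -/

theorem contract_coeffTerm (f : V →ₗ[𝕂] W) (y : M) (η : Fam M N V) :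
    contract 𝕂 N W y (coeffTerm f η) = -coeffTerm f (ι y η) := by
  funext a k x α
  simp [contract, coeffTerm, pow_succ]

theorem insertOne_coeffTerm (f : V →ₗ[𝕂] W) (g : M →ₗ[𝕂] N) (η : Fam M N V) :
    insertOne g (coeffTerm f η) = -coeffTerm f (insertOne g η) := by
  funext a k x α
  cases a with
  | zero => simp [insertOne, coeffTerm]
  | succ a =>
    simp [insertOne, coeffTerm, pow_succ, Finset.smul_sum, smul_smul, mul_comm]

theorem twist_coeffTerm (f : V →ₗ[𝕂] W) (b : M →ₗ[𝕂] M →ₗ[𝕂] N) (η : Fam M N V) :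
    twist b (coeffTerm f η) = coeffTerm f (twist b η) := by
  rw [← sub_eq_zero]
  refine eq_zero_of_contract (𝕂 := 𝕂) (S := Set.univ)
    (X := fun η => twist b (coeffTerm f η) - coeffTerm f (twist b η))
    (fun η _ => sub_self _)
    (fun η _ y => ⟨-(ι y η + insertOne (b y) η), trivial, ?_⟩) η trivial
  simp only [map_sub, map_add, map_neg, contract_twist, contract_coeffTerm, insertOne_coeffTerm]
  abel

theorem weightInv_coeffTerm (f : V →ₗ[𝕂] W) (c : ℕ) (η : Fam M N V) :
    weightInv d p c (coeffTerm f η) = coeffTerm f (weightInv d p c η) := by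
  rw [← sub_eq_zero]
  refine eq_zero_of_contract_nat (𝕂 := 𝕂) (S := Set.univ)
    (X := fun c η => weightInv d p c (coeffTerm f η) - coeffTerm f (weightInv d p c η))
    (fun c η _ => ?_)
    (fun c η _ y => ⟨-ι (y - d (p y)) η, trivial, -ι (d (p y)) η, trivial, ?_⟩) c η trivial
  · funext k x α
    simp [weightInv_zero, coeffTerm]
  · simp only [map_sub, map_add, map_neg, contract_weightInv, contract_coeffTerm]
    abel

end Homotopy

/-! ### Comparison of cohomologies -/

/-- A map of complexes, given on graded subspaces, which is bijective on cohomology classes. -/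
theorem nonempty_cohomology_equiv {𝕂 E E' : Type*} [Field 𝕂] [AddCommGroup E] [Module 𝕂 E]
    [AddCommGroup E'] [Module 𝕂 E'] {C : ℤ → Submodule 𝕂 E} {D : E →ₗ[𝕂] E}
    {C' : ℤ → Submodule 𝕂 E'} {D' : E' →ₗ[𝕂] E'} (f : E →ₗ[𝕂] E')
    (hC : ∀ m, ∀ ω ∈ C m, f ω ∈ C' m) (hD : ∀ m, ∀ ω ∈ C m, f (D ω) = D' (f ω)) (n : ℤ)
    (hsurj : ∀ ω' ∈ C' n, D' ω' = 0 →
      ∃ ω ∈ C n, D ω = 0 ∧ ∃ θ ∈ C' (n - 1), ω' - f ω = D' θ)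
    (hinj : ∀ ω ∈ C n, D ω = 0 → (∃ θ ∈ C' (n - 1), f ω = D' θ) → ∃ θ ∈ C (n - 1), ω = D θ) :
    Nonempty (Cohomology C D n ≃ₗ[𝕂] Cohomology C' D' n) := by
  have hf : ∀ ω ∈ C n ⊓ LinearMap.ker D, f ω ∈ C' n ⊓ LinearMap.ker D' := by
    rintro ω ⟨h₁, h₂⟩
    exact ⟨hC n ω h₁, (hD n ω h₁).symm.trans ((congrArg f h₂).trans (map_zero f))⟩
  let g := f.restrict hf
  have hg : ((C (n - 1)).map D).submoduleOf (C n ⊓ LinearMap.ker D) ≤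
      (((C' (n - 1)).map D').submoduleOf (C' n ⊓ LinearMap.ker D')).comap g := by
    rintro ⟨ω, hω⟩ ⟨θ, hθ, e⟩
    exact ⟨f θ, hC _ θ hθ, (hD _ θ hθ).symm.trans (congrArg f e)⟩
  refine ⟨LinearEquiv.ofBijective (Submodule.mapQ _ _ g hg) ⟨?_, ?_⟩⟩
  · rw [injective_iff_map_eq_zero]
    intro x
    induction x using Submodule.Quotient.induction_on with | _ ω =>
    intro h
    obtain ⟨ω, hω⟩ := ω
    rw [Submodule.mapQ_apply, Submodule.Quotient.mk_eq_zero] at h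
    obtain ⟨θ, hθ, e⟩ := h
    obtain ⟨ξ, hξ, e'⟩ := hinj ω hω.1 hω.2 ⟨θ, hθ, e.symm⟩
    rw [Submodule.Quotient.mk_eq_zero]
    exact ⟨ξ, hξ, e'.symm⟩
  · intro x
    induction x using Submodule.Quotient.induction_on with | _ ω' =>
    obtain ⟨ω', hω'⟩ := ω'
    obtain ⟨ω, hω, hω0, θ, hθ, e⟩ := hsurj ω' hω'.1 hω'.2
    refine ⟨Submodule.Quotient.mk ⟨ω, hω, hω0⟩, ?_⟩
    rw [Submodule.mapQ_apply, eq_comm, Submodule.Quotient.eq]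
    exact ⟨θ, hθ, e.symm⟩

section Comparison

variable {𝕂 M N V V₁ V₀ : Type*} [Field 𝕂] [AddCommGroup M] [Module 𝕂 M] [AddCommGroup N]
  [Module 𝕂 N] [AddCommGroup V] [Module 𝕂 V] [AddCommGroup V₁] [Module 𝕂 V₁] [AddCommGroup V₀]
  [Module 𝕂 V₀]

local notation "ι" => contract 𝕂 N V

/-- The differential on pairs of families with values in a 2-term complex `δ : V₁ → V₀`, given by
differentials on the families with values in `V₁` and in `V₀`. -/
def totalDifferential (δ : V₁ →ₗ[𝕂] V₀) (D₁ : Fam M N V₁ →ₗ[𝕂] Fam M N V₁)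
    (D₀ : Fam M N V₀ →ₗ[𝕂] Fam M N V₀) :
    Fam M N V₁ × Fam M N V₀ →ₗ[𝕂] Fam M N V₁ × Fam M N V₀ :=
  LinearMap.prod (D₁ ∘ₗ LinearMap.fst 𝕂 _ _)
    (D₀ ∘ₗ LinearMap.snd 𝕂 _ _ + coeffTerm δ ∘ₗ LinearMap.fst 𝕂 _ _)

variable (V₁ V₀) in
/-- The pairs of weakly symmetric cochains of degree `n`. -/
def totalCochains (h : M →ₗ[𝕂] M →ₗ[𝕂] N) (n : ℤ) : Submodule 𝕂 (Fam M N V₁ × Fam M N V₀) :=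
  (weakCochains 𝕂 V₁ h (n + 1)).prod (weakCochains 𝕂 V₀ h n)

theorem twist_mem_weakCochains {h h' b : M →ₗ[𝕂] M →ₗ[𝕂] N} (hh : h - b - b.flip = h') {n : ℤ}
    {η : Fam M N V} (hη : η ∈ weakCochains 𝕂 V h n) : twist b η ∈ weakCochains 𝕂 V h' n := by
  rw [weakCochains_eq] at hη ⊢
  exact ⟨twist_concentrated hη.1 b, hh ▸ twist_mem hη.2 b⟩

theorem mem_weakFamilies {h : M →ₗ[𝕂] M →ₗ[𝕂] N} {n : ℤ} {η : Fam M N V}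
    (hη : η ∈ weakCochains 𝕂 V h n) : η ∈ weakFamilies V h := by
  rw [weakCochains_eq] at hη
  exact hη.2

/-- The twist is an isomorphism of complexes. -/
theorem nonempty_cohomology_equiv_twist {h : M →ₗ[𝕂] M →ₗ[𝕂] N} (b : M →ₗ[𝕂] M →ₗ[𝕂] N)
    (hb : ∀ x y, h x y = b x y + b y x) {δ : V₁ →ₗ[𝕂] V₀}
    {D₁ D₁' : Fam M N V₁ →ₗ[𝕂] Fam M N V₁} {D₀ D₀' : Fam M N V₀ →ₗ[𝕂] Fam M N V₀}
    (h₁ : ∀ η ∈ weakFamilies V₁ h, twist b (D₁ η) = D₁' (twist b η))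
    (h₀ : ∀ η ∈ weakFamilies V₀ h, twist b (D₀ η) = D₀' (twist b η)) (n : ℤ) :
    Nonempty (Cohomology (totalCochains V₁ V₀ h) (totalDifferential δ D₁ D₀) n ≃ₗ[𝕂]
      Cohomology (totalCochains V₁ V₀ (0 : M →ₗ[𝕂] M →ₗ[𝕂] N)) (totalDifferential δ D₁' D₀') n) := by
  have hh : h - b - b.flip = 0 := by
    ext x y
    simp [hb]
  have hh' : 0 - -b - (-b).flip = h := by
    ext x y
    simp [hb]
  let f : Fam M N V₁ × Fam M N V₀ →ₗ[𝕂] Fam M N V₁ × Fam M N V₀ :=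
    (twist b).prodMap (twist b)
  have hfinj : Function.Injective f := (twist_injective b).prodMap (twist_injective b)
  have hC : ∀ m, ∀ ω ∈ totalCochains V₁ V₀ h m,
      f ω ∈ totalCochains V₁ V₀ (0 : M →ₗ[𝕂] M →ₗ[𝕂] N) m := fun m ω hω =>
    ⟨twist_mem_weakCochains hh hω.1, twist_mem_weakCochains hh hω.2⟩
  have hsurj : ∀ m, ∀ ω' ∈ totalCochains V₁ V₀ (0 : M →ₗ[𝕂] M →ₗ[𝕂] N) m,
      ∃ ω ∈ totalCochains V₁ V₀ h m, f ω = ω' := by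
    rintro m ⟨ω₁, ω₀⟩ hω
    refine ⟨(twist (-b) ω₁, twist (-b) ω₀),
      ⟨twist_mem_weakCochains hh' hω.1, twist_mem_weakCochains hh' hω.2⟩, ?_⟩
    have e₁ := twist_neg_twist (mem_weakFamilies hω.1) (-b)
    have e₀ := twist_neg_twist (mem_weakFamilies hω.2) (-b)
    rw [neg_neg] at e₁ e₀
    exact Prod.ext e₁ e₀
  have hD : ∀ m, ∀ ω ∈ totalCochains V₁ V₀ h m,
      f (totalDifferential δ D₁ D₀ ω) = totalDifferential δ D₁' D₀' (f ω) := by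
    rintro m ⟨ω₁, ω₀⟩ hω
    refine Prod.ext (h₁ _ (mem_weakFamilies hω.1)) ?_
    change twist b (D₀ ω₀ + coeffTerm δ ω₁) = D₀' (twist b ω₀) + coeffTerm δ (twist b ω₁)
    rw [map_add, h₀ _ (mem_weakFamilies hω.2), twist_coeffTerm]
  refine nonempty_cohomology_equiv f hC hD n (fun ω' hω' h0 => ?_) (fun ω hω _ => ?_)
  · obtain ⟨ω, hω, rfl⟩ := hsurj n ω' hω'
    refine ⟨ω, hω, hfinj ?_, 0, zero_mem _, by simp⟩
    rw [hD n ω hω, h0, map_zero]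
  · rintro ⟨θ', hθ', e⟩
    obtain ⟨θ, hθ, rfl⟩ := hsurj _ θ' hθ'
    refine ⟨θ, hθ, hfinj ?_⟩
    rw [e, hD _ θ hθ]

/-! ### The Cartan formulas of the differentials -/

variable {h : M →ₗ[𝕂] M →ₗ[𝕂] N} {d : N →ₗ[𝕂] M} {ρ : M →ₗ[𝕂] Module.End 𝕂 V}
  {br : M →ₗ[𝕂] M →ₗ[𝕂] M} {w : M →ₗ[𝕂] Module.End 𝕂 N} {η : Fam M N V}
  {D : Fam M N V →ₗ[𝕂] Fam M N V}

theorem contract_insertTerm (hη : η ∈ weakFamilies V h) (d : N →ₗ[𝕂] M) (y : M) :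
    ι y (insertTerm d η) =
      lieDerivative 0 0 (-(h.flip y ∘ₗ d)) η - insertTerm d (ι y η) := by
  funext a k x α
  obtain ⟨F, hF⟩ := hη.1 a k
  have hA : lieDerivative 0 0 (-(h.flip y ∘ₗ d)) η a k x α =
      -∑ j : Fin k, η a k x (Function.update α j (h (d (α j)) y)) := by
    simp [lieDerivative, hF, MultilinearMap.map_update_zero, MultilinearMap.map_update_neg]
  rw [Pi.sub_apply, Pi.sub_apply, Pi.sub_apply, Pi.sub_apply, hA]
  cases k with
  | zero => simp [contract, insertTerm]
  | succ k =>
    change ∑ i : Fin (k + 1), η (a + 2) k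
        (Fin.cons (d (α i)) (Fin.cons y x : Fin (a + 1) → M) : Fin (a + 2) → M) (i.removeNth α) =
      -∑ i : Fin (k + 1), η a (k + 1) x (Function.update α i (h (d (α i)) y)) -
      ∑ i : Fin (k + 1), η (a + 2) k
        (Fin.cons y (Fin.cons (d (α i)) x : Fin (a + 1) → M) : Fin (a + 2) → M) (i.removeNth α)
    rw [← Finset.sum_neg_distrib, ← Finset.sum_sub_distrib]
    refine Finset.sum_congr rfl fun i _ => ?_
    have e := congrFun (congrFun (congrFun (congrFun
      (contract_anticomm hη y (d (α i))) a) k) x) (i.removeNth α)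
    rw [apply_update_eq hη, eq_sub_iff_add_eq]
    exact e

/-- The weak symmetry makes `insertTerm d` contribute the action `α ↦ h (d α) x` on `N`. -/
theorem isCartan_insertTerm_add_lpTerm (hw : ∀ x α, w x α = h (d α) x) :
    IsCartan h d ρ br w 0 0 (insertTerm d + lpTerm br ρ) where
  apply_zero η := by
    funext k x α
    simp [lpTerm, lpDifferential]
  contract η hη x := by
    have e : -w x = -(h.flip x ∘ₗ d) := by
      ext α
      simp [hw]
    have hA := lieDerivative_add hη 0 (ρ x) 0 (-br x) (-(h.flip x ∘ₗ d)) 0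
    rw [zero_add, zero_add, add_zero] at hA
    rw [LinearMap.add_apply, LinearMap.add_apply, map_add, contract_insertTerm hη,
      contract_lpTerm hη, e, hA, LinearMap.zero_apply, insertTwo_zero hη]
    abel
  contract' η hη α := by
    rw [LinearMap.add_apply, LinearMap.add_apply, map_add, contract'_insertTerm, contract'_lpTerm,
      LinearMap.zero_apply, insertOne_zero hη]
    abel

theorem IsCartan.add_mixedTerm {w' : M →ₗ[𝕂] Module.End 𝕂 N} {m : N →ₗ[𝕂] M →ₗ[𝕂] N}
    {t : M →ₗ[𝕂] M →ₗ[𝕂] M →ₗ[𝕂] N} (hD : IsCartan h d ρ br w t 0 D)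
    (hw : ∀ x α, w' x α = w x α - m α x) : IsCartan h d ρ br w' t m (D + mixedTerm m) where
  apply_zero η := by
    funext k x α
    rw [LinearMap.add_apply, Pi.add_apply, hD.apply_zero]
    simp [mixedTerm]
  contract η hη x := by
    have e : -w' x = -w x + m.flip x := by
      ext α
      simp [hw]
      abel
    have hA := lieDerivative_add hη (ρ x) 0 (-br x) 0 (-w x) (m.flip x)
    rw [add_zero, add_zero] at hA
    rw [LinearMap.add_apply, LinearMap.add_apply, map_add, contract_mixedTerm hη,
      hD.contract η hη, e, hA]
    abel
  contract' η hη α := by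
    rw [LinearMap.add_apply, LinearMap.add_apply, map_add, contract'_mixedTerm,
      hD.contract' η hη, LinearMap.zero_apply, insertOne_zero hη]
    abel

theorem IsCartan.add_ternaryTerm {q : N →ₗ[𝕂] M →ₗ[𝕂] N} {t : M →ₗ[𝕂] M →ₗ[𝕂] M →ₗ[𝕂] N}
    (hD : IsCartan h d ρ br w 0 q D) : IsCartan h d ρ br w t q (D + ternaryTerm t) where
  apply_zero η := by
    funext k x α
    rw [LinearMap.add_apply, Pi.add_apply, hD.apply_zero]
    simp [ternaryTerm]
  contract η hη x := by
    rw [LinearMap.add_apply, LinearMap.add_apply, map_add, contract_ternaryTerm,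
      hD.contract η hη, LinearMap.zero_apply, insertTwo_zero hη]
    abel
  contract' η hη α := by
    rw [LinearMap.add_apply, LinearMap.add_apply, map_add, contract'_ternaryTerm hη,
      hD.contract' η hη]
    abel

theorem innerTerm_zero (η : Fam M N V₀) : innerTerm (0 : N →ₗ[𝕂] V₀ →ₗ[𝕂] V₁) η = 0 := by
  funext a k x α
  cases k <;> simp [innerTerm]

/-- If `p` is a retraction of the differential of a hemistrict Lie 2-algebra, then the twist by
`p [x, y]` turns its differential into one in which only the bracket `[x, y] - d p [x, y]` is
left. -/
theorem HemistrictLie2Algebra.twist_comm (L : HemistrictLie2Algebra 𝕂 N M) {p : M →ₗ[𝕂] N}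
    (hp : ∀ α, p (L.d α) = α) (hbr : ∀ x y, br x y = L.br₀₀ x y - L.d (p (L.br₀₀ x y)))
    (hη : η ∈ weakFamilies V L.h) :
    twist (L.br₀₀.compr₂ p) ((insertTerm L.d + lpTerm L.br₀₀ ρ + mixedTerm L.br₁₀ :
      Fam M N V →ₗ[𝕂] Fam M N V) η) =
      (insertTerm L.d + lpTerm br ρ : Fam M N V →ₗ[𝕂] Fam M N V) (twist (L.br₀₀.compr₂ p) η) := by
  let w₀ : M →ₗ[𝕂] Module.End 𝕂 N := L.h.compl₂ L.d
  have hL : IsCartan L.h L.d ρ L.br₀₀ L.br₀₁ 0 L.br₁₀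
      (insertTerm L.d + lpTerm L.br₀₀ ρ + mixedTerm L.br₁₀) :=
    (isCartan_insertTerm_add_lpTerm (w := w₀) fun x α => L.h_symm x (L.d α)).add_mixedTerm
      fun x α => eq_sub_of_add_eq (L.skew₀₁ x α)
  refine hL.twist_comm _ br (isCartan_insertTerm_add_lpTerm fun x α => ?_) hbr (fun x α => ?_)
    (fun x y z => ?_) hη
  · change 0 = L.h (L.d α) x - p (L.br₀₀ (L.d α) x) - p (L.br₀₀ x (L.d α))
    rw [sub_sub, ← map_add, L.skew₀₀, hp, sub_self]
  · change _ = p (L.br₀₀ x (L.d α))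
    rw [← L.d_br₀₁, hp]
  · change 0 + (L.br₁₀ (p (L.br₀₀ x y)) z + L.br₀₁ y (p (L.br₀₀ x z)) -
      p (L.br₀₀ x (L.br₀₀ y z))) = -p (L.br₀₀ y (br x z)) - p (L.br₀₀ (br x y) z)
    rw [hbr, hbr, map_sub, map_sub, map_sub, LinearMap.sub_apply, map_sub, ← L.d_br₀₁,
      ← L.d_br₁₀, hp, hp, L.leibniz₀₀₀ x y z, map_add]
    abel

/-- The analogue of `HemistrictLie2Algebra.twist_comm` for semistrict Lie 2-algebras. -/
theorem SemistrictLie2Algebra.twist_comm (L : SemistrictLie2Algebra 𝕂 N M) {p : M →ₗ[𝕂] N}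
    (hp : ∀ α, p (L.d α) = α) (hbr : ∀ x y, br x y = L.l₂ x y - L.d (p (L.l₂ x y)))
    (hη : η ∈ weakFamilies V (0 : M →ₗ[𝕂] M →ₗ[𝕂] N)) :
    twist (L.l₂.compr₂ p) ((insertTerm L.d + lpTerm L.l₂ ρ + mixedTerm (-L.l₂'.flip) +
      ternaryTerm L.l₃ : Fam M N V →ₗ[𝕂] Fam M N V) η) =
      (insertTerm L.d + lpTerm br ρ : Fam M N V →ₗ[𝕂] Fam M N V) (twist (L.l₂.compr₂ p) η) := by
  have hL : IsCartan 0 L.d ρ L.l₂ L.l₂' L.l₃ (-L.l₂'.flip)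
      (insertTerm L.d + lpTerm L.l₂ ρ + mixedTerm (-L.l₂'.flip) + ternaryTerm L.l₃) :=
    ((isCartan_insertTerm_add_lpTerm (w := 0) fun x α => rfl).add_mixedTerm
      fun x α => by simp).add_ternaryTerm
  refine hL.twist_comm _ br (isCartan_insertTerm_add_lpTerm fun x α => ?_) hbr (fun x α => ?_)
    (fun x y z => ?_) hη
  · change 0 = 0 - p (L.l₂ (L.d α) x) - p (L.l₂ x (L.d α))
    rw [L.l₂_skew x, map_neg]
    abel
  · change _ = p (L.l₂ x (L.d α))
    rw [← L.d_l₂', hp]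
  · have e := congrArg p (L.jacobi₀ x y z)
    rw [hp, L.l₂_skew z x, L.l₂_skew z (L.l₂ x y)] at e
    change L.l₃ x y z + (-L.l₂' z (p (L.l₂ x y)) + L.l₂' y (p (L.l₂ x z)) -
      p (L.l₂ x (L.l₂ y z))) = -p (L.l₂ y (br x z)) - p (L.l₂ (br x y) z)
    rw [hbr, hbr, map_sub, map_sub, map_sub, LinearMap.sub_apply, map_sub, ← L.d_l₂',
      L.l₂_skew (L.d _) z, ← L.d_l₂', map_neg, hp, hp, ← e]
    simp only [map_add, map_neg]
    abel

/-- The cohomology of a hemistrict Lie 2-algebra with split injective differential, if the part `l₁₀` of the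
action vanishes, is computed by alternating cochains with the bracket `[x, y] - d p [x, y]`. -/
theorem HemistrictLie2Algebra.Rep.nonempty_H_equiv {L : HemistrictLie2Algebra 𝕂 N M}
    (R : L.Rep V₁ V₀) (hR : ∀ α, R.l₁₀ α = 0) {p : M →ₗ[𝕂] N} (hp : ∀ α, p (L.d α) = α)
    (hbr : ∀ x y, br x y = L.br₀₀ x y - L.d (p (L.br₀₀ x y))) (n : ℤ) :
    Nonempty (R.H n ≃ₗ[𝕂] Cohomology (totalCochains V₁ V₀ (0 : M →ₗ[𝕂] M →ₗ[𝕂] N))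
      (totalDifferential R.d (insertTerm L.d + lpTerm br R.l₀₁) (insertTerm L.d + lpTerm br R.l₀₀))
      n) := by
  have hdiff : R.differential = totalDifferential R.d
      (insertTerm L.d + lpTerm L.br₀₀ R.l₀₁ + mixedTerm L.br₁₀)
      (insertTerm L.d + lpTerm L.br₀₀ R.l₀₀ + mixedTerm L.br₁₀) := by
    refine LinearMap.ext fun ω => Prod.ext ?_ rfl
    change _ + innerTerm R.l₁₀ ω.2 = _
    rw [show R.l₁₀ = 0 from LinearMap.ext hR, innerTerm_zero, add_zero]
    rfl
  have hb : ∀ x y, L.h x y = L.br₀₀.compr₂ p x y + L.br₀₀.compr₂ p y x := by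
    intro x y
    change _ = p (L.br₀₀ x y) + p (L.br₀₀ y x)
    rw [← map_add, L.skew₀₀, hp]
  have := nonempty_cohomology_equiv_twist _ hb (δ := R.d)
    (fun η hη => L.twist_comm hp hbr hη (ρ := R.l₀₁))
    (fun η hη => L.twist_comm hp hbr hη (ρ := R.l₀₀)) n
  rwa [← hdiff] at this

/-- The cohomology of a semistrict Lie 2-algebra with split injective differential, if the part `l₁₀` of the
action vanishes, is computed by the same complex as in the hemistrict case. -/
theorem SemistrictLie2Algebra.Rep.nonempty_H_equiv [CharZero 𝕂] {L : SemistrictLie2Algebra 𝕂 N M}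
    (R : L.Rep V₁ V₀) (hR : ∀ α, R.l₁₀ α = 0) {p : M →ₗ[𝕂] N} (hp : ∀ α, p (L.d α) = α)
    (hbr : ∀ x y, br x y = L.l₂ x y - L.d (p (L.l₂ x y))) (n : ℤ) :
    Nonempty (R.H n ≃ₗ[𝕂] Cohomology (totalCochains V₁ V₀ (0 : M →ₗ[𝕂] M →ₗ[𝕂] N))
      (totalDifferential R.d (insertTerm L.d + lpTerm br R.l₀₁) (insertTerm L.d + lpTerm br R.l₀₀))
      n) := by
  have hdiff : R.differential = totalDifferential R.d
      (insertTerm L.d + lpTerm L.l₂ R.l₀₁ + mixedTerm (-L.l₂'.flip) + ternaryTerm L.l₃)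
      (insertTerm L.d + lpTerm L.l₂ R.l₀₀ + mixedTerm (-L.l₂'.flip) + ternaryTerm L.l₃) := by
    refine LinearMap.ext fun ω => Prod.ext ?_ rfl
    change _ + innerTerm R.l₁₀ ω.2 = _
    rw [show R.l₁₀ = 0 from LinearMap.ext hR, innerTerm_zero, add_zero]
    rfl
  have hcoch : R.cochains = totalCochains V₁ V₀ (0 : M →ₗ[𝕂] M →ₗ[𝕂] N) := by
    funext n
    simp only [SemistrictLie2Algebra.Rep.cochains, totalCochains, alternatingCochains_eq]
  have hb : ∀ x y, (0 : M →ₗ[𝕂] M →ₗ[𝕂] N) x y = L.l₂.compr₂ p x y + L.l₂.compr₂ p y x := by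
    intro x y
    change 0 = p (L.l₂ x y) + p (L.l₂ y x)
    rw [L.l₂_skew x y, map_neg, neg_add_cancel]
  have := nonempty_cohomology_equiv_twist _ hb (δ := R.d)
    (fun η hη => L.twist_comm hp hbr hη (ρ := R.l₀₁))
    (fun η hη => L.twist_comm hp hbr hη (ρ := R.l₀₀)) n
  change Nonempty (Cohomology R.cochains R.differential n ≃ₗ[𝕂] _)
  rwa [hcoch, hdiff]

/-! ### The complex of the quotient Lie algebra -/

variable {Q : Type*} [AddCommGroup Q] [Module 𝕂 Q]

variable (N V) in
/-- Pullback of families along `π : M → Q`, as families without `N`-arguments. -/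
def pullback (π : M →ₗ[𝕂] Q) : Fam₁ Q V →ₗ[𝕂] Fam M N V where
  toFun θ := fun a k => match k with
    | 0 => fun x _ => θ a (π ∘ x)
    | _ + 1 => fun _ _ => 0
  map_add' θ θ' := by
    funext a k x α
    cases k <;> simp
  map_smul' c θ := by
    funext a k x α
    cases k <;> simp

variable (N V) in
/-- Restriction along `s : Q → M` of the components without `N`-arguments. -/
def restrict (s : Q →ₗ[𝕂] M) : Fam M N V →ₗ[𝕂] Fam₁ Q V where
  toFun η := fun a y => η a 0 (s ∘ y) Fin.elim0
  map_add' _ _ := rfl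
  map_smul' _ _ := rfl

theorem lpDifferential_comp {brQ : Q →ₗ[𝕂] Q →ₗ[𝕂] Q} {ρQ : Q →ₗ[𝕂] Module.End 𝕂 V}
    {π : M →ₗ[𝕂] Q} (hbr : ∀ x y, π (br x y) = brQ (π x) (π y)) (hρ : ∀ x, ρ x = ρQ (π x))
    (θ : Fam₁ Q V) (a : ℕ) (x : Fin a → M) :
    lpDifferential br ρ (fun b y => θ b (π ∘ y)) a x = lpDifferential brQ ρQ θ a (π ∘ x) := by
  cases a with
  | zero => rfl
  | succ a =>
    have e : ∀ i j : Fin (a + 1), π ∘ (i.removeNth (Function.update x j (br (x i) (x j)))) =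
        i.removeNth (Function.update (π ∘ x) j (brQ (π (x i)) (π (x j)))) := by
      intro i j
      rw [← hbr, ← Function.comp_update]
      rfl
    simp only [lpDifferential, LinearMap.coe_mk, AddHom.coe_mk, hρ, e]
    rfl

theorem pullback_lpDifferential {brQ : Q →ₗ[𝕂] Q →ₗ[𝕂] Q} {ρQ : Q →ₗ[𝕂] Module.End 𝕂 V}
    {π : M →ₗ[𝕂] Q} (hπd : ∀ α, π (d α) = 0) (hbr : ∀ x y, π (br x y) = brQ (π x) (π y))
    (hρ : ∀ x, ρ x = ρQ (π x)) {n : ℤ} {θ : Fam₁ Q V}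
    (hθ : θ ∈ alternatingCochains₁ 𝕂 Q V n) :
    pullback N V π (lpDifferential brQ ρQ θ) =
      (insertTerm d + lpTerm br ρ : Fam M N V →ₗ[𝕂] Fam M N V) (pullback N V π θ) := by
  funext a k x α
  cases k with
  | zero =>
    refine (lpDifferential_comp hbr hρ θ a x).symm.trans ?_
    exact (zero_add _).symm
  | succ k =>
    have h₁ : lpTerm br ρ (pullback N V π θ) a (k + 1) x α = 0 :=
      congrFun (congrFun (map_zero (lpDifferential br ρ)) a) x
    have h₂ : insertTerm d (pullback N V π θ) a (k + 1) x α = 0 := by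
      change ∑ i : Fin (k + 1), pullback N V π θ (a + 1) k
        (Fin.cons (d (α i)) x : Fin (a + 1) → M) (i.removeNth α) = 0
      refine Finset.sum_eq_zero fun i _ => ?_
      cases k with
      | zero =>
        obtain ⟨F, hF⟩ := hθ.2 (a + 1)
        exact (hF _).trans (F.map_coord_zero 0 (hπd _))
      | succ k => rfl
    rw [LinearMap.add_apply, Pi.add_apply, Pi.add_apply, Pi.add_apply, Pi.add_apply, h₁, h₂,
      add_zero]
    rfl

theorem restrict_insertTerm_add_lpTerm {brQ : Q →ₗ[𝕂] Q →ₗ[𝕂] Q} {ρQ : Q →ₗ[𝕂] Module.End 𝕂 V}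
    {s : Q →ₗ[𝕂] M} (hbr : ∀ x y, s (brQ x y) = br (s x) (s y)) (hρ : ∀ x, ρQ x = ρ (s x))
    (η : Fam M N V) :
    restrict N V s ((insertTerm d + lpTerm br ρ : Fam M N V →ₗ[𝕂] Fam M N V) η) =
      lpDifferential brQ ρQ (restrict N V s η) := by
  funext a y
  refine Eq.trans ?_ (lpDifferential_comp hbr hρ (fun b y => η b 0 y Fin.elim0) a y).symm
  exact zero_add _

theorem pullback_mem [CharZero 𝕂] (π : M →ₗ[𝕂] Q) {n : ℤ} {θ : Fam₁ Q V}
    (hθ : θ ∈ alternatingCochains₁ 𝕂 Q V n) :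
    pullback N V π θ ∈ weakCochains 𝕂 V (0 : M →ₗ[𝕂] M →ₗ[𝕂] N) n := by
  rw [← alternatingCochains_eq]
  refine ⟨⟨fun a k hn => ?_, fun a k => ?_, fun a k x α σ => ?_⟩, fun a k x α i j hx hij => ?_⟩
  · funext x α
    cases k with
    | zero => exact congrFun (hθ.1 a (by simpa using hn)) _
    | succ k => rfl
  · cases k with
    | zero =>
      obtain ⟨F, hF⟩ := hθ.2 a
      exact ⟨MultilinearMap.mk' (fun x => MultilinearMap.constOfIsEmpty 𝕂 (fun _ : Fin 0 => N)
        (F.compLinearMap π x)) (fun x i u v => by ext; simp only [AlternatingMap.map_update_add]; rfl)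
        (fun x i c u => by ext; simp only [AlternatingMap.map_update_smul]; rfl),
        fun x α => hF _⟩
    | succ k => exact ⟨0, fun _ _ => rfl⟩
  · cases k <;> rfl
  · cases k with
    | zero =>
      obtain ⟨F, hF⟩ := hθ.2 a
      exact (hF _).trans (F.map_eq_zero_of_eq _ (congrArg π hx) hij)
    | succ k => rfl

theorem restrict_mem [CharZero 𝕂] (s : Q →ₗ[𝕂] M) {n : ℤ} {η : Fam M N V}
    (hη : η ∈ weakCochains 𝕂 V (0 : M →ₗ[𝕂] M →ₗ[𝕂] N) n) :
    restrict N V s η ∈ alternatingCochains₁ 𝕂 Q V n := by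
  rw [← alternatingCochains_eq] at hη
  obtain ⟨⟨h₁, h₂, -⟩, h₃⟩ := hη
  refine ⟨fun a hn => ?_, fun a => ?_⟩
  · funext y
    exact congrFun (congrFun (h₁ a 0 (by simpa using hn)) _) _
  · obtain ⟨F, hF⟩ := h₂ a 0
    let A : M [⋀^Fin a]→ₗ[𝕂] V :=
      { MultilinearMap.mk' (fun x => F x Fin.elim0) (fun x i u v => by simp)
          (fun x i c u => by simp) with
        map_eq_zero_of_eq' := fun x i j hx hij => (hF x _).symm.trans (h₃ _ _ _ _ i j hx hij) }
    exact ⟨A.compLinearMap s, fun x => hF _ _⟩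

theorem restrict_pullback {π : M →ₗ[𝕂] Q} {s : Q →ₗ[𝕂] M} (hπs : ∀ y, π (s y) = y)
    (θ : Fam₁ Q V) : restrict N V s (pullback N V π θ) = θ := by
  funext a y
  change θ a _ = θ a y
  congr 1
  funext i
  exact hπs _

theorem pullback_restrict {π : M →ₗ[𝕂] Q} {s : Q →ₗ[𝕂] M} {p : M →ₗ[𝕂] N}
    (hsπ : ∀ x, s (π x) = x - d (p x)) (η : Fam M N V) :
    pullback N V π (restrict N V s η) = weightZero d p η := by
  funext a k x α
  cases k with
  | zero =>
    rw [Subsingleton.elim α Fin.elim0]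
    change η a 0 _ _ = η a 0 _ _
    congr 1
    funext i
    exact hsπ _
  | succ k => rfl

theorem restrict_coeffTerm (s : Q →ₗ[𝕂] M) (f : V₁ →ₗ[𝕂] V₀) (η : Fam M N V₁) :
    restrict N V₀ s (coeffTerm f η) = coeffTerm₁ f (restrict N V₁ s η) := rfl

theorem pullback_coeffTerm₁ (π : M →ₗ[𝕂] Q) (f : V₁ →ₗ[𝕂] V₀) (θ : Fam₁ Q V₁) :
    pullback N V₀ π (coeffTerm₁ f θ) = coeffTerm f (pullback N V₁ π θ) := by
  funext a k x α
  cases k with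
  | zero => rfl
  | succ k => simp [pullback, coeffTerm]

end Comparison

section Final

variable {𝕂 M N V₁ V₀ : Type*} [Field 𝕂] [CharZero 𝕂] [AddCommGroup M] [Module 𝕂 M]
  [AddCommGroup N] [Module 𝕂 N] [AddCommGroup V₁] [Module 𝕂 V₁] [AddCommGroup V₀] [Module 𝕂 V₀]

theorem insertOne_weightInv_mem {d : N →ₗ[𝕂] M} {p : M →ₗ[𝕂] N} {n : ℤ} {η : Fam M N V₁}
    (hη : η ∈ weakCochains 𝕂 V₁ (0 : M →ₗ[𝕂] M →ₗ[𝕂] N) n) :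
    insertOne p (weightInv d p 0 η) ∈ weakCochains 𝕂 V₁ (0 : M →ₗ[𝕂] M →ₗ[𝕂] N) (n - 1) := by
  rw [weakCochains_eq] at hη ⊢
  exact ⟨insertOne_concentrated (weightInv_concentrated hη.1 0) p,
    insertOne_mem (weightInv_mem hη.2 0) p⟩

/-- Let `M = s(𝔥) ⊕ d(N)` as Lie algebras, where `d(N)` is an abelian ideal which commutes with
`s(𝔥)` and acts trivially on the coefficients. Then the pullback along the projection `π : M → 𝔥` is
a quasi-isomorphism. -/
theorem LieComplex.nonempty_H_equiv {𝔥 : Type*} [LieRing 𝔥] [LieAlgebra 𝕂 𝔥]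
    (R : LieComplex 𝕂 𝔥 V₁ V₀) {d : N →ₗ[𝕂] M} {p : M →ₗ[𝕂] N} {π : M →ₗ[𝕂] 𝔥} {s : 𝔥 →ₗ[𝕂] M}
    (hp : ∀ α, p (d α) = α) (hπs : ∀ y, π (s y) = y) (hsπ : ∀ x, s (π x) = x - d (p x))
    {br : M →ₗ[𝕂] M →ₗ[𝕂] M} (hbr : ∀ x y, br x y = s ⁅π x, π y⁆)
    {ρ₁ : M →ₗ[𝕂] Module.End 𝕂 V₁} {ρ₀ : M →ₗ[𝕂] Module.End 𝕂 V₀}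
    (hρ₁ : ∀ x, ρ₁ x = R.ρ₁ (π x)) (hρ₀ : ∀ x, ρ₀ x = R.ρ₀ (π x)) (n : ℤ) :
    Nonempty (R.H n ≃ₗ[𝕂] Cohomology (totalCochains V₁ V₀ (0 : M →ₗ[𝕂] M →ₗ[𝕂] N))
      (totalDifferential R.d (insertTerm d + lpTerm br ρ₁) (insertTerm d + lpTerm br ρ₀)) n) := by
  have hπd : ∀ α, π (d α) = 0 := fun α => by
    rw [← hπs (π (d α)), hsπ, hp, sub_self, map_zero]
  have hps : ∀ y, p (s y) = 0 := fun y => by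
    rw [← hπs y, hsπ, map_sub, hp, sub_self]
  have hpbr : ∀ x y, p (br x y) = 0 := fun x y => by rw [hbr, hps]
  have hbr₁ : ∀ α, br (d α) = 0 := fun α => by
    ext y
    rw [hbr, hπd, zero_lie, map_zero, LinearMap.zero_apply]
  have hbr₂ : ∀ x α, br x (d α) = 0 := fun x α => by rw [hbr, hπd, lie_zero, map_zero]
  have hπbr : ∀ x y, π (br x y) = LieComplex.lieBr 𝕂 𝔥 (π x) (π y) := fun x y => by
    rw [hbr, hπs]
    rfl
  have hsbr : ∀ x y, s (LieComplex.lieBr 𝕂 𝔥 x y) = br (s x) (s y) := fun x y => by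
    rw [hbr, hπs, hπs]
    rfl
  set D₁ : Fam M N V₁ →ₗ[𝕂] Fam M N V₁ := insertTerm d + lpTerm br ρ₁ with hD₁
  set D₀ : Fam M N V₀ →ₗ[𝕂] Fam M N V₀ := insertTerm d + lpTerm br ρ₀ with hD₀
  have hC₁ : IsCartan (0 : M →ₗ[𝕂] M →ₗ[𝕂] N) d ρ₁ br 0 0 0 D₁ :=
    isCartan_insertTerm_add_lpTerm fun x α => rfl
  have hC₀ : IsCartan (0 : M →ₗ[𝕂] M →ₗ[𝕂] N) d ρ₀ br 0 0 0 D₀ :=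
    isCartan_insertTerm_add_lpTerm fun x α => rfl
  let f : Fam₁ 𝔥 V₁ × Fam₁ 𝔥 V₀ →ₗ[𝕂] Fam M N V₁ × Fam M N V₀ :=
    (pullback N V₁ π).prodMap (pullback N V₀ π)
  let g : Fam M N V₁ × Fam M N V₀ →ₗ[𝕂] Fam₁ 𝔥 V₁ × Fam₁ 𝔥 V₀ :=
    (restrict N V₁ s).prodMap (restrict N V₀ s)
  have hg : ∀ ω, g (totalDifferential R.d D₁ D₀ ω) = R.differential (g ω) := by
    rintro ⟨ω₁, ω₀⟩
    refine Prod.ext (restrict_insertTerm_add_lpTerm hsbr (fun x => ?_) ω₁) ?_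
    · rw [hρ₁, hπs]
    · change restrict N V₀ s (D₀ ω₀ + coeffTerm R.d ω₁) = lpDifferential _ R.ρ₀ _ + coeffTerm₁ _ _
      rw [map_add, restrict_coeffTerm, hD₀,
        restrict_insertTerm_add_lpTerm hsbr (fun x => by rw [hρ₀, hπs])]
      rfl
  have hgmem : ∀ m, ∀ ω ∈ totalCochains V₁ V₀ (0 : M →ₗ[𝕂] M →ₗ[𝕂] N) m, g ω ∈ R.cochains m :=
    fun m ω hω => ⟨restrict_mem s hω.1, restrict_mem s hω.2⟩
  have hfmem : ∀ m, ∀ ω ∈ R.cochains m,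
      f ω ∈ totalCochains V₁ V₀ (0 : M →ₗ[𝕂] M →ₗ[𝕂] N) m :=
    fun m ω hω => ⟨pullback_mem π hω.1, pullback_mem π hω.2⟩
  have hgf : ∀ ω, g (f ω) = ω := fun ω =>
    Prod.ext (restrict_pullback (N := N) (V := V₁) hπs ω.1)
      (restrict_pullback (N := N) (V := V₀) hπs ω.2)
  refine nonempty_cohomology_equiv f hfmem ?_ n ?_ ?_
  · rintro m ⟨ω₁, ω₀⟩ hω
    refine Prod.ext (pullback_lpDifferential hπd hπbr hρ₁ hω.1) ?_
    change pullback N V₀ π (lpDifferential _ R.ρ₀ ω₀ + coeffTerm₁ R.d ω₁) =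
      D₀ (pullback N V₀ π ω₀) + coeffTerm R.d (pullback N V₁ π ω₁)
    rw [map_add, pullback_coeffTerm₁, pullback_lpDifferential hπd hπbr hρ₀ hω.2]
  · rintro ⟨ω₁, ω₀⟩ hω h0
    refine ⟨g (ω₁, ω₀), hgmem n _ hω, by rw [← hg, h0, map_zero],
      (insertOne p (weightInv d p 0 ω₁), insertOne p (weightInv d p 0 ω₀)), ?_, ?_⟩
    · refine ⟨?_, insertOne_weightInv_mem hω.2⟩
      have := insertOne_weightInv_mem (d := d) (p := p) hω.1
      rwa [add_sub_right_comm] at this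
    · have h₁ : D₁ ω₁ = 0 := congrArg Prod.fst h0
      have h₀ : D₀ ω₀ = -coeffTerm R.d ω₁ := eq_neg_of_add_eq_zero_left (congrArg Prod.snd h0)
      refine Prod.ext ?_ ?_
      · change ω₁ - pullback N V₁ π (restrict N V₁ s ω₁) = D₁ _
        rw [pullback_restrict hsπ, hC₁.sub_weightZero hp hpbr hbr₁ hbr₂
          (fun α => by rw [hρ₁, hπd, map_zero]) (mem_weakFamilies hω.1), h₁, map_zero, map_zero,
          add_zero]
        rfl
      · change ω₀ - pullback N V₀ π (restrict N V₀ s ω₀) = D₀ _ + coeffTerm R.d _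
        rw [pullback_restrict hsπ, hC₀.sub_weightZero hp hpbr hbr₁ hbr₂
          (fun α => by rw [hρ₀, hπd, map_zero]) (mem_weakFamilies hω.2), h₀, map_neg, map_neg,
          weightInv_coeffTerm, insertOne_coeffTerm, neg_neg]
        rfl
  · rintro ω hω - ⟨θ, hθ, e⟩
    refine ⟨g θ, hgmem _ θ hθ, ?_⟩
    rw [← hg, ← e, hgf]

end Final

end LieTwo

theorem theorem4p7 {𝕂 : Type*} [RCLike 𝕂]
    {𝔤 : Type*} [AddCommGroup 𝔤] [Module 𝕂 𝔤] [LieTwo.LeibnizAlgebra 𝕂 𝔤]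
    {V₁ V₀ : Type*} [AddCommGroup V₁] [Module 𝕂 V₁] [AddCommGroup V₀] [Module 𝕂 V₀]
    (V : (LieTwo.LeibnizAlgebra.hemistrict 𝕂 𝔤).Rep V₁ V₀)
    (hV : ∀ α : LieTwo.LeibnizAlgebra.kernel 𝕂 𝔤, V.l₁₀ α = 0) :
    ∀ n : ℤ, Nonempty (V.H n ≃ₗ[𝕂] V.skewSymmetrization.H n) ∧
      Nonempty (V.skewSymmetrization.H n ≃ₗ[𝕂] (LieTwo.LeibnizAlgebra.lieComplex V hV).H n) := by
  intro n
  let K := LieTwo.LeibnizAlgebra.kernel 𝕂 𝔤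
  let L := LieTwo.LeibnizAlgebra.hemistrict 𝕂 𝔤
  -- a linear retraction of the inclusion `K → 𝔤`
  obtain ⟨p, hp⟩ := K.subtype.exists_leftInverse_of_injective K.ker_subtype
  have hpd : ∀ α : K, p (L.d α) = α := fun α => LinearMap.congr_fun hp α
  let τ : 𝔤 →ₗ[𝕂] 𝔤 := LinearMap.id - L.d ∘ₗ p
  have hτ : ∀ x, τ x = x - L.d (p x) := fun x => rfl
  have hτd : ∀ α, τ (L.d α) = 0 := fun α => by rw [hτ, hpd, sub_self]
  -- the section of `𝔤 → 𝔤 / K` with image `ker p`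
  let s : (𝔤 ⧸ K) →ₗ[𝕂] 𝔤 := K.liftQ τ fun k hk => hτd ⟨k, hk⟩
  let br : 𝔤 →ₗ[𝕂] 𝔤 →ₗ[𝕂] 𝔤 := L.br₀₀.compr₂ τ
  -- symmetrization changes the bracket by elements of `K`, which `τ` annihilates
  have hskew : ∀ x y, br x y = L.skewBr x y - L.d (p (L.skewBr x y)) := by
    intro x y
    have e : L.br₀₀ x y = L.skewBr x y + L.d ((1 / 2 : 𝕂) • L.h x y) := by
      rw [L.skewBr_apply, map_smul, ← L.skew₀₀]
      module
    change τ (L.br₀₀ x y) = τ (L.skewBr x y)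
    rw [e, map_add, hτd, add_zero]
  obtain ⟨e₁⟩ := V.nonempty_H_equiv hV hpd (br := br) (fun _ _ => rfl) n
  obtain ⟨e₂⟩ := V.skewSymmetrization.nonempty_H_equiv hV hpd hskew n
  obtain ⟨e₃⟩ := (LieTwo.LeibnizAlgebra.lieComplex V hV).nonempty_H_equiv (d := L.d) (p := p)
    (π := K.mkQ) (s := s) (br := br) (ρ₁ := V.l₀₁) (ρ₀ := V.l₀₀) hpd
    (fun y => by
      induction y using Submodule.Quotient.induction_on with | _ x =>
      change K.mkQ (x - L.d (p x)) = K.mkQ x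
      rw [map_sub, sub_eq_self]
      exact (Submodule.Quotient.mk_eq_zero K).mpr (p x).2)
    (fun x => rfl) (fun x y => rfl) (fun x => rfl) (fun x => rfl) n
  exact ⟨⟨e₁.trans e₂.symm⟩, ⟨e₂.trans e₃.symm⟩⟩
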